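/- **Theorem 2 (Regulation for hyperbolic PDE systems).** Let $0\le\ell\le n$ and $m\ge 0$ be integers. Let $\Lambda_0=\mathrm{diag}(\lambda_1,\dots,\lambda_n)$ and $\Lambda_1$ be $C^1$ functions on $[0,1]$ with values in $\mathbb R^{n\times n}$, with $\lambda_i(s)>0$ for $i\le\ell$ and $\lambda_i(s)<0$ for $i>\ell$, for all $s\in[0,1]$. Write $x=(x_+,x_-)\in\mathbb R^\ell\times\mathbb R^{n-\ell}$ for $x\in\mathbb R^n$. Let $K=\begin{bmatrix}K_{11}&K_{12}\\K_{21}&K_{22}\end{bmatrix}\in\mathbb R^{n\times n}$, $B=\begin{bmatrix}B_1\\B_2\end{bmatrix}\in\mathbb R^{n\times m}$ (blocks according to $(+,-)$) and $L_1,L_2\in\mathbb R^{m\times n}$. For $k_i>0$, $K_i\in\mathbb R^{m\times m}$, $w_b\in\mathbb R^n$ and $w_y,y_{ref}\in\mathbb R^m$ consider the closed loop, for $t\ge0$ and $s\in(0,1)$, $$\phi_t+\Lambda_0(s)\phi_s+\Lambda_1(s)\phi=0,\qquad \begin{bmatrix}\phi_+(t,0)\\\phi_-(t,1)\end{bmatrix}=K\begin{bmatrix}\phi_+(t,1)\\\phi_-(t,0)\end{bmatrix}+Bu(t)+w_b,\tag{1}$$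 $$u=k_iK_iz,\qquad z_t=y-y_{ref},\qquad y(t)=L_1\begin{bmatrix}\phi_+(t,0)\\\phi_-(t,1)\end{bmatrix}+L_2\begin{bmatrix}\phi_+(t,1)\\\phi_-(t,0)\end{bmatrix}+w_y,\tag{2}$$ with state $v=(\phi,z)$ in $\mathcal X_e=L^2((0,1);\mathbb R^n)\times\mathbb R^m$, $\|v\|_{\mathcal X_e}=\|\phi\|_{L^2}+|z|$, and let $\mathcal X_{e1}=H^1((0,1);\mathbb R^n)\times\mathbb R^m$. Put $$K_+=\begin{bmatrix}I&0\\K_{21}&K_{22}\end{bmatrix},\qquad K_-=\begin{bmatrix}K_{11}&K_{12}\\0&I\end{bmatrix}.$$ Assume the following. * *(Input-to-state exponential stability.)* There are a $C^1$ function $P$ on $[0,1]$ with values in the diagonal $n\times n$ matrices, numbers $\mu>0$, $\underline P>0$, $\overline P$ and a positive definite $S\in\mathbb R^{n\times n}$ such that for all $s\in[0,1]$: $(P\Lambda_0)_s-P\Lambda_1-\Lambda_1^\top P\le-\mu P$ and $\underline P\,I\le P(s)\le\overline P\,I$; and $-K_+^\top P(1)\Lambda_0(1)K_++K_-^\top P(0)\Lambda_0(0)K_-\le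 -S$. * *(Rank condition 1.)* Let $\Phi_s=-\Lambda_0^{-1}\Lambda_1\Phi$, $\Phi(0)=I$, $\Phi_+=\begin{bmatrix}\Phi_{11}(1)&\Phi_{12}(1)\\0&I\end{bmatrix}$ and $\Phi_-=\begin{bmatrix}I&0\\\Phi_{21}(1)&\Phi_{22}(1)\end{bmatrix}$. The matrices $\Phi_--K\Phi_+$ and $T_1=(L_1\Phi_-+L_2\Phi_+)(\Phi_--K\Phi_+)^{-1}B$ are invertible. * *(Rank condition 2.)* Let $\Psi_s=\Psi(\Lambda_1-\Lambda_{0s})\Lambda_0^{-1}$, $\Psi(0)=I$. The matrices $\Psi(1)\Lambda_0(1)K_+-\Lambda_0(0)K_-$ and $$T_2=-L_1B+M\Big(\Lambda_0(0)\begin{bmatrix}B_1\\0\end{bmatrix}-\Psi(1)\Lambda_0(1)\begin{bmatrix}0\\B_2\end{bmatrix}\Big),\quad M=(L_1K+L_2)\big(\Lambda_0(0)K_--\Psi(1)\Lambda_0(1)K_+\big)^{-1},$$ are invertible. Let $K_i=T_2^{-1}$. Then there is $k_i^*>0$ such that for every $0<k_i<k_i^*$ there are $k,\nu>0$ such that for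 all $w_b\in\mathbb R^n$ and $w_y,y_{ref}\in\mathbb R^m$: 1. For every $v_0\in\mathcal X_e$ there is a unique weak solution $v\in C^0([0,\infty);\mathcal X_e)$ of (1)–(2) with $v(0)=v_0$. If $v_0=(\phi_0,z_0)\in\mathcal X_{e1}$ satisfies the compatibility condition, i.e. the boundary condition in (1) holds for $\phi_0$ with $u=k_iK_iz_0$, then there is a unique strong solution $v\in C^0([0,\infty);\mathcal X_{e1})\cap C^1([0,\infty);\mathcal X_e)$ with $v(0)=v_0$, and it is also the weak solution. 2. There is an equilibrium $v_\infty\in\mathcal X_e$ of (1)–(2) such that for every $v_0\in\mathcal X_e$ the weak solution $v$ with $v(0)=v_0$ satisfies $\|v(t)-v_\infty\|_{\mathcal X_e}\le k\,e^{-\nu t}\|v_0-v_\infty\|_{\mathcal X_e}$ for all $t\ge0$. 3. If $v_0\in\mathcal X_{e1}$ satisfies the compatibility condition, then $\lim_{t\to+\infty}|y(t)-y_{ref}|=0$ along the strong solution with $v(0)=v_0$. Here a weak solution with initial value $v_0=(\phi_0,z_0)$ is a $v=(\phi,z)\in C^0([0,\infty);\mathcal X_e)$ with $v(0)=v_0$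 such that, with $b(t)=Bk_iK_iz(t)+w_b$, $$\int_0^T\!\!\int_0^1(\psi_t+\Lambda_0\psi_s+\Lambda_{0s}\psi-\Lambda_1^\top\psi)^\top\phi\,ds\,dt+\int_0^1\psi(0,s)^\top\phi_0(s)\,ds+\int_0^T\zeta_t^\top z\,dt+\zeta(0)^\top z_0$$ $$+\int_0^T\Big(\psi(t,0)^\top\Lambda_0(0)\begin{bmatrix}b_+\\0\end{bmatrix}-\psi(t,1)^\top\Lambda_0(1)\begin{bmatrix}0\\b_-\end{bmatrix}+\zeta^\top(L_1b+w_y-y_{ref})\Big)dt=0$$ for all $T>0$ and all $C^1$ functions $\psi:[0,T]\times[0,1]\to\mathbb R^n$, $\zeta:[0,T]\to\mathbb R^m$ with $\psi(T,\cdot)=0$, $\zeta(T)=0$ and $K_+^\top\Lambda_0(1)\psi(t,1)-K_-^\top\Lambda_0(0)\psi(t,0)=(L_1K+L_2)^\top\zeta(t)$ on $[0,T]$. A strong solution satisfies the differential equation in (1) in $L^2((0,1);\mathbb R^n)$, and the boundary condition and (2), at every $t\ge0$; an equilibrium is a constant strong solution. -/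

import Mathlib

open MeasureTheory Set Filter Topology
open scoped Matrix ContDiff

noncomputable section

namespace HypReg

/-- The index set of the `n = p + q` components of `φ`: the first `p` of them (`ℓ = p`) form `φ₊`,
the last `q = n - ℓ` form `φ₋`. -/
abbrev Idx (p q : ℕ) : Type := Fin p ⊕ Fin q

/-- `L²((0,1), ℝⁿ)`. -/
abbrev L2 (p q : ℕ) : Type :=
  Lp (EuclideanSpace ℝ (Idx p q)) 2 (volume.restrict (Ioo (0 : ℝ) 1))

/-- The state space `L²((0,1), ℝⁿ) × ℝᵐ`. -/
abbrev State (p q m : ℕ) : Type := L2 p q × EuclideanSpace ℝ (Fin m)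

/-- The norm `‖φ‖_{L²} + |z|` of the state space (equivalent to the maximum norm that the product
type carries). -/
def stateNorm {p q m : ℕ} (v : State p q m) : ℝ := ‖v.1‖ + ‖v.2‖

/-- `g` is the weak derivative of `φ` on `(0,1)`. -/
def HasWeakDeriv {p q : ℕ} (φ g : L2 p q) : Prop :=
  ∀ θ : ℝ → ℝ, ContDiff ℝ ∞ θ → HasCompactSupport θ → tsupport θ ⊆ Ioo (0 : ℝ) 1 →
    ∀ i : Idx p q,
      ∫ s in Ioo (0 : ℝ) 1, deriv θ s * φ s i = -∫ s in Ioo (0 : ℝ) 1, θ s * g s i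

/-- `φ` belongs to `H¹((0,1), ℝⁿ)`. -/
def MemH1 {p q : ℕ} (φ : L2 p q) : Prop := ∃ g : L2 p q, HasWeakDeriv φ g

open Classical in
/-- The representative of `φ` that is continuous on `[0,1]`. Every `φ` in `H¹` has one, and it is
unique on `[0,1]`; the value is `0` for a `φ` that has none. -/
def contRep {p q : ℕ} (φ : L2 p q) : ℝ → Idx p q → ℝ :=
  if h : ∃ f : ℝ → Idx p q → ℝ, ContinuousOn f (Icc 0 1) ∧
      ∀ᵐ s ∂(volume.restrict (Ioo (0 : ℝ) 1)), WithLp.ofLp (φ s) = f s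
  then h.choose else 0

/-- The boundary values `(f₊(0), f₋(1))`. -/
def traceIn {p q : ℕ} (f : ℝ → Idx p q → ℝ) : Idx p q → ℝ :=
  Sum.elim (fun i => f 0 (Sum.inl i)) (fun j => f 1 (Sum.inr j))

/-- The boundary values `(f₊(1), f₋(0))`. -/
def traceOut {p q : ℕ} (f : ℝ → Idx p q → ℝ) : Idx p q → ℝ :=
  Sum.elim (fun i => f 1 (Sum.inl i)) (fun j => f 0 (Sum.inr j))

/-- `(x₊, 0)`. -/
def plusPart {p q : ℕ} (x : Idx p q → ℝ) : Idx p q → ℝ :=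
  Sum.elim (fun i => x (Sum.inl i)) (fun _ => 0)

/-- `(0, x₋)`. -/
def minusPart {p q : ℕ} (x : Idx p q → ℝ) : Idx p q → ℝ :=
  Sum.elim (fun _ => 0) (fun j => x (Sum.inr j))

/-- The data of the hyperbolic system: the coefficients `Λ₀ = diag(lam)` and `Λ₁`, both `C¹` on
`[0,1]`, the boundary matrices `K` and `B`, and the output matrices `L₁` and `L₂`. -/
structure HypSystem (p q m : ℕ) where
  lam : ℝ → Idx p q → ℝ
  Lam1 : ℝ → Matrix (Idx p q) (Idx p q) ℝ
  K : Matrix (Idx p q) (Idx p q) ℝ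
  B : Matrix (Idx p q) (Fin m) ℝ
  L1 : Matrix (Fin m) (Idx p q) ℝ
  L2 : Matrix (Fin m) (Idx p q) ℝ
  lam_contDiffOn : ∀ i, ContDiffOn ℝ 1 (fun s => lam s i) (Icc 0 1)
  lam_pos : ∀ s ∈ Icc (0 : ℝ) 1, ∀ i : Fin p, 0 < lam s (Sum.inl i)
  lam_neg : ∀ s ∈ Icc (0 : ℝ) 1, ∀ j : Fin q, lam s (Sum.inr j) < 0
  Lam1_contDiffOn : ∀ i j, ContDiffOn ℝ 1 (fun s => Lam1 s i j) (Icc 0 1)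

namespace HypSystem

variable {p q m : ℕ} (S : HypSystem p q m)

/-- `Λ₀(s)`. -/
def Lam0 (s : ℝ) : Matrix (Idx p q) (Idx p q) ℝ := Matrix.diagonal (S.lam s)

/-- The derivative of `Λ₀` at `s ∈ [0,1]`. -/
def Lam0' (s : ℝ) : Matrix (Idx p q) (Idx p q) ℝ :=
  Matrix.diagonal fun i => derivWithin (fun σ => S.lam σ i) (Icc 0 1) s

/-- `K₊ = [[I, 0], [K₂₁, K₂₂]]`. -/
def Kplus : Matrix (Idx p q) (Idx p q) ℝ :=
  Matrix.fromBlocks 1 0 S.K.toBlocks₂₁ S.K.toBlocks₂₂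

/-- `K₋ = [[K₁₁, K₁₂], [0, I]]`. -/
def Kminus : Matrix (Idx p q) (Idx p q) ℝ :=
  Matrix.fromBlocks S.K.toBlocks₁₁ S.K.toBlocks₁₂ 0 1

/-- The input-to-state exponential stability assumption, with `P = diag(P)`, and with the matrix
inequality `X ≤ Y` written as positive semidefiniteness of `Y - X`. -/
def ISSAssumption : Prop :=
  ∃ (P : ℝ → Idx p q → ℝ) (μ Plow Pup : ℝ) (Q : Matrix (Idx p q) (Idx p q) ℝ),
    (∀ i, ContDiffOn ℝ 1 (fun s => P s i) (Icc 0 1)) ∧ 0 < μ ∧ 0 < Plow ∧ Q.PosDef ∧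
    (∀ s ∈ Icc (0 : ℝ) 1,
      (-(μ • Matrix.diagonal (P s)) -
        (Matrix.diagonal (fun i => derivWithin (fun σ => P σ i * S.lam σ i) (Icc 0 1) s)
          - Matrix.diagonal (P s) * S.Lam1 s
          - (S.Lam1 s)ᵀ * Matrix.diagonal (P s))).PosSemidef) ∧
    (∀ s ∈ Icc (0 : ℝ) 1, ∀ i, Plow ≤ P s i ∧ P s i ≤ Pup) ∧
    (-Q - (-(S.Kplusᵀ * Matrix.diagonal (P 1) * S.Lam0 1 * S.Kplus)
      + S.Kminusᵀ * Matrix.diagonal (P 0) * S.Lam0 0 * S.Kminus)).PosSemidef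

/-- `Φ' = -Λ₀⁻¹ Λ₁ Φ` on `[0,1]`, `Φ(0) = I`: the fundamental matrix of the stationary equation
`Λ₀ φ' + Λ₁ φ = 0`. -/
def IsPhi (Φ : ℝ → Matrix (Idx p q) (Idx p q) ℝ) : Prop :=
  Φ 0 = 1 ∧ ∀ s ∈ Icc (0 : ℝ) 1, ∀ i j,
    HasDerivWithinAt (fun σ => Φ σ i j) ((-((S.Lam0 s)⁻¹ * S.Lam1 s * Φ s)) i j) (Icc 0 1) s

/-- `Ψ' = Ψ (Λ₁ - Λ₀') Λ₀⁻¹` on `[0,1]`, `Ψ(0) = I`. -/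
def IsPsi (Ψ : ℝ → Matrix (Idx p q) (Idx p q) ℝ) : Prop :=
  Ψ 0 = 1 ∧ ∀ s ∈ Icc (0 : ℝ) 1, ∀ i j,
    HasDerivWithinAt (fun σ => Ψ σ i j)
      ((Ψ s * (S.Lam1 s - S.Lam0' s) * (S.Lam0 s)⁻¹) i j) (Icc 0 1) s

/-- `Φ₊(1) = [[Φ₁₁(1), Φ₁₂(1)], [0, I]]`, from `F = Φ(1)`. -/
def PhiPlus (F : Matrix (Idx p q) (Idx p q) ℝ) : Matrix (Idx p q) (Idx p q) ℝ :=
  Matrix.fromBlocks F.toBlocks₁₁ F.toBlocks₁₂ 0 1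

/-- `Φ₋(1) = [[I, 0], [Φ₂₁(1), Φ₂₂(1)]]`, from `F = Φ(1)`. -/
def PhiMinus (F : Matrix (Idx p q) (Idx p q) ℝ) : Matrix (Idx p q) (Idx p q) ℝ :=
  Matrix.fromBlocks 1 0 F.toBlocks₂₁ F.toBlocks₂₂

/-- `T₁`. -/
def T1 (Φ : ℝ → Matrix (Idx p q) (Idx p q) ℝ) : Matrix (Fin m) (Fin m) ℝ :=
  (S.L1 * PhiMinus (Φ 1) + S.L2 * PhiPlus (Φ 1)) *
    (PhiMinus (Φ 1) - S.K * PhiPlus (Φ 1))⁻¹ * S.B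

/-- The first rank condition. -/
def RankCondition1 (Φ : ℝ → Matrix (Idx p q) (Idx p q) ℝ) : Prop :=
  IsUnit (PhiMinus (Φ 1) - S.K * PhiPlus (Φ 1)) ∧ IsUnit (S.T1 Φ)

/-- `M = (L₁ K + L₂) (Λ₀(0) K₋ - Ψ(1) Λ₀(1) K₊)⁻¹`. -/
def Mmat (Ψ : ℝ → Matrix (Idx p q) (Idx p q) ℝ) : Matrix (Fin m) (Idx p q) ℝ :=
  (S.L1 * S.K + S.L2) * (S.Lam0 0 * S.Kminus - Ψ 1 * S.Lam0 1 * S.Kplus)⁻¹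

/-- `[B₁; 0]`. -/
def Bplus : Matrix (Idx p q) (Fin m) ℝ := Matrix.fromRows S.B.toRows₁ 0

/-- `[0; B₂]`. -/
def Bminus : Matrix (Idx p q) (Fin m) ℝ := Matrix.fromRows 0 S.B.toRows₂

/-- `T₂ = -L₁ B + M (Λ₀(0) [B₁; 0] - Ψ(1) Λ₀(1) [0; B₂])`. -/
def T2 (Ψ : ℝ → Matrix (Idx p q) (Idx p q) ℝ) : Matrix (Fin m) (Fin m) ℝ :=
  -(S.L1 * S.B) + S.Mmat Ψ *
    (S.Lam0 0 * S.Bplus - Ψ 1 * S.Lam0 1 * S.Bminus)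

/-- The second rank condition. -/
def RankCondition2 (Ψ : ℝ → Matrix (Idx p q) (Idx p q) ℝ) : Prop :=
  IsUnit (Ψ 1 * S.Lam0 1 * S.Kplus - S.Lam0 0 * S.Kminus) ∧ IsUnit (S.T2 Ψ)

/-- The control `u = kᵢ Kᵢ z`. -/
def control (ki : ℝ) (Ki : Matrix (Fin m) (Fin m) ℝ) (z : EuclideanSpace ℝ (Fin m)) :
    Fin m → ℝ :=
  ki • (Ki *ᵥ WithLp.ofLp z)

/-- The output `y = L₁ (φ₊(0), φ₋(1)) + L₂ (φ₊(1), φ₋(0)) + w_y`. -/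
def output (wy : EuclideanSpace ℝ (Fin m)) (φ : HypReg.L2 p q) : EuclideanSpace ℝ (Fin m) :=
  WithLp.toLp 2 (S.L1 *ᵥ traceIn (contRep φ) + S.L2 *ᵥ traceOut (contRep φ)) + wy

/-- The boundary condition `(φ₊(0), φ₋(1)) = K (φ₊(1), φ₋(0)) + B u + w_b` with `u = kᵢ Kᵢ z`. -/
def BoundaryCondition (ki : ℝ) (Ki : Matrix (Fin m) (Fin m) ℝ) (wb : Idx p q → ℝ)
    (v : State p q m) : Prop :=
  traceIn (contRep v.1) = S.K *ᵥ traceOut (contRep v.1) + S.B *ᵥ control ki Ki v.2 + wb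

/-- Strong solutions on `[0,∞)` of the closed loop with initial value `v₀`. Only the values `v t`
with `t ≥ 0` matter. -/
structure IsStrongSolution (ki : ℝ) (Ki : Matrix (Fin m) (Fin m) ℝ) (wb : Idx p q → ℝ)
    (wy yref : EuclideanSpace ℝ (Fin m)) (v₀ : State p q m) (v : ℝ → State p q m) : Prop where
  initial : v 0 = v₀
  /-- `v ∈ C¹([0,∞); L² × ℝᵐ)` -/
  contDiffOn : ContDiffOn ℝ 1 v (Ici 0)
  /-- `v ∈ C⁰([0,∞); H¹ × ℝᵐ)`, and the differential equation holds in `L²` at every `t ≥ 0` -/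
  pde : ∃ g : ℝ → HypReg.L2 p q, ContinuousOn g (Ici 0) ∧
    ∀ t ∈ Ici (0 : ℝ), HasWeakDeriv (v t).1 (g t) ∧
      ∀ᵐ s ∂(volume.restrict (Ioo (0 : ℝ) 1)),
        WithLp.ofLp ((derivWithin v (Ici 0) t).1 s) + S.Lam0 s *ᵥ WithLp.ofLp (g t s)
          + S.Lam1 s *ᵥ WithLp.ofLp ((v t).1 s) = 0
  boundary : ∀ t ∈ Ici (0 : ℝ), S.BoundaryCondition ki Ki wb (v t)
  integrator : ∀ t ∈ Ici (0 : ℝ), (derivWithin v (Ici 0) t).2 = S.output wy (v t).1 - yref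

/-- Test functions on `[0,T]`: pairs `(ψ, ζ)` of `C¹` functions that vanish at time `T` and satisfy
the adjoint boundary condition, which removes the free boundary values `(φ₊(t,1), φ₋(t,0))`
from the weak formulation. -/
structure IsTestPair (T : ℝ) (ψ : ℝ → ℝ → Idx p q → ℝ) (ζ : ℝ → Fin m → ℝ) : Prop where
  contDiff_psi : ContDiff ℝ 1 fun x : ℝ × ℝ => ψ x.1 x.2
  contDiff_zeta : ContDiff ℝ 1 ζ
  psi_end : ∀ s ∈ Icc (0 : ℝ) 1, ψ T s = 0
  zeta_end : ζ T = 0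
  adjoint_boundary : ∀ t ∈ Icc (0 : ℝ) T,
    S.Kplusᵀ *ᵥ (S.Lam0 1 *ᵥ ψ t 1) - S.Kminusᵀ *ᵥ (S.Lam0 0 *ᵥ ψ t 0)
      = (S.L1 * S.K + S.L2)ᵀ *ᵥ ζ t

/-- Weak solutions on `[0,∞)` of the closed loop with initial value `v₀`, in the sense of
transposition: `v = (φ, z)` is continuous with values in `L² × ℝᵐ`, and the identity below is what
integration by parts gives when the equation for `φ` is multiplied by `ψ` and the equation for `z`
by `ζ`. -/
structure IsWeakSolution (ki : ℝ) (Ki : Matrix (Fin m) (Fin m) ℝ) (wb : Idx p q → ℝ)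
    (wy yref : EuclideanSpace ℝ (Fin m)) (v₀ : State p q m) (v : ℝ → State p q m) : Prop where
  initial : v 0 = v₀
  continuousOn : ContinuousOn v (Ici 0)
  weak : ∀ T : ℝ, 0 < T → ∀ ψ ζ, S.IsTestPair T ψ ζ →
    (∫ t in (0 : ℝ)..T, ∫ s in Ioo (0 : ℝ) 1,
        (deriv (fun τ => ψ τ s) t + S.Lam0 s *ᵥ deriv (ψ t) s + S.Lam0' s *ᵥ ψ t s
          - (S.Lam1 s)ᵀ *ᵥ ψ t s) ⬝ᵥ WithLp.ofLp ((v t).1 s))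
      + (∫ s in Ioo (0 : ℝ) 1, ψ 0 s ⬝ᵥ WithLp.ofLp (v₀.1 s))
      + (∫ t in (0 : ℝ)..T, deriv ζ t ⬝ᵥ WithLp.ofLp (v t).2)
      + ζ 0 ⬝ᵥ WithLp.ofLp v₀.2
      + (∫ t in (0 : ℝ)..T,
          (ψ t 0 ⬝ᵥ (S.Lam0 0 *ᵥ plusPart (S.B *ᵥ control ki Ki (v t).2 + wb))
            - ψ t 1 ⬝ᵥ (S.Lam0 1 *ᵥ minusPart (S.B *ᵥ control ki Ki (v t).2 + wb))
            + ζ t ⬝ᵥ (S.L1 *ᵥ (S.B *ᵥ control ki Ki (v t).2 + wb)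
                + WithLp.ofLp wy - WithLp.ofLp yref))) = 0

/-- `v∞` is an equilibrium: the constant trajectory at `v∞` is a strong solution. -/
def IsEquilibrium (ki : ℝ) (Ki : Matrix (Fin m) (Fin m) ℝ) (wb : Idx p q → ℝ)
    (wy yref : EuclideanSpace ℝ (Fin m)) (vInf : State p q m) : Prop :=
  S.IsStrongSolution ki Ki wb wy yref vInf fun _ => vInf

end HypSystem

end HypReg

end

/-! The closed loop is an evolution equation v' = Av whose unbounded generator A is handled only
through its graph `IsGen` and its bounded inverse R: the relation v = Ry stands for Av = y.

Inverse and equilibrium. The equation Av = y is a linear ODE in s. Variation of constants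
(`statSol`) solves it up to the initial value c = φ(0). The boundary condition and the output
equation then form a finite linear system for (c, z), which the first rank condition makes solvable
(`exists_solve_boundary`). With disturbances in place of y the same system yields the equilibrium,
and subtracting it reduces everything to the homogeneous loop.

Decay. Integrating the PDE against Ψ leaves boundary terms only, and the matrix M is chosen to
cancel the free boundary values. Hence η = z - M∫Ψφ satisfies η' = -T₂u = -kᵢz (`IsGenAux.forward`),
where kᵢz = kᵢη + kᵢM∫Ψφ. The stability assumption bounds the derivative of ∫φᵀPφ by -μ∫φᵀPφ +
C|kᵢz|² (`IsGenAux.energy`, `exists_flux_bound`). In V = ∫φᵀPφ + |η|² the good terms are of order 1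
in φ and of order kᵢ in η, while the bad ones are of order kᵢ²|z|² and kᵢ|φ||η|. For small kᵢ the
good terms win (`lyapunov_arith`). So A is strictly dissipative in the Hilbert norm √V
(`exists_dissipative`).

Semigroup. A dissipative A with bounded inverse generates an exponentially decaying semigroup, the
limit of the exponentials of the Yosida approximations (R - l)⁻¹ (`exists_closedLoopSemigroup`).
Orbits from the range of R are strong solutions. They satisfy the weak formulation by Green's
formula, and density of the range extends it to all orbits.

Uniqueness. Testing with time profile T - t shows that the double time integral of a weak solution
with zero data is a differentiable solution starting at 0; it vanishes by energy decay, and so does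
the weak solution (`IsClosedLoopSemigroup.eq_zero_of_isWeakSolution`).

Regulation. The error y - y_ref equals z', a component of the derivative of the orbit. For
compatible data that derivative is itself an orbit of the homogeneous semigroup, so it decays. -/

noncomputable section

namespace HypReg

/-! ### Contraction semigroups generated by the inverse of a dissipative bounded operator -/

section Semigroup

variable {H : Type*} [NormedAddCommGroup H] [InnerProductSpace ℝ H]

/-- Dissipativity, with rate `ρ`, of the (possibly unbounded) operator `R⁻¹`. -/
def InvDissipative (R : H →L[ℝ] H) (ρ : ℝ) : Prop :=
  ∀ y, inner ℝ y (R y) ≤ -ρ * ‖R y‖ ^ 2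

theorem InvDissipative.inner_nonpos {R : H →L[ℝ] H} {ρ : ℝ} (hr : 0 < ρ)
    (hR : InvDissipative R ρ) (y : H) : inner ℝ y (R y) ≤ 0 :=
  (hR y).trans (by nlinarith [sq_nonneg ‖R y‖])

/-- The exponential of a dissipative bounded operator is a contraction. -/
theorem norm_exp_smul_apply_le [CompleteSpace H] {A : H →L[ℝ] H}
    (hA : ∀ x, inner ℝ (A x) x ≤ 0) {t : ℝ} (ht : 0 ≤ t) (x : H) : ‖NormedSpace.exp (t • A) x‖ ≤ ‖x‖ := by
  have hd : ∀ s : ℝ, HasDerivAt (fun s : ℝ => NormedSpace.exp (s • A) x)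
      (A (NormedSpace.exp (s • A) x)) s := fun s => by
    have := (hasDerivAt_exp_smul_const' (𝕂 := ℝ) A s).clm_apply (hasDerivAt_const s x)
    simpa using this
  have hanti : Antitone fun s : ℝ => ‖NormedSpace.exp (s • A) x‖ ^ 2 := by
    refine antitone_of_hasDerivAt_nonpos (fun s => (hd s).norm_sq) fun s => ?_
    have := hA (NormedSpace.exp (s • A) x)
    rw [real_inner_comm] at this
    simpa using by linarith
  have h := hanti ht
  simp only [zero_smul, NormedSpace.exp_zero, one_apply_eq_self] at h
  exact (sq_le_sq₀ (norm_nonneg _) (norm_nonneg _)).1 h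

/-- The exponentials of two commuting dissipative bounded operators differ at time `t` by at most
`t` times the difference of the operators. -/
theorem norm_exp_smul_sub_exp_smul_le [CompleteSpace H] {A B : H →L[ℝ] H}
    (hA : ∀ x, inner ℝ (A x) x ≤ 0)
    (hB : ∀ x, inner ℝ (B x) x ≤ 0) (hAB : Commute A B) {t : ℝ} (ht : 0 ≤ t) (x : H) :
    ‖NormedSpace.exp (t • A) x - NormedSpace.exp (t • B) x‖ ≤ t * ‖A x - B x‖ := by
  -- Interpolation from exp(tB)x at s = 0 to exp(tA)x at s = t. Commutativity turns the derivative
  -- into two contractions applied to Ax - Bx.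
  set f : ℝ → H := fun s => NormedSpace.exp (s • A) (NormedSpace.exp ((t - s) • B) x) with hf
  have hd : ∀ s : ℝ, HasDerivAt f
      (NormedSpace.exp (s • A) (NormedSpace.exp ((t - s) • B) (A x - B x))) s := fun s => by
    have h1 := hasDerivAt_exp_smul_const (𝕂 := ℝ) A s
    have h2 : HasDerivAt (fun s : ℝ => NormedSpace.exp ((t - s) • B))
        (-(NormedSpace.exp ((t - s) • B) * B)) s := by
      have := (hasDerivAt_exp_smul_const (𝕂 := ℝ) B (t - s)).scomp s
        ((hasDerivAt_id s).const_sub t)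
      simpa [Function.comp_def] using this
    have h3 := h1.clm_apply (h2.clm_apply (hasDerivAt_const s x))
    have hc : Commute A (NormedSpace.exp ((t - s) • B)) :=
      ((hAB.smul_right (t - s)).exp_right)
    have hc' := congrArg (fun L : H →L[ℝ] H => L x) hc.eq
    simp only [mul_apply_eq_comp] at hc'
    refine h3.congr_deriv ?_
    simp only [mul_apply_eq_comp, neg_apply, map_zero, add_zero, map_neg,
      map_sub, hc']
    abel
  have hb : ∀ s ∈ Ico 0 t, ‖NormedSpace.exp (s • A)
      (NormedSpace.exp ((t - s) • B) (A x - B x))‖ ≤ ‖A x - B x‖ := fun s hs =>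
    (norm_exp_smul_apply_le hA hs.1 _).trans (norm_exp_smul_apply_le hB (by linarith [hs.2]) _)
  have := norm_image_sub_le_of_norm_deriv_le_segment' (f := f) (a := 0) (b := t)
    (fun s _ => (hd s).hasDerivWithinAt) hb t ⟨ht, le_rfl⟩
  simpa [hf, mul_comm] using this

variable (R : H →L[ℝ] H)

/-- The Yosida approximation of `R⁻¹`. -/
def yosida (l : ℝ) : H →L[ℝ] H := Ring.inverse (R - l • 1)

variable {R} {ρ : ℝ}

/-- Lax–Milgram: since ⟨Ry, y⟩ ≤ 0, the operator l - R is coercive with constant l. -/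
theorem isUnit_sub_smul_one [CompleteSpace H] (hr : 0 < ρ)
    (hR : InvDissipative R ρ) {l : ℝ} (hl : 0 < l) : IsUnit (R - l • 1) := by
  have hco : IsCoercive ((innerSL ℝ).comp (l • (1 : H →L[ℝ] H) - R)) := by
    refine ⟨l, hl, fun y => ?_⟩
    have h := hR.inner_nonpos hr y
    rw [real_inner_comm] at h
    simp only [ContinuousLinearMap.comp_apply, innerSL_apply_apply, sub_apply,
      smul_apply, one_apply_eq_self, inner_sub_left,
      real_inner_smul_left, real_inner_self_eq_norm_sq]
    nlinarith
  set e := hco.continuousLinearEquivOfBilin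
  have he : (e : H →L[ℝ] H) = l • (1 : H →L[ℝ] H) - R := by
    ext y
    exact (hco.unique_continuousLinearEquivOfBilin fun w => rfl).symm
  have hu : IsUnit (e : H →L[ℝ] H) := ⟨ContinuousLinearEquiv.toUnit e, rfl⟩
  rw [he] at hu
  simpa using hu.neg

theorem yosida_apply_sub [CompleteSpace H] (hr : 0 < ρ)
    (hR : InvDissipative R ρ) {l : ℝ} (hl : 0 < l) (x : H) :
    yosida R l (R x - l • x) = x := by
  have := Ring.inverse_mul_cancel _ (isUnit_sub_smul_one hr hR hl)
  simpa [yosida] using congrArg (fun L : H →L[ℝ] H => L x) this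

theorem sub_yosida_apply [CompleteSpace H] (hr : 0 < ρ)
    (hR : InvDissipative R ρ) {l : ℝ} (hl : 0 < l) (x : H) :
    R (yosida R l x) - l • yosida R l x = x := by
  have := Ring.mul_inverse_cancel _ (isUnit_sub_smul_one hr hR hl)
  simpa [yosida] using congrArg (fun L : H →L[ℝ] H => L x) this

theorem commute_yosida (l l' : ℝ) : Commute (yosida R l) (yosida R l') := by
  apply Commute.ringInverse_ringInverse
  simp [Commute, SemiconjBy, sub_mul, mul_sub, smul_sub, smul_smul, mul_comm l l']
  abel

theorem inner_yosida_nonpos [CompleteSpace H] (hr : 0 < ρ)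
    (hR : InvDissipative R ρ) {l : ℝ} (hl : 0 < l) (x : H) :
    inner ℝ (yosida R l x) x ≤ 0 := by
  have h := hR.inner_nonpos hr (yosida R l x)
  nth_rw 2 [← sub_yosida_apply hr hR hl x]
  rw [inner_sub_right, real_inner_smul_right, real_inner_self_eq_norm_sq]
  nlinarith [sq_nonneg ‖yosida R l x‖]

/-- Pair Ry - ly = x with y. The term ⟨y, Ry⟩ has the favourable sign, which leaves l‖y‖² ≤ ‖y‖‖x‖.
-/
theorem norm_yosida_le [CompleteSpace H] (hr : 0 < ρ)
    (hR : InvDissipative R ρ) {l : ℝ} (hl : 0 < l) (x : H) :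
    l * ‖yosida R l x‖ ≤ ‖x‖ := by
  set y := yosida R l x
  have hx : R y - l • y = x := sub_yosida_apply hr hR hl x
  have h := hR.inner_nonpos hr y
  have h1 : l * ‖y‖ ^ 2 ≤ ‖y‖ * ‖x‖ := by
    have h2 := abs_real_inner_le_norm y x
    rw [← hx, inner_sub_right, real_inner_smul_right, real_inner_self_eq_norm_sq, hx] at h2
    nlinarith [neg_le_abs (inner ℝ y (R y) - l * ‖y‖ ^ 2)]
  rcases (norm_nonneg y).eq_or_lt with h0 | h0
  · rw [← h0]; simp
  · nlinarith

/-- At a point Rx of the domain the exact value of R⁻¹ is x, so l • `yosida R l x` is the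
approximation error. All convergence rates as l → 0 come from this identity. -/
theorem yosida_R_apply [CompleteSpace H] (hr : 0 < ρ)
    (hR : InvDissipative R ρ) {l : ℝ} (hl : 0 < l) (x : H) :
    yosida R l (R x) = x + l • yosida R l x := by
  have := yosida_apply_sub hr hR hl x
  rwa [map_sub, map_smul, sub_eq_iff_eq_add] at this

theorem commute_yosida_right [CompleteSpace H] (hr : 0 < ρ)
    (hR : InvDissipative R ρ) {l : ℝ} (hl : 0 < l) : Commute R (yosida R l) := by
  ext x
  have := sub_yosida_apply hr hR hl x
  rw [sub_eq_iff_eq_add] at this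
  simp [this, yosida_R_apply hr hR hl]

theorem norm_yosida_R_le [CompleteSpace H] (hr : 0 < ρ)
    (hR : InvDissipative R ρ) {l : ℝ} (hl : 0 < l) (x : H) :
    ‖yosida R l (R x)‖ ≤ 2 * ‖x‖ := by
  rw [yosida_R_apply hr hR hl]
  refine (norm_add_le _ _).trans ?_
  rw [norm_smul, Real.norm_of_nonneg hl.le]
  linarith [norm_yosida_le hr hR hl x]

/-- A vector x orthogonal to the range has ⟨x, Rx⟩ = 0. The strict rate ρ > 0 then forces Rx = 0,
hence x = 0. -/
theorem denseRange_of_invDissipative [CompleteSpace H] (hr : 0 < ρ) (hR : InvDissipative R ρ)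
    (hinj : Function.Injective R) : DenseRange R := by
  have : (R : H →ₗ[ℝ] H).range.topologicalClosure = ⊤ := by
    rw [Submodule.topologicalClosure_eq_top_iff, Submodule.eq_bot_iff]
    intro x hx
    have h0 : inner ℝ x (R x) = 0 := by
      rw [real_inner_comm]
      exact hx (R x) ⟨x, rfl⟩
    have h1 := hR x
    rw [h0] at h1
    have h2 : ‖R x‖ = 0 := pow_eq_zero_iff two_ne_zero |>.1
      (le_antisymm (by nlinarith) (sq_nonneg _))
    exact hinj (by rw [map_zero]; exact norm_eq_zero.1 h2)
  have h := congrArg (fun K : Submodule ℝ H => (K : Set H)) this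
  simp only [Submodule.topologicalClosure_coe, Submodule.top_coe] at h
  exact dense_iff_closure_eq.2 h

/-- The approximating semigroups. -/
def approxSemigroup (R : H →L[ℝ] H) (n : ℕ) (t : ℝ) : H →L[ℝ] H :=
  NormedSpace.exp (t • yosida R (1 / (n + 1 : ℝ)))

theorem norm_approxSemigroup_le [CompleteSpace H] (hr : 0 < ρ)
    (hR : InvDissipative R ρ) (n : ℕ) {t : ℝ} (ht : 0 ≤ t) (x : H) :
    ‖approxSemigroup R n t x‖ ≤ ‖x‖ :=
  norm_exp_smul_apply_le (inner_yosida_nonpos hr hR Nat.one_div_pos_of_nat) ht x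

/-- Points R(Ru) lie in the domain of the square of R⁻¹, where each Yosida approximation has error
at most 2l‖u‖. The approximating semigroups therefore differ at an explicit rate. -/
theorem norm_approxSemigroup_sub_le [CompleteSpace H] (hr : 0 < ρ)
    (hR : InvDissipative R ρ) (n k : ℕ) {t : ℝ} (ht : 0 ≤ t) (u : H) :
    ‖approxSemigroup R n t (R (R u)) - approxSemigroup R k t (R (R u))‖
      ≤ t * (2 * (1 / (n + 1 : ℝ) + 1 / (k + 1 : ℝ)) * ‖u‖) := by
  have hn : (0 : ℝ) < 1 / (n + 1 : ℝ) := Nat.one_div_pos_of_nat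
  have hk : (0 : ℝ) < 1 / (k + 1 : ℝ) := Nat.one_div_pos_of_nat
  refine (norm_exp_smul_sub_exp_smul_le (inner_yosida_nonpos hr hR hn)
    (inner_yosida_nonpos hr hR hk) (commute_yosida _ _) ht _).trans ?_
  gcongr
  rw [yosida_R_apply hr hR hn, yosida_R_apply hr hR hk, add_sub_add_left_eq_sub]
  refine (norm_sub_le _ _).trans ?_
  rw [norm_smul, norm_smul, Real.norm_of_nonneg hn.le, Real.norm_of_nonneg hk.le]
  have h1 := mul_le_mul_of_nonneg_left (norm_yosida_R_le hr hR hn u) hn.le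
  have h2 := mul_le_mul_of_nonneg_left (norm_yosida_R_le hr hR hk u) hk.le
  linarith

/-- The explicit rate holds on the dense range of R², and contractivity carries it to every x.
Uniformity on compact time intervals is what makes the limit continuous in time. -/
theorem uniformCauchySeqOn_approxSemigroup [CompleteSpace H] (hr : 0 < ρ)
    (hR : InvDissipative R ρ) (hinj : Function.Injective R) {b : ℝ} (hb : 0 ≤ b) (x : H) :
    UniformCauchySeqOn (fun n t => approxSemigroup R n t x) atTop (Icc 0 b) := by
  have hdense := (denseRange_of_invDissipative hr hR hinj)
  have hdense2 : DenseRange (R ∘ R) := hdense.comp hdense R.continuous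
  rw [Metric.uniformCauchySeqOn_iff]
  intro ε hε
  obtain ⟨u, hu⟩ := hdense2.exists_dist_lt x (show 0 < ε / 4 by positivity)
  have hlim : Tendsto (fun n : ℕ => b * (4 * (1 / (n + 1 : ℝ)) * ‖u‖)) atTop (𝓝 0) := by
    have := ((tendsto_one_div_add_atTop_nhds_zero_nat (𝕜 := ℝ)).const_mul 4).mul_const ‖u‖
    simpa using this.const_mul b
  obtain ⟨N, hN⟩ := ((tendsto_order.1 hlim).2 (ε / 4) (by positivity)).exists_forall_of_atTop
  refine ⟨N, fun n hn k hk t ht => ?_⟩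
  have hNn : 1 / (n + 1 : ℝ) ≤ 1 / (N + 1 : ℝ) := by gcongr
  have hNk : 1 / (k + 1 : ℝ) ≤ 1 / (N + 1 : ℝ) := by gcongr
  have h1 : ‖approxSemigroup R n t (R (R u)) - approxSemigroup R k t (R (R u))‖ < ε / 4 := by
    refine (norm_approxSemigroup_sub_le hr hR n k ht.1 u).trans_lt
      (lt_of_le_of_lt ?_ (hN N le_rfl))
    have : 2 * (1 / (n + 1 : ℝ) + 1 / (k + 1 : ℝ)) ≤ 4 * (1 / (N + 1 : ℝ)) := by linarith
    gcongr
    exact ht.2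
  have h2 : ∀ j : ℕ, ‖approxSemigroup R j t x - approxSemigroup R j t (R (R u))‖ < ε / 4 :=
    fun j => by
      rw [← map_sub]
      refine (norm_approxSemigroup_le hr hR j ht.1 _).trans_lt ?_
      rw [← dist_eq_norm]
      exact hu
  have h3 := h2 k
  rw [norm_sub_rev] at h3
  rw [dist_eq_norm]
  calc ‖approxSemigroup R n t x - approxSemigroup R k t x‖
      = ‖(approxSemigroup R n t x - approxSemigroup R n t (R (R u)))
        + (approxSemigroup R n t (R (R u)) - approxSemigroup R k t (R (R u)))
        + (approxSemigroup R k t (R (R u)) - approxSemigroup R k t x)‖ := by congr 1; abel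
    _ ≤ _ := norm_add₃_le
    _ < ε := by linarith [h2 n]

/-- The contraction semigroup generated by `R⁻¹`. -/
def invSemigroup (R : H →L[ℝ] H) (t : ℝ) (x : H) : H :=
  limUnder atTop fun n => approxSemigroup R n t x

theorem tendsto_approxSemigroup [CompleteSpace H] (hr : 0 < ρ)
    (hR : InvDissipative R ρ) (hinj : Function.Injective R) {t : ℝ} (ht : 0 ≤ t) (x : H) :
    Tendsto (fun n => approxSemigroup R n t x) atTop (𝓝 (invSemigroup R t x)) :=
  ((uniformCauchySeqOn_approxSemigroup hr hR hinj ht x).cauchySeq ⟨ht, le_rfl⟩).tendsto_limUnder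

theorem invSemigroup_zero (R : H →L[ℝ] H) (x : H) : invSemigroup R 0 x = x := by
  simp [invSemigroup, approxSemigroup, tendsto_const_nhds.limUnder_eq]

theorem invSemigroup_sub [CompleteSpace H] (hr : 0 < ρ)
    (hR : InvDissipative R ρ) (hinj : Function.Injective R) {t : ℝ} (ht : 0 ≤ t) (x y : H) :
    invSemigroup R t (x - y) = invSemigroup R t x - invSemigroup R t y := by
  refine tendsto_nhds_unique (tendsto_approxSemigroup hr hR hinj ht _) ?_
  simp only [map_sub]
  exact (tendsto_approxSemigroup hr hR hinj ht x).sub (tendsto_approxSemigroup hr hR hinj ht y)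

theorem norm_invSemigroup_le [CompleteSpace H] (hr : 0 < ρ)
    (hR : InvDissipative R ρ) (hinj : Function.Injective R) {t : ℝ} (ht : 0 ≤ t) (x : H) :
    ‖invSemigroup R t x‖ ≤ ‖x‖ :=
  le_of_tendsto (tendsto_approxSemigroup hr hR hinj ht x).norm
    (Eventually.of_forall fun n => norm_approxSemigroup_le hr hR n ht x)

theorem invSemigroup_comm [CompleteSpace H] (hr : 0 < ρ)
    (hR : InvDissipative R ρ) (hinj : Function.Injective R) {t : ℝ} (ht : 0 ≤ t) (x : H) :
    R (invSemigroup R t x) = invSemigroup R t (R x) := by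
  refine tendsto_nhds_unique ((R.continuous.tendsto _).comp
    (tendsto_approxSemigroup hr hR hinj ht x)) ?_
  refine (tendsto_approxSemigroup hr hR hinj ht (R x)).congr fun n => ?_
  have hc : Commute R (approxSemigroup R n t) :=
    ((commute_yosida_right hr hR Nat.one_div_pos_of_nat).smul_right t).exp_right
  simpa using (congrArg (fun L : H →L[ℝ] H => L x) hc.eq).symm

theorem continuous_approxSemigroup [CompleteSpace H] (R : H →L[ℝ] H) (n : ℕ) (x : H) :
    Continuous fun t => approxSemigroup R n t x := by
  refine continuous_iff_continuousAt.2 fun t => ?_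
  have := (hasDerivAt_exp_smul_const (𝕂 := ℝ) (yosida R (1 / (n + 1 : ℝ))) t).clm_apply
    (hasDerivAt_const t x)
  exact this.continuousAt

theorem continuousOn_invSemigroup [CompleteSpace H] (hr : 0 < ρ)
    (hR : InvDissipative R ρ) (hinj : Function.Injective R) (x : H) :
    ContinuousOn (fun t => invSemigroup R t x) (Ici 0) := by
  intro t ht
  have hu := (uniformCauchySeqOn_approxSemigroup hr hR hinj
    (b := t + 1) (by linarith [mem_Ici.1 ht]) x).tendstoUniformlyOn_of_tendsto
    fun s hs => tendsto_approxSemigroup hr hR hinj hs.1 x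
  have hc := hu.continuousOn
    (Frequently.of_forall fun n => (continuous_approxSemigroup R n x).continuousOn)
  refine (hc t ⟨ht, by linarith⟩).mono_of_mem_nhdsWithin ?_
  filter_upwards [self_mem_nhdsWithin, mem_nhdsWithin_of_mem_nhds (Iio_mem_nhds (lt_add_one t))]
    with s hs hs' using ⟨hs, le_of_lt hs'⟩

theorem tendsto_yosida_R [CompleteSpace H] (hr : 0 < ρ)
    (hR : InvDissipative R ρ) (hinj : Function.Injective R) (y : H) :
    Tendsto (fun n : ℕ => yosida R (1 / (n + 1 : ℝ)) (R y)) atTop (𝓝 y) := by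
  rw [Metric.tendsto_atTop]
  intro ε hε
  obtain ⟨u, hu⟩ := (denseRange_of_invDissipative hr hR hinj).exists_dist_lt y
    (show 0 < ε / 4 by positivity)
  rw [dist_eq_norm] at hu
  have hlim : Tendsto (fun n : ℕ => 1 / (n + 1 : ℝ) * (2 * ‖u‖)) atTop (𝓝 0) := by
    simpa using (tendsto_one_div_add_atTop_nhds_zero_nat (𝕜 := ℝ)).mul_const (2 * ‖u‖)
  obtain ⟨N, hN⟩ := ((tendsto_order.1 hlim).2 (ε / 4) (by positivity)).exists_forall_of_atTop
  refine ⟨N, fun n hn => ?_⟩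
  have hl : (0 : ℝ) < 1 / (n + 1 : ℝ) := Nat.one_div_pos_of_nat
  have h1 := norm_yosida_R_le hr hR hl (y - R u)
  have h2 : ‖yosida R (1 / (n + 1 : ℝ)) (R (R u)) - R u‖ < ε / 4 := by
    rw [yosida_R_apply hr hR hl, add_sub_cancel_left, norm_smul, Real.norm_of_nonneg hl.le]
    exact (mul_le_mul_of_nonneg_left (norm_yosida_R_le hr hR hl u) hl.le).trans_lt (hN n hn)
  rw [dist_eq_norm]
  calc ‖yosida R (1 / (n + 1 : ℝ)) (R y) - y‖
      = ‖yosida R (1 / (n + 1 : ℝ)) (R (y - R u)) +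
          (yosida R (1 / (n + 1 : ℝ)) (R (R u)) - R u) - (y - R u)‖ := by
        congr 1; simp only [map_sub]; abel
    _ ≤ _ := (norm_sub_le _ _).trans (add_le_add_left (norm_add_le _ _) _)
    _ < ε := by linarith

/-- The limit is taken in the integrated equation, which needs only pointwise convergence of the
integrands and the bound 2‖y‖; no convergence of derivatives has to be shown. -/
theorem invSemigroup_R_eq_integral [CompleteSpace H] (hr : 0 < ρ)
    (hR : InvDissipative R ρ) (hinj : Function.Injective R) (y : H) {t : ℝ} (ht : 0 ≤ t) :
    invSemigroup R t (R y) = R y + ∫ s in (0 : ℝ)..t, invSemigroup R s y := by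
  refine tendsto_nhds_unique (tendsto_approxSemigroup hr hR hinj ht _) ?_
  have hint : ∀ n : ℕ, approxSemigroup R n t (R y) = R y +
      ∫ s in (0 : ℝ)..t, approxSemigroup R n s (yosida R (1 / (n + 1 : ℝ)) (R y)) := fun n => by
    have hd : ∀ s : ℝ, HasDerivAt (fun s : ℝ => approxSemigroup R n s (R y))
        (approxSemigroup R n s (yosida R (1 / (n + 1 : ℝ)) (R y))) s := fun s => by
      have := (hasDerivAt_exp_smul_const (𝕂 := ℝ) (yosida R (1 / (n + 1 : ℝ))) s).clm_apply
        (hasDerivAt_const s (R y))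
      simpa [approxSemigroup] using this
    rw [intervalIntegral.integral_eq_sub_of_hasDerivAt (fun s _ => hd s)
      (continuous_approxSemigroup R n _).continuousOn.intervalIntegrable]
    simp [approxSemigroup]
  simp_rw [hint]
  refine tendsto_const_nhds.add ?_
  refine intervalIntegral.tendsto_integral_filter_of_dominated_convergence (fun _ => 2 * ‖y‖)
    (Eventually.of_forall fun n => (continuous_approxSemigroup R n _).aestronglyMeasurable)
    (Eventually.of_forall fun n => Eventually.of_forall fun s hs => ?_)
    intervalIntegrable_const (Eventually.of_forall fun s hs => ?_)
  · rw [uIoc_of_le ht] at hs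
    exact (norm_approxSemigroup_le hr hR n hs.1.le _).trans
      (norm_yosida_R_le hr hR Nat.one_div_pos_of_nat y)
  · rw [uIoc_of_le ht] at hs
    have h1 : Tendsto (fun n : ℕ => approxSemigroup R n s (yosida R (1 / (n + 1 : ℝ)) (R y) - y))
        atTop (𝓝 0) := by
      refine squeeze_zero_norm (fun n => norm_approxSemigroup_le hr hR n hs.1.le _) ?_
      simpa using ((tendsto_yosida_R hr hR hinj y).sub_const y).norm
    simpa using h1.add (tendsto_approxSemigroup hr hR hinj hs.1.le y)

theorem hasDerivWithinAt_invSemigroup [CompleteSpace H] (hr : 0 < ρ)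
    (hR : InvDissipative R ρ) (hinj : Function.Injective R) (y : H) {t : ℝ} (ht : 0 ≤ t) :
    HasDerivWithinAt (fun t => invSemigroup R t (R y)) (invSemigroup R t y) (Ici 0) t := by
  -- The semigroup is controlled for t ≥ 0 only. Its constant extension is continuous on the line,
  -- so the fundamental theorem of calculus also applies at t = 0.
  set g : ℝ → H := fun s => invSemigroup R (max s 0) y with hg
  have hgc : Continuous g :=
    (continuousOn_invSemigroup hr hR hinj y).comp_continuous (by fun_prop)
      fun s => mem_Ici.2 (le_max_right _ _)
  have h1 : HasDerivAt (fun t => R y + ∫ s in (0 : ℝ)..t, g s) (g t) t :=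
    (hgc.integral_hasStrictDerivAt 0 t).hasDerivAt.const_add _
  have hgt : g t = invSemigroup R t y := by simp [hg, max_eq_left ht]
  rw [hgt] at h1
  have heq : ∀ τ ∈ Ici (0 : ℝ), invSemigroup R τ (R y) = R y + ∫ s in (0 : ℝ)..τ, g s := by
    intro τ hτ
    rw [invSemigroup_R_eq_integral hr hR hinj y hτ]
    congr 1
    refine intervalIntegral.integral_congr fun s hs => ?_
    rw [uIcc_of_le hτ] at hs
    simp [hg, max_eq_left hs.1]
  exact h1.hasDerivWithinAt.congr heq (heq t ht)

/-- Energy decay along solutions of `u = R u'`. -/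
theorem norm_le_exp_mul_of_deriv (hR : InvDissipative R ρ) {u u' : ℝ → H}
    (hu : ∀ t, 0 ≤ t → HasDerivWithinAt u (u' t) (Ici 0) t) (huR : ∀ t, 0 ≤ t → u t = R (u' t))
    {t : ℝ} (ht : 0 ≤ t) : ‖u t‖ ≤ Real.exp (-ρ * t) * ‖u 0‖ := by
  set E : ℝ → ℝ := fun s => Real.exp (2 * ρ * s) * ‖u s‖ ^ 2 with hE
  have hd : ∀ s, 0 ≤ s → HasDerivWithinAt E (Real.exp (2 * ρ * s) * (2 * ρ) * ‖u s‖ ^ 2 +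
      Real.exp (2 * ρ * s) * (2 * inner ℝ (u s) (u' s))) (Ici 0) s := fun s hs => by
    have h1 : HasDerivAt (fun s => Real.exp (2 * ρ * s)) (Real.exp (2 * ρ * s) * (2 * ρ)) s := by
      simpa using ((hasDerivAt_id s).const_mul (2 * ρ)).exp
    exact h1.hasDerivWithinAt.mul (hu s hs).norm_sq
  have hanti : AntitoneOn E (Ici 0) := by
    refine antitoneOn_of_hasDerivWithinAt_nonpos (convex_Ici 0)
      (fun s hs => (hd s hs).continuousWithinAt)
      (fun s hs => (hd s (interior_subset hs)).mono interior_subset) fun s hs => ?_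
    have hs0 : 0 ≤ s := interior_subset hs
    have h := hR (u' s)
    rw [← huR s hs0, real_inner_comm] at h
    nlinarith [Real.exp_pos (2 * ρ * s)]
  have h := hanti (mem_Ici.2 le_rfl) (mem_Ici.2 ht) ht
  simp only [hE, mul_zero, Real.exp_zero, one_mul] at h
  have h2 : (Real.exp (ρ * t) * ‖u t‖) ^ 2 ≤ ‖u 0‖ ^ 2 := by
    rw [mul_pow, ← Real.exp_nat_mul]
    rwa [Nat.cast_ofNat, ← mul_assoc]
  have h3 := (sq_le_sq₀ (by positivity) (norm_nonneg _)).1 h2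
  rw [neg_mul, Real.exp_neg, ← div_eq_inv_mul, le_div_iff₀ (Real.exp_pos _), mul_comm]
  exact h3

/-- Orbits starting in the range of R are differentiable and decay by the energy estimate. The bound
passes to the closure because each time-t map is 1-Lipschitz. -/
theorem norm_invSemigroup_le_exp [CompleteSpace H] (hr : 0 < ρ)
    (hR : InvDissipative R ρ) (hinj : Function.Injective R) {t : ℝ} (ht : 0 ≤ t) (x : H) :
    ‖invSemigroup R t x‖ ≤ Real.exp (-ρ * t) * ‖x‖ := by
  have hlip : LipschitzWith 1 (invSemigroup R t) := LipschitzWith.of_dist_le_mul fun x y => by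
    rw [dist_eq_norm, dist_eq_norm, ← invSemigroup_sub hr hR hinj ht]
    simpa using norm_invSemigroup_le hr hR hinj ht (x - y)
  refine (denseRange_of_invDissipative hr hR hinj).induction_on
    (p := fun x => ‖invSemigroup R t x‖ ≤ Real.exp (-ρ * t) * ‖x‖) x
    (isClosed_le hlip.continuous.norm (by fun_prop)) fun y => ?_
  have := norm_le_exp_mul_of_deriv hR (u := fun t => invSemigroup R t (R y))
    (u' := fun t => invSemigroup R t y)
    (fun t ht => hasDerivWithinAt_invSemigroup hr hR hinj y ht)
    (fun t ht => (invSemigroup_comm hr hR hinj ht y).symm) ht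
  simpa only [invSemigroup_zero] using this

end Semigroup

/-! ### Primitives of integrable functions on `[0,1]` -/

/-- `f` is a primitive on `[0,1]` of the integrable function `g`. -/
def IsPrim (f g : ℝ → ℝ) : Prop :=
  IntervalIntegrable g volume 0 1 ∧ ∀ s ∈ Icc (0 : ℝ) 1, f s = f 0 + ∫ τ in (0 : ℝ)..s, g τ

theorem ae_Ioo_iff_ae_uIoc {P : ℝ → Prop} :
    (∀ᵐ s ∂(volume.restrict (Ioo (0 : ℝ) 1)), P s) ↔ ∀ᵐ s, s ∈ uIoc (0 : ℝ) 1 → P s := by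
  rw [uIoc_of_le zero_le_one, restrict_Ioo_eq_restrict_Ioc, ae_restrict_iff' measurableSet_Ioc]

theorem integral_Ioo_eq (g : ℝ → ℝ) : ∫ s in Ioo (0 : ℝ) 1, g s = ∫ s in (0 : ℝ)..1, g s := by
  rw [intervalIntegral.integral_of_le zero_le_one, restrict_Ioo_eq_restrict_Ioc]

namespace IsPrim

variable {f g f₁ f₂ g₁ g₂ : ℝ → ℝ}

theorem integral_eq (h : IsPrim f g) : ∫ s in Ioo (0 : ℝ) 1, g s = f 1 - f 0 := by
  rw [integral_Ioo_eq, h.2 1 ⟨zero_le_one, le_rfl⟩]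
  ring

theorem congr (h : IsPrim f₁ g) (hf : EqOn f₂ f₁ (Icc 0 1)) : IsPrim f₂ g :=
  ⟨h.1, fun s hs => by rw [hf hs, hf ⟨le_rfl, zero_le_one⟩]; exact h.2 s hs⟩

theorem congr_ae (h : IsPrim f g₁)
    (hg : ∀ᵐ s ∂(volume.restrict (Ioo (0 : ℝ) 1)), g₁ s = g₂ s) : IsPrim f g₂ := by
  have hg' := ae_Ioo_iff_ae_uIoc.1 hg
  refine ⟨h.1.congr_ae ((ae_restrict_iff' measurableSet_uIoc).2 hg'), fun s hs => ?_⟩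
  rw [h.2 s hs]
  congr 1
  refine intervalIntegral.integral_congr_ae ?_
  filter_upwards [hg'] with τ hτ hτs
  refine hτ ?_
  rw [uIoc_of_le zero_le_one]
  rw [uIoc_of_le hs.1] at hτs
  exact ⟨hτs.1, hτs.2.trans hs.2⟩

theorem intervalIntegrable_sub (h : IsPrim f g) {s : ℝ} (hs : s ∈ Icc (0 : ℝ) 1) :
    IntervalIntegrable g volume 0 s :=
  h.1.mono_set (by rw [uIcc_of_le hs.1, uIcc_of_le zero_le_one]; exact Icc_subset_Icc_right hs.2)

/-- Formulated for the integral expression because f itself is constrained only on [0,1]. -/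
theorem absolutelyContinuousOnInterval (h : IsPrim f g) :
    AbsolutelyContinuousOnInterval (fun s => f 0 + ∫ τ in (0 : ℝ)..s, g τ) 0 1 :=
  ((LipschitzWith.const (f 0)).lipschitzOnWith.absolutelyContinuousOnInterval).add
    (h.1.absolutelyContinuousOnInterval_intervalIntegral (by simp))

theorem continuousOn (h : IsPrim f g) : ContinuousOn f (Icc 0 1) := by
  have := h.absolutelyContinuousOnInterval.continuousOn
  rw [uIcc_of_le zero_le_one] at this
  exact this.congr h.2

theorem add (h₁ : IsPrim f₁ g₁) (h₂ : IsPrim f₂ g₂) :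
    IsPrim (fun s => f₁ s + f₂ s) (fun s => g₁ s + g₂ s) := by
  refine ⟨h₁.1.add h₂.1, fun s hs => ?_⟩
  rw [intervalIntegral.integral_add (h₁.intervalIntegrable_sub hs) (h₂.intervalIntegrable_sub hs)]
  beta_reduce
  rw [h₁.2 s hs, h₂.2 s hs]
  ring

theorem const (c : ℝ) : IsPrim (fun _ => c) (fun _ => 0) :=
  ⟨intervalIntegrable_const, fun s _ => by simp⟩

theorem sum {ι : Type*} (t : Finset ι) {F G : ι → ℝ → ℝ} (h : ∀ i ∈ t, IsPrim (F i) (G i)) :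
    IsPrim (fun s => ∑ i ∈ t, F i s) (fun s => ∑ i ∈ t, G i s) := by
  classical
  induction t using Finset.induction_on with
  | empty => simpa using const 0
  | insert a t ha ih =>
    simp only [Finset.sum_insert ha]
    exact (h a (Finset.mem_insert_self _ _)).add
      (ih fun i hi => h i (Finset.mem_insert_of_mem hi))

/-- A product of absolutely continuous functions is absolutely continuous, hence the integral of its
a.e. derivative; Lebesgue differentiation of the two factors computes that derivative. Every
integration by parts in s rests on this rule. -/
theorem mul (h₁ : IsPrim f₁ g₁) (h₂ : IsPrim f₂ g₂) :
    IsPrim (fun s => f₁ s * f₂ s) (fun s => g₁ s * f₂ s + f₁ s * g₂ s) := by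
  have hc₁ := h₁.continuousOn
  have hc₂ := h₂.continuousOn
  rw [← uIcc_of_le (zero_le_one' ℝ)] at hc₁ hc₂
  refine ⟨(h₁.1.mul_continuousOn hc₂).add (h₂.1.continuousOn_mul hc₁), fun s hs => ?_⟩
  set F₁ : ℝ → ℝ := fun s => f₁ 0 + ∫ τ in (0 : ℝ)..s, g₁ τ with hF₁
  set F₂ : ℝ → ℝ := fun s => f₂ 0 + ∫ τ in (0 : ℝ)..s, g₂ τ with hF₂
  have hsub : uIcc 0 s ⊆ uIcc (0 : ℝ) 1 := by
    rw [uIcc_of_le hs.1, uIcc_of_le zero_le_one]; exact Icc_subset_Icc_right hs.2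
  have hac := (h₁.absolutelyContinuousOnInterval.fun_mul
    h₂.absolutelyContinuousOnInterval).mono hsub
  have key := hac.integral_deriv_eq_sub
  have hd : ∫ x in (0 : ℝ)..s, deriv (fun x => F₁ x * F₂ x) x
      = ∫ x in (0 : ℝ)..s, (g₁ x * f₂ x + f₁ x * g₂ x) := by
    refine intervalIntegral.integral_congr_ae ?_
    filter_upwards [h₁.1.ae_hasDerivAt_integral, h₂.1.ae_hasDerivAt_integral] with x hx₁ hx₂ hx
    have hx1 : x ∈ uIcc (0 : ℝ) 1 := hsub (uIoc_subset_uIcc hx)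
    have h0 : (0 : ℝ) ∈ uIcc (0 : ℝ) 1 := left_mem_uIcc
    have hd1 : HasDerivAt F₁ (g₁ x) x := (hx₁ hx1 0 h0).const_add _
    have hd2 : HasDerivAt F₂ (g₂ x) x := (hx₂ hx1 0 h0).const_add _
    have hx1' : x ∈ Icc (0 : ℝ) 1 := by rwa [uIcc_of_le zero_le_one] at hx1
    rw [h₁.2 x hx1', h₂.2 x hx1']
    exact (hd1.mul hd2).deriv
  rw [← hd]
  change _ = _ + ∫ x in (0 : ℝ)..s, deriv (fun x => F₁ x * F₂ x) x
  rw [key]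
  beta_reduce
  rw [h₁.2 s hs, h₂.2 s hs]
  simp

theorem const_mul (c : ℝ) (h : IsPrim f g) : IsPrim (fun s => c * f s) (fun s => c * g s) := by
  simpa using (const c).mul h

/-- The primitive of an integrable function. -/
theorem primitive (c : ℝ) (hg : IntervalIntegrable g volume 0 1) :
    IsPrim (fun s => c + ∫ τ in (0 : ℝ)..s, g τ) g :=
  ⟨hg, fun s _ => by simp⟩

theorem of_hasDerivWithinAt (hf : ∀ s ∈ Icc (0 : ℝ) 1, HasDerivWithinAt f (g s) (Icc 0 1) s)
    (hg : ContinuousOn g (Icc 0 1)) : IsPrim f g := by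
  have hgi : IntervalIntegrable g volume 0 1 :=
    ContinuousOn.intervalIntegrable (by rwa [uIcc_of_le zero_le_one])
  refine ⟨hgi, fun s hs => ?_⟩
  rw [intervalIntegral.integral_eq_sub_of_hasDerivAt_of_le hs.1]
  · ring
  · exact fun x hx => ((hf x ⟨hx.1, hx.2.trans hs.2⟩).continuousWithinAt).mono
      (Icc_subset_Icc_right hs.2)
  · exact fun x hx => (hf x ⟨hx.1.le, (hx.2.trans_le hs.2).le⟩).hasDerivAt
      (Icc_mem_nhds hx.1 (hx.2.trans_le hs.2))
  · exact hgi.mono_set (by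
      rw [uIcc_of_le hs.1, uIcc_of_le zero_le_one]; exact Icc_subset_Icc_right hs.2)

theorem of_contDiffOn (hf : ContDiffOn ℝ 1 f (Icc 0 1)) :
    IsPrim f (derivWithin f (Icc 0 1)) :=
  of_hasDerivWithinAt
    (fun s hs => ((hf.differentiableOn one_ne_zero) s hs).hasDerivWithinAt)
    (hf.continuousOn_derivWithin (uniqueDiffOn_Icc zero_lt_one) le_rfl)

end IsPrim

/-! ### The lemma of du Bois-Reymond -/

theorem exists_testFunction_integral_eq_one : ∃ η : ℝ → ℝ, ContDiff ℝ ∞ η ∧ HasCompactSupport η ∧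
    tsupport η ⊆ Ioo (0 : ℝ) 1 ∧ ∫ s, η s = 1 := by
  let b : ContDiffBump (1 / 2 : ℝ) := ⟨1 / 8, 1 / 4, by norm_num, by norm_num⟩
  refine ⟨b.normed volume, b.contDiff_normed, b.hasCompactSupport_normed, ?_, b.integral_normed⟩
  rw [b.tsupport_normed_eq, Real.closedBall_eq_Icc]
  exact Icc_subset_Ioo (by norm_num [b]) (by norm_num [b])

/-- A test function with vanishing integral is the derivative of a test function. -/
theorem exists_testFunction_deriv_eq {η : ℝ → ℝ} (hη : ContDiff ℝ ∞ η) {a b : ℝ}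
    (ha : 0 < a) (hb : b < 1) (hsupp : ∀ s, s ∉ Icc a b → η s = 0)
    (hint : ∫ s in a..b, η s = 0) :
    ∃ θ : ℝ → ℝ, ContDiff ℝ ∞ θ ∧ HasCompactSupport θ ∧ tsupport θ ⊆ Ioo (0 : ℝ) 1 ∧
      deriv θ = η := by
  set θ : ℝ → ℝ := fun s => ∫ τ in a..s, η τ with hθ
  have hd : ∀ s, HasDerivAt θ (η s) s := fun s =>
    (hη.continuous.integral_hasStrictDerivAt a s).hasDerivAt
  have hderiv : deriv θ = η := funext fun s => (hd s).deriv
  have hz : ∀ s, s ∉ Icc a b → θ s = 0 := by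
    intro s hs
    rcases lt_or_ge s a with h | h
    · rw [hθ]
      refine (intervalIntegral.integral_congr_ae (g := fun _ => 0) ?_).trans (by simp)
      refine (ae_iff.2 ?_ : ∀ᵐ x, x ≠ a).mono fun x hxa hx => hsupp x fun hx' => ?_
      · simp
      · rw [uIoc_of_ge h.le] at hx
        exact hxa (le_antisymm hx.2 hx'.1)
    · have hbs : b < s := lt_of_not_ge fun h' => hs ⟨h, h'⟩
      have h1 : ∫ τ in b..s, η τ = 0 := by
        refine (intervalIntegral.integral_congr_ae (g := fun _ => 0) ?_).trans (by simp)
        refine Eventually.of_forall fun x hx => hsupp x fun hx' => ?_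
        rw [uIoc_of_le hbs.le] at hx
        exact absurd hx'.2 (not_le.2 hx.1)
      rw [hθ]
      change ∫ τ in a..s, η τ = 0
      rw [← intervalIntegral.integral_add_adjacent_intervals
        (hη.continuous.intervalIntegrable a b) (hη.continuous.intervalIntegrable b s), hint, h1,
        add_zero]
  have hts : tsupport θ ⊆ Icc a b :=
    closure_minimal (fun s hs => by_contra fun h => hs (hz s h)) isClosed_Icc
  refine ⟨θ, ?_, isCompact_Icc.of_isClosed_subset (isClosed_tsupport _) hts,
    hts.trans (Icc_subset_Ioo ha hb), hderiv⟩
  rw [contDiff_infty_iff_deriv, hderiv]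
  exact ⟨fun s => (hd s).differentiableAt, hη⟩

theorem integral_testFunction_mul {η : ℝ → ℝ} (hη : tsupport η ⊆ Ioo (0 : ℝ) 1) (h : ℝ → ℝ) :
    ∫ s in Ioo (0 : ℝ) 1, η s * h s = ∫ s, η s * h s := by
  refine setIntegral_eq_integral_of_forall_compl_eq_zero fun s hs => ?_
  rw [image_eq_zero_of_notMem_tsupport fun h' => hs (hη h'), zero_mul]

/-- A function whose weak derivative on `(0,1)` vanishes is constant. -/
theorem ae_eq_const_of_integral_deriv_mul_eq_zero {h : ℝ → ℝ} (hh : IntegrableOn h (Ioo 0 1))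
    (hz : ∀ θ : ℝ → ℝ, ContDiff ℝ ∞ θ → HasCompactSupport θ → tsupport θ ⊆ Ioo (0 : ℝ) 1 →
      ∫ s in Ioo (0 : ℝ) 1, deriv θ s * h s = 0) :
    ∃ c : ℝ, ∀ᵐ s ∂(volume.restrict (Ioo (0 : ℝ) 1)), h s = c := by
  obtain ⟨η₀, hη₀, hc₀, hs₀, hi₀⟩ := exists_testFunction_integral_eq_one
  set c := ∫ s in Ioo (0 : ℝ) 1, η₀ s * h s with hc
  have hmulint : ∀ η : ℝ → ℝ, Continuous η → HasCompactSupport η →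
      IntegrableOn (fun s => η s * h s) (Ioo 0 1) := fun η hη hcη => by
    obtain ⟨C, hC⟩ := hη.bounded_above_of_compact_support hcη
    exact Integrable.bdd_mul hh hη.aestronglyMeasurable (Eventually.of_forall hC)
  refine ⟨c, ?_⟩
  have key : ∀ᵐ s, s ∈ Ioo (0 : ℝ) 1 → h s - c = 0 := by
    refine isOpen_Ioo.ae_eq_zero_of_integral_contDiff_smul_eq_zero
      (hh.sub (by simp : IntegrableOn (fun _ => c) (Ioo (0 : ℝ) 1))).locallyIntegrableOn
      fun η hη hcη hsη => ?_
    simp only [smul_eq_mul]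
    rw [← integral_testFunction_mul hsη (fun s => h s - c)]
    set I := ∫ s, η s with hI
    -- Both functions vanish outside [inf K, sup K], a compact subinterval of (0,1) on which a
    -- mean-zero combination can be integrated to a test function.
    set K : Set ℝ := tsupport η ∪ tsupport η₀ with hK
    have hKc : IsCompact K := IsCompact.union hcη hc₀
    have hKsub : K ⊆ Ioo 0 1 := union_subset hsη hs₀
    have hKne : K.Nonempty := by
      by_contra hne
      rw [not_nonempty_iff_eq_empty, union_empty_iff, tsupport_eq_empty_iff,
        tsupport_eq_empty_iff] at hne
      rw [hne.2] at hi₀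
      simp at hi₀
    have hmem : ∀ s ∈ K, s ∈ Icc (sInf K) (sSup K) := fun s hs =>
      ⟨csInf_le hKc.bddBelow hs, le_csSup hKc.bddAbove hs⟩
    have hsupp : ∀ s, s ∉ Icc (sInf K) (sSup K) → η s = 0 ∧ η₀ s = 0 := fun s hs =>
      ⟨image_eq_zero_of_notMem_tsupport fun h' => hs (hmem s (Or.inl h')),
        image_eq_zero_of_notMem_tsupport fun h' => hs (hmem s (Or.inr h'))⟩
    have hle : sInf K ≤ sSup K := csInf_le_csSup hKne hKc.bddBelow hKc.bddAbove
    have hint : ∀ f : ℝ → ℝ, (∀ s, s ∉ Icc (sInf K) (sSup K) → f s = 0) →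
        ∫ s in sInf K..sSup K, f s = ∫ s, f s := fun f hf => by
      rw [intervalIntegral.integral_of_le hle, ← integral_Icc_eq_integral_Ioc]
      exact setIntegral_eq_integral_of_forall_compl_eq_zero hf
    -- Splitting η into η - Iη₀ and Iη₀: the first has mean zero and is a derivative θ', which h
    -- does not see; the second gives exactly I times the constant c.
    obtain ⟨θ, hθ, hcθ, hsθ, hdθ⟩ := exists_testFunction_deriv_eq
      (η := fun s => η s - I * η₀ s) (hη.sub (contDiff_const.mul hη₀))
      (hKsub (hKc.sInf_mem hKne)).1 (hKsub (hKc.sSup_mem hKne)).2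
      (fun s hs => by simp [hsupp s hs]) (by
        rw [hint _ fun s hs => by simp [hsupp s hs], integral_sub
          (hη.continuous.integrable_of_hasCompactSupport hcη)
          ((hη₀.continuous.integrable_of_hasCompactSupport hc₀).const_mul I),
          integral_const_mul, hi₀]
        simp [hI])
    have h1 := hz θ hθ hcθ hsθ
    rw [hdθ] at h1
    have h2 : ∫ s in Ioo (0 : ℝ) 1, (η s - I * η₀ s) * h s
        = (∫ s in Ioo (0 : ℝ) 1, η s * h s) - I * c := by
      rw [hc, ← integral_const_mul, ← integral_sub (hmulint η hη.continuous hcη)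
        ((hmulint η₀ hη₀.continuous hc₀).const_mul I)]
      congr 1; ext s; ring
    have h3 : ∫ s in Ioo (0 : ℝ) 1, η s * (h s - c)
        = (∫ s in Ioo (0 : ℝ) 1, η s * h s) - I * c := by
      have h4 : ∫ s in Ioo (0 : ℝ) 1, η s * c = I * c := by
        rw [integral_testFunction_mul hsη, integral_mul_const]
      rw [← h4, ← integral_sub (hmulint η hη.continuous hcη)
        (((hη.continuous.integrable_of_hasCompactSupport hcη).mul_const c).integrableOn)]
      congr 1; ext s; ring
    rw [h3, ← h2, h1]
  rw [ae_restrict_iff' measurableSet_Ioo]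
  filter_upwards [key] with s hs hs' using sub_eq_zero.1 (hs hs')

variable {p q m : ℕ}

/-! ### `H¹` functions and their continuous representatives -/

theorem integrable_coord (φ : L2 p q) (i : Idx p q) :
    IntegrableOn (fun s => φ s i) (Ioo (0 : ℝ) 1) := by
  have h1 : Integrable (fun s => φ s) (volume.restrict (Ioo (0 : ℝ) 1)) :=
    (Lp.memLp φ).integrable (by norm_num)
  exact (EuclideanSpace.proj i : EuclideanSpace ℝ (Idx p q) →L[ℝ] ℝ).integrable_comp h1

theorem intervalIntegrable_coord (φ : L2 p q) (i : Idx p q) :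
    IntervalIntegrable (fun s => φ s i) volume 0 1 :=
  (intervalIntegrable_iff_integrableOn_Ioo_of_le zero_le_one).2 (integrable_coord φ i)

theorem eqOn_Icc_of_ae_eq {E : Type*} [TopologicalSpace E] [T2Space E] {f g : ℝ → E}
    (hf : ContinuousOn f (Icc 0 1))
    (hg : ContinuousOn g (Icc 0 1))
    (h : ∀ᵐ s ∂(volume.restrict (Ioo (0 : ℝ) 1)), f s = g s) : EqOn f g (Icc 0 1) := by
  have h1 : EqOn f g (Ioo 0 1) := Measure.eqOn_open_of_ae_eq h isOpen_Ioo
    (hf.mono Ioo_subset_Icc_self) (hg.mono Ioo_subset_Icc_self)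
  have := h1.of_subset_closure hf hg Ioo_subset_Icc_self
    (by rw [closure_Ioo zero_ne_one])
  exact this

/-- Makes the choice inside `contRep` harmless: traces may be computed from any continuous
representative. -/
theorem contRep_eqOn {φ : L2 p q} {f : ℝ → Idx p q → ℝ} (hf : ContinuousOn f (Icc 0 1))
    (h : ∀ᵐ s ∂(volume.restrict (Ioo (0 : ℝ) 1)), WithLp.ofLp (φ s) = f s) :
    EqOn (contRep φ) f (Icc 0 1) := by
  have hex : ∃ f : ℝ → Idx p q → ℝ, ContinuousOn f (Icc 0 1) ∧
      ∀ᵐ s ∂(volume.restrict (Ioo (0 : ℝ) 1)), WithLp.ofLp (φ s) = f s := ⟨f, hf, h⟩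
  rw [contRep, dif_pos hex]
  refine eqOn_Icc_of_ae_eq hex.choose_spec.1 hf ?_
  filter_upwards [hex.choose_spec.2, h] with s h1 h2 using h1.symm.trans h2

/-- `f` is the continuous representative of `φ`, and it is a primitive of `g`. -/
structure IsH1Rep (φ g : L2 p q) (f : ℝ → Idx p q → ℝ) : Prop where
  ae_eq : ∀ᵐ s ∂(volume.restrict (Ioo (0 : ℝ) 1)), WithLp.ofLp (φ s) = f s
  isPrim : ∀ i, IsPrim (fun s => f s i) (fun s => g s i)

namespace IsH1Rep

variable {φ g : L2 p q} {f : ℝ → Idx p q → ℝ}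

theorem continuousOn (h : IsH1Rep φ g f) : ContinuousOn f (Icc 0 1) :=
  continuousOn_pi.2 fun i => (h.isPrim i).continuousOn

theorem contRep_eqOn (h : IsH1Rep φ g f) : EqOn (contRep φ) f (Icc 0 1) :=
  HypReg.contRep_eqOn h.continuousOn h.ae_eq

theorem hasWeakDeriv (h : IsH1Rep φ g f) : HasWeakDeriv φ g := by
  intro θ hθ hcθ hsθ i
  have hp : IsPrim θ (deriv θ) := IsPrim.of_hasDerivWithinAt
    (fun s _ => ((hθ.differentiable (by simp)) s).hasDerivAt.hasDerivWithinAt)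
    (hθ.continuous_deriv (by simp)).continuousOn
  have hm := hp.mul (h.isPrim i)
  have h0 : θ 0 = 0 := image_eq_zero_of_notMem_tsupport fun h' => lt_irrefl _ (hsθ h').1
  have h1 : θ 1 = 0 := image_eq_zero_of_notMem_tsupport fun h' => lt_irrefl _ (hsθ h').2
  have key := hm.integral_eq
  have hci := (h.isPrim i).continuousOn
  rw [integral_add] at key
  · have he : ∫ s in Ioo (0 : ℝ) 1, deriv θ s * φ s i = ∫ s in Ioo (0 : ℝ) 1, deriv θ s * f s i := by
      refine integral_congr_ae ?_
      filter_upwards [h.ae_eq] with s hs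
      rw [← hs]
    rw [he]
    simp only [h0, h1] at key
    linarith
  · exact (((hθ.continuous_deriv (by simp)).continuousOn.mul hci).integrableOn_Icc).mono_set
      Ioo_subset_Icc_self
  · have := (intervalIntegrable_coord g i).continuousOn_mul
      (hθ.continuous.continuousOn (s := uIcc 0 1))
    exact (intervalIntegrable_iff_integrableOn_Ioo_of_le zero_le_one).1 this

end IsH1Rep

/-- Each component of φ minus the primitive of g has zero weak derivative, so it is constant. The
primitive plus that constant is the continuous representative. -/
theorem HasWeakDeriv.isH1Rep {φ g : L2 p q} (h : HasWeakDeriv φ g) :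
    IsH1Rep φ g (contRep φ) := by
  have hex : ∀ i, ∃ c : ℝ, ∀ᵐ s ∂(volume.restrict (Ioo (0 : ℝ) 1)),
      φ s i - (∫ τ in (0 : ℝ)..s, g τ i) = c := fun i => by
    have hp : IsPrim (fun s => ∫ τ in (0 : ℝ)..s, g τ i) (fun s => g s i) := by
      simpa using IsPrim.primitive 0 (intervalIntegrable_coord g i)
    refine ae_eq_const_of_integral_deriv_mul_eq_zero ((integrable_coord φ i).sub
      (hp.continuousOn.integrableOn_Icc.mono_set Ioo_subset_Icc_self)) fun θ hθ hcθ hsθ => ?_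
    have hθp : IsPrim θ (deriv θ) := IsPrim.of_hasDerivWithinAt
      (fun s _ => ((hθ.differentiable (by simp)) s).hasDerivAt.hasDerivWithinAt)
      (hθ.continuous_deriv (by simp)).continuousOn
    have h0 : θ 0 = 0 := image_eq_zero_of_notMem_tsupport fun h' => lt_irrefl _ (hsθ h').1
    have h1 : θ 1 = 0 := image_eq_zero_of_notMem_tsupport fun h' => lt_irrefl _ (hsθ h').2
    have hdc : Continuous (deriv θ) := hθ.continuous_deriv (by simp)
    have hi1 : IntegrableOn (fun s => deriv θ s * ∫ τ in (0 : ℝ)..s, g τ i) (Ioo 0 1) :=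
      (hdc.continuousOn.mul hp.continuousOn).integrableOn_Icc.mono_set Ioo_subset_Icc_self
    have hi2 : IntegrableOn (fun s => θ s * g s i) (Ioo 0 1) :=
      (intervalIntegrable_iff_integrableOn_Ioo_of_le zero_le_one).1
        ((intervalIntegrable_coord g i).continuousOn_mul (hθ.continuous.continuousOn))
    have hi3 : IntegrableOn (fun s => deriv θ s * φ s i) (Ioo 0 1) :=
      (intervalIntegrable_iff_integrableOn_Ioo_of_le zero_le_one).1
        ((intervalIntegrable_coord φ i).continuousOn_mul hdc.continuousOn)
    have key := (hθp.mul hp).integral_eq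
    rw [integral_add hi1 hi2, h0, h1, zero_mul, zero_mul, sub_zero] at key
    simp only [mul_sub]
    rw [integral_sub hi3 hi1, h θ hθ hcθ hsθ i]
    linarith
  choose c hc using hex
  set f : ℝ → Idx p q → ℝ := fun s i => c i + ∫ τ in (0 : ℝ)..s, g τ i with hf
  have hprim : ∀ i, IsPrim (fun s => f s i) (fun s => g s i) := fun i =>
    IsPrim.primitive (c i) (intervalIntegrable_coord g i)
  have hae : ∀ᵐ s ∂(volume.restrict (Ioo (0 : ℝ) 1)), WithLp.ofLp (φ s) = f s := by
    filter_upwards [ae_all_iff.2 hc] with s hs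
    funext i
    simp [hf, ← hs i]
  have heq := contRep_eqOn (continuousOn_pi.2 fun i => (hprim i).continuousOn) hae
  refine ⟨?_, fun i => (hprim i).congr fun s hs => congrFun (heq hs) i⟩
  filter_upwards [hae, ae_restrict_mem measurableSet_Ioo] with s hs hs'
  rw [hs, heq (Ioo_subset_Icc_self hs')]

/-! ### Operators on `C([0,1], ℝⁿ)` and `L²((0,1), ℝⁿ)` -/

/-- Entrywise continuity on `[0,1]` of a matrix valued function. -/
def MatContinuousOn {ι κ : Type*} (M : ℝ → Matrix ι κ ℝ) : Prop :=
  ∀ i j, ContinuousOn (fun s => M s i j) (Icc 0 1)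

theorem MatContinuousOn.mul {ι κ l : Type*} [Fintype κ] {M : ℝ → Matrix ι κ ℝ}
    {N : ℝ → Matrix κ l ℝ} (hM : MatContinuousOn M) (hN : MatContinuousOn N) :
    MatContinuousOn fun s => M s * N s := fun i j => by
  simp only [Matrix.mul_apply]
  exact continuousOn_finsetSum _ fun k _ => (hM i k).mul (hN k j)

theorem MatContinuousOn.sub {ι κ : Type*} {M N : ℝ → Matrix ι κ ℝ}
    (hM : MatContinuousOn M) (hN : MatContinuousOn N) :
    MatContinuousOn fun s => M s - N s := fun i j => (hM i j).sub (hN i j)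

theorem MatContinuousOn.neg {ι κ : Type*} {M : ℝ → Matrix ι κ ℝ}
    (hM : MatContinuousOn M) :
    MatContinuousOn fun s => -M s := fun i j => (hM i j).neg

theorem MatContinuousOn.transpose {ι κ : Type*} {M : ℝ → Matrix ι κ ℝ}
    (hM : MatContinuousOn M) :
    MatContinuousOn fun s => (M s)ᵀ := fun i j => hM j i

theorem MatContinuousOn.const {ι κ : Type*} (M : Matrix ι κ ℝ) :
    MatContinuousOn fun _ => M := fun _ _ => continuousOn_const

theorem MatContinuousOn.diagonal {ι : Type*} [DecidableEq ι] {d : ℝ → ι → ℝ}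
    (hd : ∀ i, ContinuousOn (fun s => d s i) (Icc 0 1)) :
    MatContinuousOn fun s => Matrix.diagonal (d s) := fun i j => by
  by_cases h : i = j
  · subst h; simpa using hd i
  · simpa [Matrix.diagonal_apply_ne _ h] using continuousOn_const

theorem MatContinuousOn.mulVec {ι κ : Type*} [Fintype κ] {M : ℝ → Matrix ι κ ℝ}
    (hM : MatContinuousOn M) {f : ℝ → κ → ℝ} (hf : ContinuousOn f (Icc 0 1)) :
    ContinuousOn (fun s => M s *ᵥ f s) (Icc 0 1) := by
  refine continuousOn_pi.2 fun i => ?_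
  simp only [Matrix.mulVec, dotProduct]
  exact continuousOn_finsetSum _ fun k _ => (hM i k).mul (continuousOn_pi.1 hf k)

theorem MatContinuousOn.toEuclideanCLM {ι : Type*} [Fintype ι] [DecidableEq ι]
    {M : ℝ → Matrix ι ι ℝ} (hM : MatContinuousOn M) :
    ContinuousOn (fun s => Matrix.toEuclideanCLM (𝕜 := ℝ) (M s)) (Icc 0 1) := by
  have h1 : ContinuousOn M (Icc 0 1) := continuousOn_pi.2 fun i => continuousOn_pi.2 fun j => hM i j
  have h2 : Continuous (Matrix.toEuclideanCLM (𝕜 := ℝ) (n := ι)) :=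
    LinearMap.continuous_of_finiteDimensional
      (Matrix.toEuclideanCLM (𝕜 := ℝ) (n := ι)).toAlgEquiv.toLinearMap
  exact h2.comp_continuousOn h1

theorem exists_bound_toEuclideanCLM {M : ℝ → Matrix (Idx p q) (Idx p q) ℝ}
    (hM : MatContinuousOn M) :
    ∃ C, ∀ s ∈ Ioo (0 : ℝ) 1, ‖Matrix.toEuclideanCLM (𝕜 := ℝ) (M s)‖ ≤ C := by
  obtain ⟨C, hC⟩ := isCompact_Icc.exists_bound_of_continuousOn hM.toEuclideanCLM
  exact ⟨C, fun s hs => hC s (Ioo_subset_Icc_self hs)⟩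

theorem memLp_mulVec {M : ℝ → Matrix (Idx p q) (Idx p q) ℝ} (hM : MatContinuousOn M)
    (φ : L2 p q) :
    MemLp (fun s => Matrix.toEuclideanCLM (𝕜 := ℝ) (M s) (φ s)) 2
      (volume.restrict (Ioo (0 : ℝ) 1)) := by
  obtain ⟨C, hC⟩ := exists_bound_toEuclideanCLM hM
  refine MemLp.of_le_mul (c := C) (Lp.memLp φ) ?_ ?_
  · have h1 : AEStronglyMeasurable (fun s => Matrix.toEuclideanCLM (𝕜 := ℝ) (M s))
        (volume.restrict (Ioo (0 : ℝ) 1)) :=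
      (hM.toEuclideanCLM.mono Ioo_subset_Icc_self).aestronglyMeasurable measurableSet_Ioo
    exact (isBoundedBilinearMap_apply (𝕜 := ℝ) (E := EuclideanSpace ℝ (Idx p q))
      (F := EuclideanSpace ℝ (Idx p q))).continuous.comp_aestronglyMeasurable
      (h1.prodMk (Lp.aestronglyMeasurable φ))
  · filter_upwards [ae_restrict_mem measurableSet_Ioo] with s hs
    exact (Matrix.toEuclideanCLM (𝕜 := ℝ) (M s)).le_of_opNorm_le (hC s hs) _

/-- Multiplication by a matrix valued function that is continuous on `[0,1]`. -/
def mulL2 {M : ℝ → Matrix (Idx p q) (Idx p q) ℝ} (hM : MatContinuousOn M) :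
    L2 p q →L[ℝ] L2 p q :=
  LinearMap.mkContinuousOfExistsBound
    { toFun := fun φ => (memLp_mulVec hM φ).toLp
      map_add' := fun φ ψ => by
        rw [← MemLp.toLp_add]
        refine MemLp.toLp_congr _ _ ?_
        filter_upwards [Lp.coeFn_add φ ψ] with s hs
        rw [hs, Pi.add_apply, map_add, Pi.add_apply]
      map_smul' := fun c φ => by
        rw [RingHom.id_apply, ← MemLp.toLp_const_smul]
        refine MemLp.toLp_congr _ _ ?_
        filter_upwards [Lp.coeFn_smul c φ] with s hs
        rw [hs, Pi.smul_apply, map_smul, Pi.smul_apply] }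
    (by
      obtain ⟨C, hC⟩ := exists_bound_toEuclideanCLM hM
      refine ⟨C, fun φ => Lp.norm_le_mul_norm_of_ae_le_mul ?_⟩
      filter_upwards [ae_restrict_mem measurableSet_Ioo,
        MemLp.coeFn_toLp (memLp_mulVec hM φ)] with s hs h
      simp only [LinearMap.coe_mk, AddHom.coe_mk]
      rw [h]
      exact (Matrix.toEuclideanCLM (𝕜 := ℝ) (M s)).le_of_opNorm_le (hC s hs) _)

theorem mulL2_ae {M : ℝ → Matrix (Idx p q) (Idx p q) ℝ} (hM : MatContinuousOn M) (φ : L2 p q) :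
    ∀ᵐ s ∂(volume.restrict (Ioo (0 : ℝ) 1)),
      WithLp.ofLp (mulL2 hM φ s) = M s *ᵥ WithLp.ofLp (φ s) := by
  filter_upwards [MemLp.coeFn_toLp (memLp_mulVec hM φ)] with s h
  exact congrArg WithLp.ofLp h

/-- `C([0,1], ℝⁿ)`. -/
abbrev C01 (p q : ℕ) : Type := C(Icc (0 : ℝ) 1, Idx p q → ℝ)

/-- The extension of an element of `C([0,1], ℝⁿ)` to the real line by constants. -/
def extC (f : C01 p q) : ℝ → Idx p q → ℝ := IccExtend zero_le_one f

theorem continuous_extC (f : C01 p q) : Continuous (extC f) := f.continuous.Icc_extend'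

theorem extC_apply (f : C01 p q) {s : ℝ} (hs : s ∈ Icc (0 : ℝ) 1) : extC f s = f ⟨s, hs⟩ :=
  IccExtend_of_mem _ _ hs

theorem norm_toLp_extC_le (f : C01 p q) (s : ℝ) :
    ‖(WithLp.toLp 2 (extC f s) : EuclideanSpace ℝ (Idx p q))‖
      ≤ ‖(PiLp.continuousLinearEquiv 2 ℝ (fun _ : Idx p q => ℝ)).symm.toContinuousLinearMap‖ * ‖f‖ :=
  ((PiLp.continuousLinearEquiv 2 ℝ
    (fun _ : Idx p q => ℝ)).symm.toContinuousLinearMap.le_opNorm (extC f s)).trans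
    (by gcongr; exact f.norm_coe_le_norm _)

theorem memLp_extC (f : C01 p q) :
    MemLp (fun s => (WithLp.toLp 2 (extC f s) : EuclideanSpace ℝ (Idx p q))) 2
      (volume.restrict (Ioo (0 : ℝ) 1)) :=
  MemLp.of_bound ((PiLp.continuous_toLp 2 _).comp (continuous_extC f)).aestronglyMeasurable _
    (Eventually.of_forall (norm_toLp_extC_le f))

/-- The embedding of `C([0,1], ℝⁿ)` in `L²((0,1), ℝⁿ)`. -/
def embL2 : C01 p q →L[ℝ] L2 p q :=
  LinearMap.mkContinuousOfExistsBound
    { toFun := fun f => (memLp_extC f).toLp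
      map_add' := fun _ _ => rfl
      map_smul' := fun _ _ => rfl }
    (by
      refine ⟨_, fun f => (Lp.norm_le_of_ae_bound
        (mul_nonneg (norm_nonneg (PiLp.continuousLinearEquiv 2 ℝ
          (fun _ : Idx p q => ℝ)).symm.toContinuousLinearMap) (norm_nonneg f)) ?_).trans_eq
        (mul_assoc _ _ ‖f‖).symm⟩
      filter_upwards [MemLp.coeFn_toLp (memLp_extC f)] with s h
      exact (congrArg norm h).trans_le (norm_toLp_extC_le f s))

theorem embL2_ae (f : C01 p q) : ∀ᵐ s ∂(volume.restrict (Ioo (0 : ℝ) 1)),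
    WithLp.ofLp (embL2 f s) = extC f s := by
  filter_upwards [MemLp.coeFn_toLp (memLp_extC f)] with s h
  exact congrArg WithLp.ofLp h

/-- On (0,1) Lebesgue measure is a probability measure, so the L¹ norm is at most the L² norm. This
makes the primitive a bounded map from L² to C([0,1]). -/
theorem norm_integral_coord_le (φ : L2 p q) (i : Idx p q) {s : ℝ} (hs : s ∈ Icc (0 : ℝ) 1) :
    ‖∫ τ in (0 : ℝ)..s, φ τ i‖ ≤ ‖φ‖ := by
  have h1 : ‖∫ τ in (0 : ℝ)..s, φ τ i‖ ≤ ∫ τ in Ioo (0 : ℝ) 1, ‖φ τ‖ := by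
    rw [intervalIntegral.integral_of_le hs.1, ← integral_Ioc_eq_integral_Ioo]
    refine (norm_integral_le_integral_norm _).trans ?_
    have hint : IntegrableOn (fun τ => ‖φ τ‖) (Ioc (0 : ℝ) 1) :=
      (integrableOn_Ioc_iff_integrableOn_Ioo).2 ((Lp.memLp φ).integrable (by norm_num)).norm
    refine (integral_mono_of_nonneg (Eventually.of_forall fun _ => norm_nonneg _)
      (hint.mono_set (Ioc_subset_Ioc_right hs.2))
      (Eventually.of_forall fun τ => PiLp.norm_apply_le (φ τ) i)).trans ?_
    exact setIntegral_mono_set hint (Eventually.of_forall fun _ => norm_nonneg _)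
      (Ioc_subset_Ioc_right hs.2).eventuallyLE
  refine h1.trans ?_
  have h2 : ∫ τ in Ioo (0 : ℝ) 1, ‖φ τ‖ = (eLpNorm φ 1 (volume.restrict (Ioo (0 : ℝ) 1))).toReal := by
    rw [eLpNorm_one_eq_lintegral_enorm,
      integral_norm_eq_lintegral_enorm (Lp.aestronglyMeasurable φ)]
  rw [h2, Lp.norm_def]
  refine ENNReal.toReal_mono (Lp.eLpNorm_ne_top φ) ?_
  have : IsProbabilityMeasure (volume.restrict (Ioo (0 : ℝ) 1)) := ⟨by simp⟩
  exact eLpNorm_le_eLpNorm_of_exponent_le (by norm_num) (Lp.aestronglyMeasurable φ)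

/-- The primitive that vanishes at `0`. -/
def primC : L2 p q →L[ℝ] C01 p q :=
  LinearMap.mkContinuous
    { toFun := fun φ => ⟨fun s i => ∫ τ in (0 : ℝ)..s, φ τ i, by
        refine continuous_pi fun i => ?_
        have := (IsPrim.primitive 0 (intervalIntegrable_coord φ i)).continuousOn
        simpa [domRestrict_def] using this.domRestrict⟩
      map_add' := fun φ ψ => by
        ext s i
        have hs := s.2
        have := ((IsPrim.primitive 0 (intervalIntegrable_coord φ i)).intervalIntegrable_sub hs)
        have := ((IsPrim.primitive 0 (intervalIntegrable_coord ψ i)).intervalIntegrable_sub hs)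
        simp only [ContinuousMap.coe_mk, ContinuousMap.add_apply, Pi.add_apply]
        rw [← intervalIntegral.integral_add ‹_› ‹_›]
        refine intervalIntegral.integral_congr_ae ?_
        filter_upwards [ae_Ioo_iff_ae_uIoc.1 (Lp.coeFn_add φ ψ)] with τ h1 h2
        rw [h1 (by
          rw [uIoc_of_le zero_le_one]; rw [uIoc_of_le hs.1] at h2
          exact ⟨h2.1, h2.2.trans hs.2⟩)]
        rfl
      map_smul' := fun c φ => by
        ext s i
        have hs := s.2
        simp only [ContinuousMap.coe_mk, ContinuousMap.smul_apply, Pi.smul_apply,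
          RingHom.id_apply]
        rw [← intervalIntegral.integral_smul]
        refine intervalIntegral.integral_congr_ae ?_
        filter_upwards [ae_Ioo_iff_ae_uIoc.1 (Lp.coeFn_smul c φ)] with τ h1 h2
        rw [h1 (by
          rw [uIoc_of_le zero_le_one]; rw [uIoc_of_le hs.1] at h2
          exact ⟨h2.1, h2.2.trans hs.2⟩)]
        rfl }
    1 (fun φ => by
      rw [one_mul, ContinuousMap.norm_le _ (norm_nonneg _)]
      intro s
      rw [pi_norm_le_iff_of_nonneg (norm_nonneg _)]
      exact fun i => norm_integral_coord_le φ i s.2)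

theorem primC_apply (φ : L2 p q) (s : Icc (0 : ℝ) 1) (i : Idx p q) :
    primC φ s i = ∫ τ in (0 : ℝ)..s, φ τ i := rfl

/-- Multiplication by a matrix valued function on `C([0,1], ℝⁿ)`. -/
def mulC {M : ℝ → Matrix (Idx p q) (Idx p q) ℝ} (hM : MatContinuousOn M) :
    C01 p q →L[ℝ] C01 p q where
  toFun f := ⟨fun s => M s *ᵥ f s, by
    have := hM.mulVec (continuous_extC f).continuousOn
    refine this.domRestrict.congr fun s => ?_
    simp [extC_apply f s.2]⟩
  map_add' f g := by ext s; simp [Matrix.mulVec_add]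
  map_smul' c f := by ext s; simp [Matrix.mulVec_smul]
  cont := by
    refine ContinuousMap.continuous_of_continuous_uncurry _ ?_
    have hM' : ∀ i j, Continuous fun s : Icc (0 : ℝ) 1 => M s i j := fun i j => (hM i j).domRestrict
    refine continuous_pi fun i => ?_
    simp only [Function.uncurry, ContinuousMap.coe_mk, Matrix.mulVec, dotProduct]
    refine continuous_finsetSum _ fun j _ => ((hM' i j).comp continuous_snd).mul ?_
    exact (continuous_apply j).comp (continuous_eval)

/-! ### Splitting into the components `+` and `-` -/

section Parts

variable (x y : Idx p q → ℝ)

@[simp] theorem plusPart_inl (i : Fin p) : plusPart x (Sum.inl i) = x (Sum.inl i) := rfl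
@[simp] theorem plusPart_inr (j : Fin q) : plusPart x (Sum.inr j) = 0 := rfl
@[simp] theorem minusPart_inl (i : Fin p) : minusPart x (Sum.inl i) = 0 := rfl
@[simp] theorem minusPart_inr (j : Fin q) : minusPart x (Sum.inr j) = x (Sum.inr j) := rfl

theorem plusPart_add_minusPart : plusPart x + minusPart x = x := by
  ext (i | j) <;> simp

theorem plusPart_add : plusPart (x + y) = plusPart x + plusPart y := by
  ext (i | j) <;> simp

theorem minusPart_add : minusPart (x + y) = minusPart x + minusPart y := by
  ext (i | j) <;> simp

theorem plusPart_sub : plusPart (x - y) = plusPart x - plusPart y := by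
  ext (i | j) <;> simp

theorem minusPart_sub : minusPart (x - y) = minusPart x - minusPart y := by
  ext (i | j) <;> simp

theorem plusPart_smul (c : ℝ) : plusPart (c • x) = c • plusPart x := by
  ext (i | j) <;> simp

theorem minusPart_smul (c : ℝ) : minusPart (c • x) = c • minusPart x := by
  ext (i | j) <;> simp

end Parts

/-- `plusPart` as a linear map. -/
def plusL : (Idx p q → ℝ) →ₗ[ℝ] Idx p q → ℝ where
  toFun := plusPart
  map_add' := plusPart_add
  map_smul' c x := plusPart_smul x c

/-- `minusPart` as a linear map. -/
def minusL : (Idx p q → ℝ) →ₗ[ℝ] Idx p q → ℝ where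
  toFun := minusPart
  map_add' := minusPart_add
  map_smul' c x := minusPart_smul x c

theorem traceIn_eq (f : ℝ → Idx p q → ℝ) : traceIn f = plusPart (f 0) + minusPart (f 1) := by
  ext (i | j) <;> simp [traceIn]

theorem traceOut_eq (f : ℝ → Idx p q → ℝ) : traceOut f = plusPart (f 1) + minusPart (f 0) := by
  ext (i | j) <;> simp [traceOut]

theorem fromBlocks_bottom_mulVec (F : Matrix (Idx p q) (Idx p q) ℝ) (c : Idx p q → ℝ) :
    Matrix.fromBlocks 1 0 F.toBlocks₂₁ F.toBlocks₂₂ *ᵥ c = plusPart c + minusPart (F *ᵥ c) := by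
  ext (i | j)
  · simp [Matrix.fromBlocks_mulVec]
  · simp [Matrix.mulVec, dotProduct, Matrix.toBlocks₂₁, Matrix.toBlocks₂₂]

theorem fromBlocks_top_mulVec (F : Matrix (Idx p q) (Idx p q) ℝ) (c : Idx p q → ℝ) :
    Matrix.fromBlocks F.toBlocks₁₁ F.toBlocks₁₂ 0 1 *ᵥ c = plusPart (F *ᵥ c) + minusPart c := by
  ext (i | j)
  · simp [Matrix.mulVec, dotProduct, Matrix.toBlocks₁₁, Matrix.toBlocks₁₂]
  · simp [Matrix.fromBlocks_mulVec]

/-! ### Primitives of matrix valued functions -/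

/-- Entrywise primitives. -/
def MatPrim {ι κ : Type*} (M M' : ℝ → Matrix ι κ ℝ) : Prop :=
  ∀ i j, IsPrim (fun s => M s i j) (fun s => M' s i j)

namespace MatPrim

variable {ι κ l : Type*} {M M' M'' : ℝ → Matrix ι κ ℝ}
  {N N' : ℝ → Matrix κ l ℝ}

theorem mul [Fintype κ] (hM : MatPrim M M') (hN : MatPrim N N') :
    MatPrim (fun s => M s * N s) (fun s => M' s * N s + M s * N' s) := fun i j => by
  simp only [Matrix.mul_apply, Matrix.add_apply, ← Finset.sum_add_distrib]
  exact IsPrim.sum _ fun k _ => (hM i k).mul (hN k j)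

theorem mulVec [Fintype κ] (hM : MatPrim M M') {f g : ℝ → κ → ℝ}
    (hf : ∀ k, IsPrim (fun s => f s k) (fun s => g s k)) (i : ι) :
    IsPrim (fun s => (M s *ᵥ f s) i) (fun s => (M' s *ᵥ f s + M s *ᵥ g s) i) := by
  simp only [Matrix.mulVec, dotProduct, Pi.add_apply, ← Finset.sum_add_distrib]
  exact IsPrim.sum _ fun k _ => (hM i k).mul (hf k)

theorem congr_deriv (hM : MatPrim M M') (h : ∀ s ∈ Icc (0 : ℝ) 1, M' s = M'' s) :
    MatPrim M M'' := fun i j => (hM i j).congr_ae (by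
  filter_upwards [ae_restrict_mem measurableSet_Ioo] with s hs
  rw [h s (Ioo_subset_Icc_self hs)])

theorem eq_of_deriv_eq_zero (hM : MatPrim M fun _ => 0) {s : ℝ} (hs : s ∈ Icc (0 : ℝ) 1) :
    M s = M 0 := by
  ext i j
  have := (hM i j).2 s hs
  simpa using this

end MatPrim

/-! ### Coefficient matrices of the system -/

namespace HypSystem

variable (S : HypSystem p q m)

theorem lam_ne_zero {s : ℝ} (hs : s ∈ Icc (0 : ℝ) 1) (i : Idx p q) : S.lam s i ≠ 0 := by
  rcases i with i | j
  · exact (S.lam_pos s hs i).ne'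
  · exact (S.lam_neg s hs j).ne

theorem lam_continuousOn (i : Idx p q) : ContinuousOn (fun s => S.lam s i) (Icc 0 1) :=
  (S.lam_contDiffOn i).continuousOn

/-- `diag(1 / λᵢ)`. -/
def Laminv (s : ℝ) : Matrix (Idx p q) (Idx p q) ℝ := Matrix.diagonal fun i => (S.lam s i)⁻¹

theorem Laminv_mul_Lam0 {s : ℝ} (hs : s ∈ Icc (0 : ℝ) 1) : S.Laminv s * S.Lam0 s = 1 := by
  rw [Laminv, Lam0, Matrix.diagonal_mul_diagonal, ← Matrix.diagonal_one]
  congr 1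
  ext i
  exact inv_mul_cancel₀ (S.lam_ne_zero hs i)

theorem Lam0_mul_Laminv {s : ℝ} (hs : s ∈ Icc (0 : ℝ) 1) : S.Lam0 s * S.Laminv s = 1 :=
  mul_eq_one_comm.1 (S.Laminv_mul_Lam0 hs)

theorem Lam0_inv {s : ℝ} (hs : s ∈ Icc (0 : ℝ) 1) : (S.Lam0 s)⁻¹ = S.Laminv s :=
  Matrix.inv_eq_left_inv (S.Laminv_mul_Lam0 hs)

theorem Lam0_matContinuousOn : MatContinuousOn S.Lam0 :=
  MatContinuousOn.diagonal S.lam_continuousOn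

theorem Laminv_matContinuousOn : MatContinuousOn S.Laminv :=
  MatContinuousOn.diagonal fun i => (S.lam_continuousOn i).inv₀ fun _ hs => S.lam_ne_zero hs i

theorem Lam0'_matContinuousOn : MatContinuousOn S.Lam0' :=
  MatContinuousOn.diagonal fun i =>
    (S.lam_contDiffOn i).continuousOn_derivWithin (uniqueDiffOn_Icc zero_lt_one) le_rfl

theorem Lam1_matContinuousOn : MatContinuousOn S.Lam1 := fun i j =>
  (S.Lam1_contDiffOn i j).continuousOn

theorem Lam0_matPrim : MatPrim S.Lam0 S.Lam0' := fun i j => by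
  by_cases h : i = j
  · subst h
    simpa [Lam0, Lam0'] using IsPrim.of_contDiffOn (S.lam_contDiffOn i)
  · simpa [Lam0, Lam0', Matrix.diagonal_apply_ne _ h] using IsPrim.const 0

theorem Kplus_mulVec (x : Idx p q → ℝ) : S.Kplus *ᵥ x = plusPart x + minusPart (S.K *ᵥ x) :=
  fromBlocks_bottom_mulVec _ _

theorem Kminus_mulVec (x : Idx p q → ℝ) : S.Kminus *ᵥ x = plusPart (S.K *ᵥ x) + minusPart x :=
  fromBlocks_top_mulVec _ _

/-! ### The fundamental matrices -/

section Fundamental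

variable {S} {Φ Ψ : ℝ → Matrix (Idx p q) (Idx p q) ℝ}

theorem IsPhi.matContinuousOn (hΦ : S.IsPhi Φ) : MatContinuousOn Φ := fun i j s hs =>
  (hΦ.2 s hs i j).continuousWithinAt

theorem IsPsi.matContinuousOn (hΨ : S.IsPsi Ψ) : MatContinuousOn Ψ := fun i j s hs =>
  (hΨ.2 s hs i j).continuousWithinAt

theorem IsPhi.matPrim (hΦ : S.IsPhi Φ) :
    MatPrim Φ fun s => -(S.Laminv s * S.Lam1 s * Φ s) := fun i j =>
  IsPrim.of_hasDerivWithinAt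
    (fun s hs => by simpa only [S.Lam0_inv hs] using hΦ.2 s hs i j)
    (((S.Laminv_matContinuousOn.mul S.Lam1_matContinuousOn).mul hΦ.matContinuousOn).neg i j)

theorem IsPsi.matPrim (hΨ : S.IsPsi Ψ) :
    MatPrim Ψ fun s => Ψ s * (S.Lam1 s - S.Lam0' s) * S.Laminv s := fun i j =>
  IsPrim.of_hasDerivWithinAt
    (fun s hs => by simpa only [S.Lam0_inv hs] using hΨ.2 s hs i j)
    (((hΨ.matContinuousOn.mul (S.Lam1_matContinuousOn.sub S.Lam0'_matContinuousOn)).mul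
      S.Laminv_matContinuousOn) i j)

/-- The Λ₀' in the equation for Ψ is there to cancel against the derivative of Λ₀ in the product
rule. -/
theorem IsPsi.matPrim_mul_Lam0 (hΨ : S.IsPsi Ψ) :
    MatPrim (fun s => Ψ s * S.Lam0 s) fun s => Ψ s * S.Lam1 s :=
  (hΨ.matPrim.mul S.Lam0_matPrim).congr_deriv fun s hs => by
    rw [Matrix.mul_assoc _ (S.Laminv s), S.Laminv_mul_Lam0 hs, Matrix.mul_one, Matrix.mul_sub,
      sub_add_cancel]

/-- The derivative is ΨΛ₁Φ - ΨΛ₀Λ₀⁻¹Λ₁Φ = 0: Ψ solves the adjoint of the equation for Φ, so the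
pairing is conserved. -/
theorem psi_mul_Lam0_mul_phi (hΦ : S.IsPhi Φ) (hΨ : S.IsPsi Ψ) {s : ℝ} (hs : s ∈ Icc (0 : ℝ) 1) :
    Ψ s * S.Lam0 s * Φ s = S.Lam0 0 := by
  have h := (hΨ.matPrim_mul_Lam0.mul hΦ.matPrim).congr_deriv (M'' := fun _ => 0) fun s hs => by
    rw [Matrix.mul_neg, Matrix.mul_assoc (S.Laminv s), Matrix.mul_assoc (Ψ s) (S.Lam0 s),
      ← Matrix.mul_assoc (S.Lam0 s), S.Lam0_mul_Laminv hs, Matrix.one_mul, Matrix.mul_assoc,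
      add_neg_cancel]
  have h0 := h.eq_of_deriv_eq_zero hs
  rw [h0, hΦ.1, hΨ.1, Matrix.one_mul, Matrix.mul_one]

/-- Conservation makes Λ₀(0)⁻¹ΨΛ₀ the inverse of Φ, so Ψ serves as the kernel in variation of
constants. -/
theorem phi_mul_psi (hΦ : S.IsPhi Φ) (hΨ : S.IsPsi Ψ) {s : ℝ} (hs : s ∈ Icc (0 : ℝ) 1) :
    Φ s * (S.Laminv 0 * Ψ s) = S.Laminv s := by
  have h0 : (0 : ℝ) ∈ Icc (0 : ℝ) 1 := ⟨le_rfl, zero_le_one⟩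
  have h1 : (S.Laminv 0 * Ψ s * S.Lam0 s) * Φ s = 1 := by
    rw [Matrix.mul_assoc (S.Laminv 0), Matrix.mul_assoc (S.Laminv 0), psi_mul_Lam0_mul_phi hΦ hΨ hs,
      S.Laminv_mul_Lam0 h0]
  have h2 := mul_eq_one_comm.1 h1
  calc Φ s * (S.Laminv 0 * Ψ s) = Φ s * (S.Laminv 0 * Ψ s * S.Lam0 s) * S.Laminv s := by
        rw [Matrix.mul_assoc, Matrix.mul_assoc _ (S.Lam0 s), S.Lam0_mul_Laminv hs, Matrix.mul_one]
    _ = _ := by rw [h2, Matrix.one_mul]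

end Fundamental

/-! ### The generator of the closed loop, as a relation -/

/-- `v` belongs to the domain of the generator of the closed loop with boundary disturbance `wb` and
output offset `w`, and the generator maps it to `y`; `g` and `f` are the derivative and the
continuous representative of `v.1`. -/
structure IsGenAux (ki : ℝ) (Ki : Matrix (Fin m) (Fin m) ℝ) (wb : Idx p q → ℝ)
    (w : EuclideanSpace ℝ (Fin m)) (v y : State p q m) (g : HypReg.L2 p q)
    (f : ℝ → Idx p q → ℝ) : Prop where
  rep : IsH1Rep v.1 g f
  pde : ∀ᵐ s ∂(volume.restrict (Ioo (0 : ℝ) 1)), WithLp.ofLp (y.1 s)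
    + S.Lam0 s *ᵥ WithLp.ofLp (g s) + S.Lam1 s *ᵥ WithLp.ofLp (v.1 s) = 0
  boundary : traceIn f = S.K *ᵥ traceOut f + S.B *ᵥ control ki Ki v.2 + wb
  integrator : y.2 = WithLp.toLp 2 (S.L1 *ᵥ traceIn f + S.L2 *ᵥ traceOut f) + w

/-- The graph of the generator of the closed loop. -/
def IsGen (ki : ℝ) (Ki : Matrix (Fin m) (Fin m) ℝ) (wb : Idx p q → ℝ)
    (w : EuclideanSpace ℝ (Fin m)) (v y : State p q m) : Prop :=
  ∃ g f, S.IsGenAux ki Ki wb w v y g f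

variable {S} {ki : ℝ} {Ki : Matrix (Fin m) (Fin m) ℝ} {wb wb' : Idx p q → ℝ}
  {w w' : EuclideanSpace ℝ (Fin m)} {v v' y y' : State p q m}

theorem control_sub (z z' : EuclideanSpace ℝ (Fin m)) :
    control ki Ki (z - z') = control ki Ki z - control ki Ki z' := by
  simp [control, Matrix.mulVec_sub, smul_sub]

theorem traceIn_sub (f f' : ℝ → Idx p q → ℝ) :
    traceIn (fun s => f s - f' s) = traceIn f - traceIn f' := by
  ext (i | j) <;> simp [traceIn]

theorem traceOut_sub (f f' : ℝ → Idx p q → ℝ) :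
    traceOut (fun s => f s - f' s) = traceOut f - traceOut f' := by
  ext (i | j) <;> simp [traceOut]

theorem _root_.HypReg.IsH1Rep.sub {φ φ' g g' : HypReg.L2 p q} {f f' : ℝ → Idx p q → ℝ}
    (h : IsH1Rep φ g f) (h' : IsH1Rep φ' g' f') :
    IsH1Rep (φ - φ') (g - g') (fun s => f s - f' s) where
  ae_eq := by
    filter_upwards [h.ae_eq, h'.ae_eq, Lp.coeFn_sub φ φ'] with s h1 h2 h3
    rw [h3, Pi.sub_apply, WithLp.ofLp_sub, h1, h2]
  isPrim i := by
    have := ((h.isPrim i).add ((h'.isPrim i).const_mul (-1)))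
    refine (this.congr fun s _ => ?_).congr_ae ?_
    · simp; ring
    · filter_upwards [Lp.coeFn_sub g g'] with s h3
      rw [h3]; simp; ring

/-- The generator is affine in the state and the disturbances. Differences of two elements with
equal disturbances lie in the homogeneous graph. -/
theorem IsGen.sub (h : S.IsGen ki Ki wb w v y) (h' : S.IsGen ki Ki wb' w' v' y') :
    S.IsGen ki Ki (wb - wb') (w - w') (v - v') (y - y') := by
  obtain ⟨g, f, h⟩ := h
  obtain ⟨g', f', h'⟩ := h'
  refine ⟨g - g', fun s => f s - f' s, h.rep.sub h'.rep, ?_, ?_, ?_⟩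
  · filter_upwards [h.pde, h'.pde, Lp.coeFn_sub g g', Lp.coeFn_sub v.1 v'.1,
      Lp.coeFn_sub y.1 y'.1] with s h1 h2 h3 h4 h5
    rw [Prod.fst_sub, Prod.fst_sub, h3, h4, h5]
    simp only [Pi.sub_apply, WithLp.ofLp_sub, Matrix.mulVec_sub]
    rw [← sub_zero (0 : Idx p q → ℝ)]
    nth_rw 1 [← h1]
    rw [← h2]
    abel
  · rw [traceIn_sub, traceOut_sub, h.boundary, h'.boundary, Prod.snd_sub, control_sub,
      Matrix.mulVec_sub, Matrix.mulVec_sub]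
    abel
  · rw [traceIn_sub, traceOut_sub, Prod.snd_sub, h.integrator, h'.integrator, Matrix.mulVec_sub,
      Matrix.mulVec_sub]
    simp only [WithLp.toLp_add, WithLp.toLp_sub]
    abel

/-- The generator is single valued. -/
theorem IsGen.eq_zero (h : S.IsGen ki Ki 0 0 0 y) : y = 0 := by
  obtain ⟨g, f, h⟩ := h
  have hf : EqOn f 0 (Icc 0 1) := by
    refine eqOn_Icc_of_ae_eq h.rep.continuousOn continuousOn_const ?_
    filter_upwards [h.rep.ae_eq, Lp.coeFn_zero (EuclideanSpace ℝ (Idx p q)) 2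
      (volume.restrict (Ioo (0 : ℝ) 1))] with s h1 h2
    rw [← h1, Prod.fst_zero, h2]
    rfl
  have hg : ∀ᵐ s ∂(volume.restrict (Ioo (0 : ℝ) 1)), ∀ i, g s i = 0 := by
    refine ae_all_iff.2 fun i => ?_
    have hw := h.rep.hasWeakDeriv
    have : ∀ᵐ s, s ∈ Ioo (0 : ℝ) 1 → g s i = 0 := by
      refine isOpen_Ioo.ae_eq_zero_of_integral_contDiff_smul_eq_zero
        (integrable_coord g i).locallyIntegrableOn fun θ hθ hcθ hsθ => ?_
      simp only [smul_eq_mul]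
      rw [← integral_testFunction_mul hsθ]
      have h1 := hw θ hθ hcθ hsθ i
      have h2 : ∫ s in Ioo (0 : ℝ) 1, deriv θ s * (0 : State p q m).1 s i = 0 := by
        refine integral_eq_zero_of_ae ?_
        filter_upwards [Lp.coeFn_zero (EuclideanSpace ℝ (Idx p q)) 2
          (volume.restrict (Ioo (0 : ℝ) 1))] with s h2
        rw [Prod.fst_zero, h2]
        simp
      linarith
    rwa [ae_restrict_iff' measurableSet_Ioo]
  have h0 : f 0 = 0 := hf ⟨le_rfl, zero_le_one⟩
  have h1 : f 1 = 0 := hf ⟨zero_le_one, le_rfl⟩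
  have hpz : plusPart (0 : Idx p q → ℝ) = 0 := map_zero plusL
  have hmz : minusPart (0 : Idx p q → ℝ) = 0 := map_zero minusL
  refine Prod.ext (Lp.ext ?_) ?_
  · filter_upwards [h.pde, hg, Lp.coeFn_zero (EuclideanSpace ℝ (Idx p q)) 2
      (volume.restrict (Ioo (0 : ℝ) 1))] with s h2 h3 h4
    have h5 : WithLp.ofLp (g s) = 0 := funext h3
    rw [h5, Prod.fst_zero, h4] at h2
    rw [Prod.fst_zero, h4]
    simpa [Matrix.mulVec_zero] using h2
  · rw [h.integrator, traceIn_eq, traceOut_eq, h0, h1]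
    simp [hpz, hmz]

/-! ### The inverse of the generator -/

section Inverse

variable {Φ Ψ : ℝ → Matrix (Idx p q) (Idx p q) ℝ}

/-- Constant functions. -/
def constC : (Idx p q → ℝ) →L[ℝ] C01 p q where
  toFun c := ContinuousMap.const _ c
  map_add' _ _ := rfl
  map_smul' _ _ := rfl
  cont := ContinuousMap.continuous_const'

/-- The solution `φ` of `Λ₀ φ' + Λ₁ φ + f = 0` with `φ(0) = c`. -/
def statSol (hΦ : S.IsPhi Φ) (hΨ : S.IsPsi Ψ) :
    (Idx p q → ℝ) × HypReg.L2 p q →L[ℝ] C01 p q :=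
  (mulC hΦ.matContinuousOn).comp
    (constC.coprod (-((mulC (MatContinuousOn.const (S.Laminv 0))).comp (primC.comp
        (mulL2 hΨ.matContinuousOn)))))

theorem statSol_apply (hΦ : S.IsPhi Φ) (hΨ : S.IsPsi Ψ) (c : Idx p q → ℝ) (φ : HypReg.L2 p q)
    (s : Icc (0 : ℝ) 1) :
    statSol hΦ hΨ (c, φ) s
      = Φ s *ᵥ (c - S.Laminv 0 *ᵥ primC (mulL2 hΨ.matContinuousOn φ) s) := by
  have h : statSol hΦ hΨ (c, φ) s = Φ s *ᵥ
      (c + -(S.Laminv 0 *ᵥ primC (mulL2 hΨ.matContinuousOn φ) s)) := rfl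
  rw [h, sub_eq_add_neg]

/-- The derivative of `statSol`. -/
def statDeriv (S : HypSystem p q m) (φ f : HypReg.L2 p q) : HypReg.L2 p q :=
  -mulL2 S.Laminv_matContinuousOn (mulL2 S.Lam1_matContinuousOn φ + f)

theorem statDeriv_ae (φ f : HypReg.L2 p q) :
    ∀ᵐ s ∂(volume.restrict (Ioo (0 : ℝ) 1)), WithLp.ofLp (statDeriv S φ f s)
      = -(S.Laminv s *ᵥ (S.Lam1 s *ᵥ WithLp.ofLp (φ s) + WithLp.ofLp (f s))) := by
  filter_upwards [Lp.coeFn_neg (mulL2 S.Laminv_matContinuousOn (mulL2 S.Lam1_matContinuousOn φ + f)),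
    mulL2_ae S.Laminv_matContinuousOn (mulL2 S.Lam1_matContinuousOn φ + f),
    Lp.coeFn_add (mulL2 S.Lam1_matContinuousOn φ) f, mulL2_ae S.Lam1_matContinuousOn φ]
    with s h1 h2 h3 h4
  rw [statDeriv, h1, Pi.neg_apply, WithLp.ofLp_neg, h2, h3, Pi.add_apply, WithLp.ofLp_add, h4]

theorem statDeriv_pde (φ f : HypReg.L2 p q) :
    ∀ᵐ s ∂(volume.restrict (Ioo (0 : ℝ) 1)), WithLp.ofLp (f s)
      + S.Lam0 s *ᵥ WithLp.ofLp (statDeriv S φ f s) + S.Lam1 s *ᵥ WithLp.ofLp (φ s) = 0 := by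
  filter_upwards [statDeriv_ae (S := S) φ f, ae_restrict_mem measurableSet_Ioo] with s h1 hs
  rw [h1, Matrix.mulVec_neg, Matrix.mulVec_mulVec, S.Lam0_mul_Laminv (Ioo_subset_Icc_self hs),
    Matrix.one_mulVec]
  abel

/-- Variation of constants: differentiating Φ(c - Λ₀(0)⁻¹∫Ψf) gives -Λ₀⁻¹Λ₁φ from Φ' and, by
`phi_mul_psi`, -Λ₀⁻¹f from the integral. -/
theorem statSol_isH1Rep (hΦ : S.IsPhi Φ) (hΨ : S.IsPsi Ψ) (c : Idx p q → ℝ) (f : HypReg.L2 p q) :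
    IsH1Rep (embL2 (statSol hΦ hΨ (c, f))) (statDeriv S (embL2 (statSol hΦ hΨ (c, f))) f)
      (extC (statSol hΦ hΨ (c, f))) where
  ae_eq := embL2_ae _
  isPrim i := by
    set h : HypReg.L2 p q := mulL2 hΨ.matContinuousOn f with hh
    have hw : ∀ k, IsPrim (fun s => c k - (S.Laminv 0 *ᵥ fun j => ∫ τ in (0 : ℝ)..s, h τ j) k)
        (fun s => -(S.Laminv 0 *ᵥ WithLp.ofLp (h s)) k) := fun k => by
      have h1 : IsPrim (fun s => (S.Laminv 0 *ᵥ fun j => ∫ τ in (0 : ℝ)..s, h τ j) k)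
          (fun s => (S.Laminv 0 *ᵥ WithLp.ofLp (h s)) k) := by
        have := MatPrim.mulVec (M := fun _ => S.Laminv 0) (M' := fun _ => 0)
          (fun i j => IsPrim.const _) (f := fun s j => ∫ τ in (0 : ℝ)..s, h τ j)
          (g := fun s => WithLp.ofLp (h s))
          (fun j => by simpa using IsPrim.primitive 0 (intervalIntegrable_coord h j)) k
        simpa using this
      have := (IsPrim.const (c k)).add (h1.const_mul (-1))
      simpa [sub_eq_add_neg] using this
    have hprim := hΦ.matPrim.mulVec (f := fun s k => c k -
        (S.Laminv 0 *ᵥ fun j => ∫ τ in (0 : ℝ)..s, h τ j) k)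
      (g := fun s k => -(S.Laminv 0 *ᵥ WithLp.ofLp (h s)) k) hw i
    have heq : ∀ s ∈ Icc (0 : ℝ) 1, extC (statSol hΦ hΨ (c, f)) s = Φ s *ᵥ (fun k => c k -
        (S.Laminv 0 *ᵥ fun j => ∫ τ in (0 : ℝ)..s, h τ j) k) := fun s hs => by
      rw [extC_apply _ hs, statSol_apply]
      rfl
    refine (hprim.congr fun s hs => by rw [heq s hs]).congr_ae ?_
    filter_upwards [statDeriv_ae (S := S) (embL2 (statSol hΦ hΨ (c, f))) f,
      embL2_ae (statSol hΦ hΨ (c, f)), mulL2_ae hΨ.matContinuousOn f,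
      ae_restrict_mem measurableSet_Ioo] with s h1 h2 h3 hs
    have hs' := Ioo_subset_Icc_self hs
    rw [h1, h2, heq s hs']
    have h4 : (fun k => -(S.Laminv 0 *ᵥ WithLp.ofLp (h s)) k)
        = -((S.Laminv 0 * Ψ s) *ᵥ WithLp.ofLp (f s)) := by
      rw [← Matrix.mulVec_mulVec, ← h3]
      rfl
    rw [h4, Matrix.mulVec_neg, Matrix.mulVec_mulVec, phi_mul_psi hΦ hΨ hs', Matrix.mulVec_add,
      Matrix.neg_mulVec, ← Matrix.mulVec_mulVec, ← Matrix.mulVec_mulVec]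
    simp [neg_add_rev, add_comm]

/-- The contribution of `f` to the boundary value `φ(1)` of `statSol`. -/
def statEnd (hΨ : S.IsPsi Ψ) (Φ : ℝ → Matrix (Idx p q) (Idx p q) ℝ) :
    HypReg.L2 p q →L[ℝ] (Idx p q → ℝ) :=
  ((Matrix.mulVecLin (Φ 1 * S.Laminv 0)).toContinuousLinearMap).comp
    ((ContinuousMap.evalCLM ℝ (⟨1, zero_le_one, le_rfl⟩ : Icc (0 : ℝ) 1)).comp
      (primC.comp (mulL2 hΨ.matContinuousOn)))

theorem statSol_zero (hΦ : S.IsPhi Φ) (hΨ : S.IsPsi Ψ) (c : Idx p q → ℝ) (f : HypReg.L2 p q) :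
    extC (statSol hΦ hΨ (c, f)) 0 = c := by
  rw [extC_apply _ (⟨le_rfl, zero_le_one⟩ : (0 : ℝ) ∈ Icc (0 : ℝ) 1), statSol_apply]
  have : primC (mulL2 hΨ.matContinuousOn f) ⟨0, le_rfl, zero_le_one⟩ = 0 := by
    ext i
    simp [primC_apply]
  simp [hΦ.1, this]

theorem statSol_one (hΦ : S.IsPhi Φ) (hΨ : S.IsPsi Ψ) (c : Idx p q → ℝ) (f : HypReg.L2 p q) :
    extC (statSol hΦ hΨ (c, f)) 1 = Φ 1 *ᵥ c - statEnd hΨ Φ f := by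
  rw [extC_apply _ (⟨zero_le_one, le_rfl⟩ : (1 : ℝ) ∈ Icc (0 : ℝ) 1), statSol_apply,
    Matrix.mulVec_sub, Matrix.mulVec_mulVec]
  rfl

/-- With φ(0) = c and φ(1) = Φ(1)c - e, the two traces are Φ₋c - e₋ and Φ₊c - e₊. The boundary
condition and the integrator equation thus become the two finite systems `h1` and `h2`. -/
theorem isGen_statSol (hΦ : S.IsPhi Φ) (hΨ : S.IsPsi Ψ) (c : Idx p q → ℝ) (f : HypReg.L2 p q)
    (z y : EuclideanSpace ℝ (Fin m))
    (h1 : (PhiMinus (Φ 1) - S.K * PhiPlus (Φ 1)) *ᵥ c - S.B *ᵥ control ki Ki z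
      = minusPart (statEnd hΨ Φ f) - S.K *ᵥ plusPart (statEnd hΨ Φ f) + wb)
    (h2 : (S.L1 * PhiMinus (Φ 1) + S.L2 * PhiPlus (Φ 1)) *ᵥ c = WithLp.ofLp (y - w)
      + S.L1 *ᵥ minusPart (statEnd hΨ Φ f) + S.L2 *ᵥ plusPart (statEnd hΨ Φ f)) :
    S.IsGen ki Ki wb w (embL2 (statSol hΦ hΨ (c, f)), z) (f, y) := by
  set e := statEnd hΨ Φ f with he
  have hin : traceIn (extC (statSol hΦ hΨ (c, f))) = PhiMinus (Φ 1) *ᵥ c - minusPart e := by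
    rw [traceIn_eq, statSol_zero, statSol_one, ← he, minusPart_sub, PhiMinus,
      fromBlocks_bottom_mulVec]
    abel
  have hout : traceOut (extC (statSol hΦ hΨ (c, f))) = PhiPlus (Φ 1) *ᵥ c - plusPart e := by
    rw [traceOut_eq, statSol_zero, statSol_one, ← he, plusPart_sub, PhiPlus,
      fromBlocks_top_mulVec]
    abel
  refine ⟨_, _, statSol_isH1Rep hΦ hΨ c f, statDeriv_pde _ f, ?_, ?_⟩
  · rw [hin, hout, Matrix.mulVec_sub, Matrix.mulVec_mulVec]
    rw [Matrix.sub_mulVec] at h1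
    have h3 : PhiMinus (Φ 1) *ᵥ c = (S.K * PhiPlus (Φ 1)) *ᵥ c + S.B *ᵥ control ki Ki z
        + (minusPart e - S.K *ᵥ plusPart e + wb) := by
      rw [← h1]; abel
    rw [h3]
    abel
  · rw [hin, hout, Matrix.mulVec_sub, Matrix.mulVec_sub, Matrix.mulVec_mulVec,
      Matrix.mulVec_mulVec]
    rw [Matrix.add_mulVec] at h2
    have h3 : (S.L1 * PhiMinus (Φ 1)) *ᵥ c - S.L1 *ᵥ minusPart e
        + ((S.L2 * PhiPlus (Φ 1)) *ᵥ c - S.L2 *ᵥ plusPart e) = WithLp.ofLp (y - w) := by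
      rw [← add_sub_add_comm, h2]
      abel
    rw [h3]
    simp

/-- Eliminating c from the first equation leaves T₁u = d - GN⁻¹b for the control u, from which z is
recovered because kᵢKᵢ is invertible. A right inverse is enough here: uniqueness will come from
dissipativity. -/
theorem exists_solve_boundary (hrank1 : S.RankCondition1 Φ) (hki : ki ≠ 0) (hKi : IsUnit Ki) :
    ∃ L : ((Idx p q → ℝ) × (Fin m → ℝ)) →ₗ[ℝ] ((Idx p q → ℝ) × EuclideanSpace ℝ (Fin m)),
      ∀ b d, (PhiMinus (Φ 1) - S.K * PhiPlus (Φ 1)) *ᵥ (L (b, d)).1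
          - S.B *ᵥ control ki Ki (L (b, d)).2 = b ∧
        (S.L1 * PhiMinus (Φ 1) + S.L2 * PhiPlus (Φ 1)) *ᵥ (L (b, d)).1 = d := by
  set N := PhiMinus (Φ 1) - S.K * PhiPlus (Φ 1) with hN
  set G := S.L1 * PhiMinus (Φ 1) + S.L2 * PhiPlus (Φ 1) with hG
  let A : ((Idx p q → ℝ) × EuclideanSpace ℝ (Fin m)) →ₗ[ℝ] ((Idx p q → ℝ) × (Fin m → ℝ)) :=
    { toFun := fun x => (N *ᵥ x.1 - S.B *ᵥ control ki Ki x.2, G *ᵥ x.1)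
      map_add' := fun x x' => by
        simp only [Prod.fst_add, Prod.snd_add, control, WithLp.ofLp_add, Matrix.mulVec_add,
          smul_add, Prod.mk_add_mk]
        congr 1
        abel
      map_smul' := fun c x => by
        simp only [Prod.smul_fst, Prod.smul_snd, control, WithLp.ofLp_smul, Matrix.mulVec_smul,
          smul_comm ki c, RingHom.id_apply, Prod.smul_mk, smul_sub] }
  have hsurj : Function.Surjective A := by
    rintro ⟨b, d⟩
    have hNu : N * N⁻¹ = 1 := Matrix.mul_nonsing_inv _ ((Matrix.isUnit_iff_isUnit_det _).1 hrank1.1)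
    have hTu : S.T1 Φ * (S.T1 Φ)⁻¹ = 1 :=
      Matrix.mul_nonsing_inv _ ((Matrix.isUnit_iff_isUnit_det _).1 hrank1.2)
    have hKu : Ki * Ki⁻¹ = 1 := Matrix.mul_nonsing_inv _ ((Matrix.isUnit_iff_isUnit_det _).1 hKi)
    set u := (S.T1 Φ)⁻¹ *ᵥ (d - G *ᵥ (N⁻¹ *ᵥ b)) with hu
    refine ⟨(N⁻¹ *ᵥ (b + S.B *ᵥ u), WithLp.toLp 2 (ki⁻¹ • (Ki⁻¹ *ᵥ u))), ?_⟩
    have hc : control ki Ki (WithLp.toLp 2 (ki⁻¹ • (Ki⁻¹ *ᵥ u))) = u := by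
      simp [control, Matrix.mulVec_smul, smul_smul, mul_inv_cancel₀ hki, Matrix.mulVec_mulVec, hKu]
    refine Prod.ext ?_ ?_
    · change N *ᵥ (N⁻¹ *ᵥ (b + S.B *ᵥ u)) - S.B *ᵥ control ki Ki _ = b
      rw [hc, Matrix.mulVec_mulVec, hNu, Matrix.one_mulVec, add_sub_cancel_right]
    · change G *ᵥ (N⁻¹ *ᵥ (b + S.B *ᵥ u)) = d
      have hT : G *ᵥ (N⁻¹ *ᵥ (S.B *ᵥ u)) = S.T1 Φ *ᵥ u := by
        rw [Matrix.mulVec_mulVec, Matrix.mulVec_mulVec, T1, Matrix.mul_assoc]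
      rw [Matrix.mulVec_add, Matrix.mulVec_add, hT, hu,
        Matrix.mulVec_mulVec _ (S.T1 Φ), hTu, Matrix.one_mulVec]
      abel
  obtain ⟨L, hL⟩ := A.exists_rightInverse_of_surjective (LinearMap.range_eq_top.2 hsurj)
  refine ⟨L, fun b d => ?_⟩
  have := LinearMap.congr_fun hL (b, d)
  exact ⟨congrArg Prod.fst this, congrArg Prod.snd this⟩

/-- The generator of the closed loop without disturbances has a bounded right inverse. -/
theorem exists_inverse_generator (hΦ : S.IsPhi Φ) (hΨ : S.IsPsi Ψ) (hrank1 : S.RankCondition1 Φ)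
    (hki : ki ≠ 0) (hKi : IsUnit Ki) :
    ∃ R : State p q m →L[ℝ] State p q m, ∀ y, S.IsGen ki Ki 0 0 (R y) y := by
  obtain ⟨L, hL⟩ := exists_solve_boundary hrank1 hki hKi
  let e := (statEnd hΨ Φ).comp (ContinuousLinearMap.fst ℝ (HypReg.L2 p q) (EuclideanSpace ℝ (Fin m)))
  let b := (minusL - S.K.mulVecLin ∘ₗ plusL).toContinuousLinearMap.comp e
  let d := (PiLp.continuousLinearEquiv 2 ℝ (fun _ : Fin m => ℝ)).toContinuousLinearMap.comp
      (ContinuousLinearMap.snd ℝ (HypReg.L2 p q) (EuclideanSpace ℝ (Fin m)))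
    + (S.L1.mulVecLin ∘ₗ minusL + S.L2.mulVecLin ∘ₗ plusL).toContinuousLinearMap.comp e
  let cz := L.toContinuousLinearMap.comp (b.prod d)
  let fs := ContinuousLinearMap.fst ℝ (Idx p q → ℝ) (EuclideanSpace ℝ (Fin m))
  let sn := ContinuousLinearMap.snd ℝ (Idx p q → ℝ) (EuclideanSpace ℝ (Fin m))
  refine ⟨(embL2.comp ((statSol hΦ hΨ).comp ((fs.comp cz).prod
    (ContinuousLinearMap.fst ℝ _ _)))).prod (sn.comp cz), fun y => ?_⟩
  obtain ⟨h1, h2⟩ := hL (b y) (d y)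
  refine isGen_statSol hΦ hΨ (L (b y, d y)).1 y.1 (L (b y, d y)).2 y.2 ?_ ?_
  · rw [h1, add_zero]
    rfl
  · rw [h2, sub_zero, add_assoc]
    rfl

theorem exists_isGen_zero (hΦ : S.IsPhi Φ) (hΨ : S.IsPsi Ψ) (hrank1 : S.RankCondition1 Φ)
    (hki : ki ≠ 0) (hKi : IsUnit Ki) (wb : Idx p q → ℝ) (w : EuclideanSpace ℝ (Fin m)) :
    ∃ v, S.IsGen ki Ki wb w v 0 := by
  obtain ⟨L, hL⟩ := exists_solve_boundary hrank1 hki hKi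
  obtain ⟨h1, h2⟩ := hL wb (WithLp.ofLp (-w))
  have hpz : plusPart (0 : Idx p q → ℝ) = 0 := map_zero plusL
  have hmz : minusPart (0 : Idx p q → ℝ) = 0 := map_zero minusL
  refine ⟨_, isGen_statSol hΦ hΨ _ 0 (L (wb, WithLp.ofLp (-w))).2 0 (h1.trans ?_) (h2.trans ?_)⟩
  · simp [hpz, hmz]
  · simp [hpz, hmz]

end Inverse

end HypSystem

/-! ### Quadratic forms -/

theorem exists_bound_of_homogeneous {ι : Type*} [Fintype ι] {F : (ι → ℝ) → ℝ} (hF : Continuous F)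
    (hhom : ∀ (c : ℝ) (b : ι → ℝ), F (c • b) = c ^ 2 * F b) :
    ∃ C, 0 ≤ C ∧ ∀ b, F b ≤ C * ‖b‖ ^ 2 := by
  obtain ⟨C, hC⟩ := (isCompact_sphere (0 : ι → ℝ) 1).exists_bound_of_continuousOn hF.continuousOn
  refine ⟨max C 0, le_max_right _ _, fun b => ?_⟩
  rcases eq_or_ne b 0 with rfl | hb
  · have := hhom 0 0
    simp at this
    simp [this]
  · have hb' : ‖b‖ ≠ 0 := norm_ne_zero_iff.2 hb
    have h1 : F b = ‖b‖ ^ 2 * F (‖b‖⁻¹ • b) := by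
      rw [← hhom, smul_smul, mul_inv_cancel₀ hb', one_smul]
    have h2 := hC (‖b‖⁻¹ • b) (by simp [norm_smul, hb'])
    rw [h1, mul_comm]
    gcongr
    exact ((le_abs_self _).trans h2).trans (le_max_left _ _)

/-- Completing the square: the form of Q is nonnegative at x - Q⁻¹n. -/
theorem two_mul_dotProduct_sub_le {ι : Type*} [Fintype ι] [DecidableEq ι] {Q : Matrix ι ι ℝ}
    (hQ : Q.PosDef) (x n : ι → ℝ) :
    2 * (x ⬝ᵥ n) - x ⬝ᵥ (Q *ᵥ x) ≤ n ⬝ᵥ (Q⁻¹ *ᵥ n) := by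
  have hdet : IsUnit Q.det := (Matrix.isUnit_iff_isUnit_det _).1 hQ.isUnit
  have h := hQ.posSemidef.dotProduct_mulVec_nonneg (x - Q⁻¹ *ᵥ n)
  have hsym : Qᵀ = Q := by
    rw [← Matrix.conjTranspose_eq_transpose_of_trivial]; exact hQ.isHermitian
  have h1 : (Q⁻¹ *ᵥ n) ⬝ᵥ (Q *ᵥ x) = x ⬝ᵥ n := by
    rw [Matrix.dotProduct_mulVec, ← Matrix.mulVec_transpose, hsym, Matrix.mulVec_mulVec,
      Matrix.mul_nonsing_inv _ hdet, Matrix.one_mulVec, dotProduct_comm]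
  rw [Matrix.mulVec_sub, Matrix.mulVec_mulVec, Matrix.mul_nonsing_inv _ hdet, Matrix.one_mulVec,
    star_trivial, sub_dotProduct, dotProduct_sub, dotProduct_sub, h1,
    dotProduct_comm (Q⁻¹ *ᵥ n) n] at h
  linarith

/-! ### The inner product of `L²` -/

theorem inner_L2_eq (φ ψ : L2 p q) : inner ℝ φ ψ
    = ∫ s in Ioo (0 : ℝ) 1, WithLp.ofLp (φ s) ⬝ᵥ WithLp.ofLp (ψ s) := by
  rw [MeasureTheory.L2.inner_def]
  refine integral_congr_ae (Eventually.of_forall fun s => ?_)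
  simp only [EuclideanSpace.inner_eq_star_dotProduct, star_trivial]
  exact dotProduct_comm _ _

theorem integrable_dotProduct (φ ψ : L2 p q) : IntegrableOn
    (fun s => WithLp.ofLp (φ s) ⬝ᵥ WithLp.ofLp (ψ s)) (Ioo (0 : ℝ) 1) := by
  refine (MeasureTheory.L2.integrable_inner (𝕜 := ℝ) φ ψ).congr
    (Eventually.of_forall fun s => ?_)
  simp only [EuclideanSpace.inner_eq_star_dotProduct, star_trivial]
  exact dotProduct_comm _ _

namespace HypSystem

variable {S : HypSystem p q m} {ki : ℝ} {Ki : Matrix (Fin m) (Fin m) ℝ} {wb : Idx p q → ℝ}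
  {w : EuclideanSpace ℝ (Fin m)} {v y : State p q m} {g : HypReg.L2 p q} {f : ℝ → Idx p q → ℝ}
  {Φ Ψ : ℝ → Matrix (Idx p q) (Idx p q) ℝ}

theorem IsGenAux.at_zero (h : S.IsGenAux ki Ki wb w v y g f) :
    f 0 = S.Kminus *ᵥ traceOut f + plusPart (S.B *ᵥ control ki Ki v.2 + wb) := by
  have hb := congrArg plusPart h.boundary
  have h1 : plusPart (traceIn f) = plusPart (f 0) := by
    rw [traceIn_eq]; ext (i | j) <;> simp
  have h2 : minusPart (traceOut f) = minusPart (f 0) := by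
    rw [traceOut_eq]; ext (i | j) <;> simp
  rw [add_assoc, plusPart_add, h1] at hb
  rw [Kminus_mulVec, h2, ← plusPart_add_minusPart (f 0), hb]
  ext (i | j) <;> simp

theorem IsGenAux.at_one (h : S.IsGenAux ki Ki wb w v y g f) :
    f 1 = S.Kplus *ᵥ traceOut f + minusPart (S.B *ᵥ control ki Ki v.2 + wb) := by
  have hb := congrArg minusPart h.boundary
  have h1 : minusPart (traceIn f) = minusPart (f 1) := by
    rw [traceIn_eq]; ext (i | j) <;> simp
  have h2 : plusPart (traceOut f) = plusPart (f 1) := by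
    rw [traceOut_eq]; ext (i | j) <;> simp
  rw [add_assoc, minusPart_add, h1] at hb
  rw [Kplus_mulVec, h2, ← plusPart_add_minusPart (f 1), hb]
  ext (i | j) <;> simp

/-! ### The forwarding functional -/

/-- `φ ↦ ∫ M Ψ φ`. -/
def forwardMap (hΨ : S.IsPsi Ψ) : HypReg.L2 p q →L[ℝ] EuclideanSpace ℝ (Fin m) :=
  (PiLp.continuousLinearEquiv 2 ℝ (fun _ : Fin m => ℝ)).symm.toContinuousLinearMap.comp
    (((S.Mmat Ψ).mulVecLin.toContinuousLinearMap).comp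
    ((ContinuousMap.evalCLM ℝ (⟨1, zero_le_one, le_rfl⟩ : Icc (0 : ℝ) 1)).comp
      (primC.comp (mulL2 hΨ.matContinuousOn))))

theorem forwardMap_apply (hΨ : S.IsPsi Ψ) (φ : HypReg.L2 p q) : forwardMap hΨ φ = WithLp.toLp 2
    (S.Mmat Ψ *ᵥ primC (mulL2 hΨ.matContinuousOn φ) ⟨1, zero_le_one, le_rfl⟩) := rfl

/-- Since (ΨΛ₀)' = ΨΛ₁, the integrand Ψy equals -(ΨΛ₀f)', so only end values survive. -/
theorem IsGenAux.integral_psi (h : S.IsGenAux ki Ki wb w v y g f) (hΨ : S.IsPsi Ψ) :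
    primC (mulL2 hΨ.matContinuousOn y.1) ⟨1, zero_le_one, le_rfl⟩
      = S.Lam0 0 *ᵥ f 0 - (Ψ 1 * S.Lam0 1) *ᵥ f 1 := by
  ext i
  have hp := (hΨ.matPrim_mul_Lam0.mulVec h.rep.isPrim i).integral_eq
  rw [primC_apply, ← integral_Ioo_eq]
  rw [hΨ.1, Matrix.one_mul] at hp
  rw [Pi.sub_apply, ← neg_sub, ← hp, ← integral_neg]
  refine integral_congr_ae ?_
  filter_upwards [mulL2_ae hΨ.matContinuousOn y.1, h.pde, h.rep.ae_eq] with s h1 h2 h3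
  have h4 : WithLp.ofLp (y.1 s) = -(S.Lam0 s *ᵥ WithLp.ofLp (g s) + S.Lam1 s *ᵥ f s) := by
    rw [← h3, eq_neg_iff_add_eq_zero, ← add_assoc, h2]
  rw [h1, h4, Matrix.mulVec_neg, Matrix.mulVec_add, Matrix.mulVec_mulVec, Matrix.mulVec_mulVec]
  simp [add_comm]

theorem Bplus_mulVec (S : HypSystem p q m) (u : Fin m → ℝ) :
    S.Bplus *ᵥ u = plusPart (S.B *ᵥ u) := by
  ext (i | j)
  · simp [Bplus, Matrix.mulVec, dotProduct, Matrix.toRows₁]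
  · simp [Bplus, Matrix.mulVec, dotProduct]

theorem Bminus_mulVec (S : HypSystem p q m) (u : Fin m → ℝ) :
    S.Bminus *ᵥ u = minusPart (S.B *ᵥ u) := by
  ext (i | j)
  · simp [Bminus, Matrix.mulVec, dotProduct]
  · simp [Bminus, Matrix.mulVec, dotProduct, Matrix.toRows₂]

/-- Along the closed loop, the time derivative of `z - ∫ M Ψ φ` is `-kᵢ z`. -/
theorem IsGenAux.forward (hΨ : S.IsPsi Ψ) (hrank2 : S.RankCondition2 Ψ)
    (h : S.IsGenAux ki (S.T2 Ψ)⁻¹ 0 0 v y g f) :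
    y.2 - forwardMap hΨ y.1 = -(ki • v.2) := by
  set u := control ki (S.T2 Ψ)⁻¹ v.2 with hu
  set x := traceOut f with hx
  set N := S.Lam0 0 * S.Kminus - Ψ 1 * S.Lam0 1 * S.Kplus with hN
  have hNu : N⁻¹ * N = 1 := by
    refine Matrix.nonsing_inv_mul _ ((Matrix.isUnit_iff_isUnit_det _).1 ?_)
    rw [hN, ← neg_sub]
    exact hrank2.1.neg
  -- The defining property of M: the free trace x enters M∫Ψy and the output with the same
  -- coefficient, so it drops out of the difference.
  have hM : S.Mmat Ψ * N = S.L1 * S.K + S.L2 := by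
    rw [Mmat, ← hN, Matrix.mul_assoc, hNu, Matrix.mul_one]
  have h1 : S.Lam0 0 *ᵥ f 0 - (Ψ 1 * S.Lam0 1) *ᵥ f 1
      = N *ᵥ x + (S.Lam0 0 * S.Bplus - Ψ 1 * S.Lam0 1 * S.Bminus) *ᵥ u := by
    rw [h.at_zero, h.at_one, add_zero, hN, Matrix.sub_mulVec, Matrix.sub_mulVec, Matrix.mulVec_add,
      Matrix.mulVec_add, ← Bplus_mulVec, ← Bminus_mulVec, Matrix.mulVec_mulVec,
      Matrix.mulVec_mulVec, Matrix.mulVec_mulVec, Matrix.mulVec_mulVec]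
    abel
  have h2 : S.T2 Ψ *ᵥ u = ki • WithLp.ofLp v.2 := by
    rw [hu, control, Matrix.mulVec_smul, Matrix.mulVec_mulVec, Matrix.mul_nonsing_inv _
      ((Matrix.isUnit_iff_isUnit_det _).1 hrank2.2), Matrix.one_mulVec]
  have h3 : S.Mmat Ψ *ᵥ (S.Lam0 0 *ᵥ f 0 - (Ψ 1 * S.Lam0 1) *ᵥ f 1)
      = (S.L1 * S.K + S.L2) *ᵥ x + (S.T2 Ψ *ᵥ u + (S.L1 * S.B) *ᵥ u) := by
    rw [h1, Matrix.mulVec_add, Matrix.mulVec_mulVec, hM, Matrix.mulVec_mulVec, ← Matrix.add_mulVec,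
      T2, neg_add_eq_sub, sub_add_cancel]
  rw [forwardMap_apply, h.integral_psi hΨ, h3, h2, h.integrator, h.boundary]
  simp only [add_zero, ← hx, ← hu, Matrix.mulVec_add, Matrix.mulVec_mulVec, Matrix.add_mulVec]
  ext i
  simp
  ring

/-! ### The energy estimate -/

/-- The weighted energy flux. -/
def flux (S : HypSystem p q m) (P : ℝ → Idx p q → ℝ) (s : ℝ) (x : Idx p q → ℝ) : ℝ :=
  x ⬝ᵥ (Matrix.diagonal (P s) *ᵥ (S.Lam0 s *ᵥ x))

theorem flux_eq_sum (P : ℝ → Idx p q → ℝ) (s : ℝ) (x : Idx p q → ℝ) :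
    S.flux P s x = ∑ i, P s i * S.lam s i * (x i * x i) := by
  simp only [flux, Lam0, Matrix.mulVec_diagonal, dotProduct]
  exact Finset.sum_congr rfl fun i _ => by ring

theorem IsGenAux.energy (h : S.IsGenAux ki Ki wb w v y g f) {P : ℝ → Idx p q → ℝ} {μ : ℝ}
    (hP : ∀ i, ContDiffOn ℝ 1 (fun s => P s i) (Icc 0 1))
    (hμ : ∀ s ∈ Icc (0 : ℝ) 1, (-(μ • Matrix.diagonal (P s)) -
        (Matrix.diagonal (fun i => derivWithin (fun σ => P σ i * S.lam σ i) (Icc 0 1) s)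
          - Matrix.diagonal (P s) * S.Lam1 s
          - (S.Lam1 s)ᵀ * Matrix.diagonal (P s))).PosSemidef)
    (hPc : MatContinuousOn fun s => Matrix.diagonal (P s)) :
    2 * inner ℝ (mulL2 hPc y.1) v.1
      ≤ S.flux P 0 (f 0) - S.flux P 1 (f 1) - μ * inner ℝ (mulL2 hPc v.1) v.1 := by
  set d : ℝ → Idx p q → ℝ := fun s i => derivWithin (fun σ => P σ i * S.lam σ i) (Icc 0 1) s
    with hd
  have hprim := IsPrim.sum Finset.univ (F := fun i s => P s i * S.lam s i * (f s i * f s i))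
    (G := fun i s => d s i * (f s i * f s i) + P s i * S.lam s i * (g s i * f s i + f s i * g s i))
    fun i _ => (IsPrim.of_contDiffOn ((hP i).mul (S.lam_contDiffOn i))).mul
      ((h.rep.isPrim i).mul (h.rep.isPrim i))
  -- The a.e. derivative in s of the flux fᵀPΛ₀f, whose integral is the difference of the boundary
  -- fluxes. The matrix inequality for P then compares -e' with the energy density pointwise.
  set e' : ℝ → ℝ := fun s => ∑ i, (d s i * (f s i * f s i)
    + P s i * S.lam s i * (g s i * f s i + f s i * g s i)) with he'
  have hint : ∫ s in Ioo (0 : ℝ) 1, e' s = S.flux P 1 (f 1) - S.flux P 0 (f 0) := by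
    rw [flux_eq_sum, flux_eq_sum]
    exact hprim.integral_eq
  have hintegrable : IntegrableOn e' (Ioo 0 1) :=
    (intervalIntegrable_iff_integrableOn_Ioo_of_le zero_le_one).1 hprim.1
  have key : ∫ s in Ioo (0 : ℝ) 1, 2 * (WithLp.ofLp (mulL2 hPc y.1 s) ⬝ᵥ WithLp.ofLp (v.1 s))
      ≤ ∫ s in Ioo (0 : ℝ) 1,
        (-e' s - μ * (WithLp.ofLp (mulL2 hPc v.1 s) ⬝ᵥ WithLp.ofLp (v.1 s))) := by
    refine integral_mono_ae ((integrable_dotProduct _ _).const_mul 2)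
      (hintegrable.neg.sub ((integrable_dotProduct _ _).const_mul μ)) ?_
    filter_upwards [h.rep.ae_eq, h.pde, mulL2_ae hPc y.1, mulL2_ae hPc v.1,
      ae_restrict_mem measurableSet_Ioo] with s h1 h2 h3 h4 hs
    have hpsd := (hμ s (Ioo_subset_Icc_self hs)).dotProduct_mulVec_nonneg (f s)
    have hy : WithLp.ofLp (y.1 s) = -(S.Lam0 s *ᵥ WithLp.ofLp (g s) + S.Lam1 s *ᵥ f s) := by
      rw [← h1, eq_neg_iff_add_eq_zero, ← add_assoc, h2]
    rw [h3, h4, h1, hy]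
    set a := f s ⬝ᵥ (Matrix.diagonal (P s) *ᵥ (S.Lam1 s *ᵥ f s)) with ha
    have ht : f s ⬝ᵥ ((S.Lam1 s)ᵀ *ᵥ (Matrix.diagonal (P s) *ᵥ f s)) = a := by
      rw [Matrix.dotProduct_mulVec, Matrix.vecMul_transpose, ha]
      simp only [Matrix.mulVec_diagonal, dotProduct]
      exact Finset.sum_congr rfl fun i _ => by ring
    have hA : (Matrix.diagonal (P s) *ᵥ -(S.Lam0 s *ᵥ WithLp.ofLp (g s) + S.Lam1 s *ᵥ f s)) ⬝ᵥ f s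
        = -(∑ i, P s i * S.lam s i * (g s i * f s i)) - a := by
      rw [Matrix.mulVec_neg, Matrix.mulVec_add, neg_dotProduct, add_dotProduct, ha,
        dotProduct_comm (Matrix.diagonal (P s) *ᵥ (S.Lam1 s *ᵥ f s)), neg_add, sub_eq_add_neg]
      congr 2
      simp only [Lam0, Matrix.mulVec_diagonal, dotProduct]
      exact Finset.sum_congr rfl fun i _ => by ring
    have hB : e' s = (∑ i, d s i * (f s i * f s i))
        + 2 * ∑ i, P s i * S.lam s i * (g s i * f s i) := by
      rw [he', Finset.mul_sum, ← Finset.sum_add_distrib]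
      exact Finset.sum_congr rfl fun i _ => by ring
    have hC : f s ⬝ᵥ (Matrix.diagonal (d s) *ᵥ f s) = ∑ i, d s i * (f s i * f s i) := by
      simp only [Matrix.mulVec_diagonal, dotProduct]
      exact Finset.sum_congr rfl fun i _ => by ring
    have hD : (Matrix.diagonal (P s) *ᵥ f s) ⬝ᵥ f s = f s ⬝ᵥ (Matrix.diagonal (P s) *ᵥ f s) :=
      dotProduct_comm _ _
    have hE : f s ⬝ᵥ ((-(μ • Matrix.diagonal (P s)) - (Matrix.diagonal (d s)
        - Matrix.diagonal (P s) * S.Lam1 s - (S.Lam1 s)ᵀ * Matrix.diagonal (P s))) *ᵥ f s)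
        = -(μ * (f s ⬝ᵥ (Matrix.diagonal (P s) *ᵥ f s))) - (∑ i, d s i * (f s i * f s i))
          + a + a := by
      simp only [Matrix.sub_mulVec, Matrix.neg_mulVec, Matrix.smul_mulVec, dotProduct_sub,
        dotProduct_neg, dotProduct_smul, ← Matrix.mulVec_mulVec, hC, ht, ← ha, smul_eq_mul]
      ring
    rw [star_trivial] at hpsd
    have hpsd' := hpsd.trans_eq hE
    simp only [hA, hB, hD]
    linarith
  rw [inner_L2_eq, inner_L2_eq, ← integral_const_mul]
  refine key.trans_eq ?_
  rw [integral_sub (f := fun s => -e' s) hintegrable.neg ((integrable_dotProduct _ _).const_mul μ), integral_neg, hint,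
    integral_const_mul]
  ring

/-- The part quadratic in x is at most -xᵀQx and the cross term is 2x·n(b). Completing the square
removes the unknown trace x and leaves a quadratic form in b alone. -/
theorem exists_flux_bound {P : ℝ → Idx p q → ℝ} {Q : Matrix (Idx p q) (Idx p q) ℝ} (hQ : Q.PosDef)
    (hb : (-Q - (-(S.Kplusᵀ * Matrix.diagonal (P 1) * S.Lam0 1 * S.Kplus)
      + S.Kminusᵀ * Matrix.diagonal (P 0) * S.Lam0 0 * S.Kminus)).PosSemidef) :
    ∃ C, 0 ≤ C ∧ ∀ x b : Idx p q → ℝ,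
      S.flux P 0 (S.Kminus *ᵥ x + plusPart b) - S.flux P 1 (S.Kplus *ᵥ x + minusPart b)
        ≤ C * ‖b‖ ^ 2 := by
  set D : ℝ → Matrix (Idx p q) (Idx p q) ℝ := fun s => Matrix.diagonal (P s) * S.Lam0 s with hD
  have hDsym : ∀ s (x y : Idx p q → ℝ), y ⬝ᵥ (D s *ᵥ x) = x ⬝ᵥ (D s *ᵥ y) := fun s x y => by
    simp only [hD, Lam0, Matrix.diagonal_mul_diagonal, Matrix.mulVec_diagonal, dotProduct]
    exact Finset.sum_congr rfl fun i _ => by ring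
  have hflux : ∀ s x, S.flux P s x = x ⬝ᵥ (D s *ᵥ x) := fun s x => by
    rw [flux, hD, Matrix.mulVec_mulVec]
  set n : (Idx p q → ℝ) → Idx p q → ℝ := fun b =>
    S.Kminusᵀ *ᵥ (D 0 *ᵥ plusPart b) - S.Kplusᵀ *ᵥ (D 1 *ᵥ minusPart b) with hn
  set F : (Idx p q → ℝ) → ℝ := fun b => n b ⬝ᵥ (Q⁻¹ *ᵥ n b) +
    plusPart b ⬝ᵥ (D 0 *ᵥ plusPart b) - minusPart b ⬝ᵥ (D 1 *ᵥ minusPart b) with hF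
  have hpc : Continuous (plusPart : (Idx p q → ℝ) → _) := plusL.continuous_of_finiteDimensional
  have hmc : Continuous (minusPart : (Idx p q → ℝ) → _) := minusL.continuous_of_finiteDimensional
  have hnc : Continuous n := by fun_prop
  obtain ⟨C, hC0, hC⟩ := exists_bound_of_homogeneous (F := F) (by fun_prop) (fun c b => by
    have hnh : n (c • b) = c • n b := by
      simp only [hn, plusPart_smul, minusPart_smul, Matrix.mulVec_smul, smul_sub]
    simp only [hF, hnh, plusPart_smul, minusPart_smul, Matrix.mulVec_smul, smul_dotProduct,
      dotProduct_smul, smul_eq_mul]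
    ring)
  refine ⟨C, hC0, fun x b => le_trans ?_ (hC b)⟩
  have hpsd := hb.dotProduct_mulVec_nonneg x
  have hQx := two_mul_dotProduct_sub_le hQ x (n b)
  have hT : ∀ (K : Matrix (Idx p q) (Idx p q) ℝ) (z : Idx p q → ℝ),
      (K *ᵥ x) ⬝ᵥ z = x ⬝ᵥ (Kᵀ *ᵥ z) := fun K z => by
    rw [Matrix.dotProduct_mulVec, Matrix.vecMul_transpose]
  have hxn : x ⬝ᵥ n b = (S.Kminus *ᵥ x) ⬝ᵥ (D 0 *ᵥ plusPart b)
      - (S.Kplus *ᵥ x) ⬝ᵥ (D 1 *ᵥ minusPart b) := by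
    rw [hT, hT, hn, dotProduct_sub]
  have hpx : star x ⬝ᵥ ((-Q - (-(S.Kplusᵀ * Matrix.diagonal (P 1) * S.Lam0 1 * S.Kplus)
      + S.Kminusᵀ * Matrix.diagonal (P 0) * S.Lam0 0 * S.Kminus)) *ᵥ x)
      = -(x ⬝ᵥ (Q *ᵥ x)) + (S.Kplus *ᵥ x) ⬝ᵥ (D 1 *ᵥ (S.Kplus *ᵥ x))
        - (S.Kminus *ᵥ x) ⬝ᵥ (D 0 *ᵥ (S.Kminus *ᵥ x)) := by
    rw [hT, hT, star_trivial]
    simp only [hD, Matrix.sub_mulVec, Matrix.neg_mulVec, Matrix.add_mulVec, dotProduct_sub,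
      dotProduct_neg, dotProduct_add, ← Matrix.mulVec_mulVec]
    ring
  rw [hpx] at hpsd
  simp only [hflux, Matrix.mulVec_add, dotProduct_add, add_dotProduct,
    hDsym _ (S.Kminus *ᵥ x) (plusPart b), hDsym _ (S.Kplus *ᵥ x) (minusPart b), hF]
  linarith

end HypSystem

/-- `L² × ℝᵐ` with the Hilbert space norm. -/
abbrev HState (p q m : ℕ) : Type := WithLp 2 (L2 p q × EuclideanSpace ℝ (Fin m))

/-! ### The Lyapunov functional -/

section Weight

variable {P : ℝ → Idx p q → ℝ}

theorem mulL2_comp_eq_self {M N : ℝ → Matrix (Idx p q) (Idx p q) ℝ} (hM : MatContinuousOn M)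
    (hN : MatContinuousOn N) (h : ∀ s ∈ Icc (0 : ℝ) 1, M s * N s = 1) (φ : L2 p q) :
    mulL2 hM (mulL2 hN φ) = φ := by
  refine Lp.ext ?_
  filter_upwards [mulL2_ae hM (mulL2 hN φ), mulL2_ae hN φ, ae_restrict_mem measurableSet_Ioo]
    with s h1 h2 hs
  rw [h2, Matrix.mulVec_mulVec, h s (Ioo_subset_Icc_self hs), Matrix.one_mulVec] at h1
  exact WithLp.ofLp_injective 2 h1

theorem sqrt_matContinuousOn (hP : ∀ i, ContinuousOn (fun s => P s i) (Icc 0 1)) :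
    MatContinuousOn fun s => Matrix.diagonal fun i => √(P s i) :=
  MatContinuousOn.diagonal fun i => (hP i).sqrt

theorem inv_sqrt_matContinuousOn (hP : ∀ i, ContinuousOn (fun s => P s i) (Icc 0 1))
    (hpos : ∀ s ∈ Icc (0 : ℝ) 1, ∀ i, 0 < P s i) :
    MatContinuousOn fun s => Matrix.diagonal fun i => (√(P s i))⁻¹ :=
  MatContinuousOn.diagonal fun i =>
    (hP i).sqrt.inv₀ fun s hs => (Real.sqrt_pos.2 (hpos s hs i)).ne'

/-- Multiplication by `√P`. -/
def sqrtWeight (hP : ∀ i, ContinuousOn (fun s => P s i) (Icc 0 1))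
    (hpos : ∀ s ∈ Icc (0 : ℝ) 1, ∀ i, 0 < P s i) : L2 p q ≃L[ℝ] L2 p q :=
  ContinuousLinearEquiv.equivOfInverse (mulL2 (sqrt_matContinuousOn hP))
    (mulL2 (inv_sqrt_matContinuousOn hP hpos))
    (mulL2_comp_eq_self _ _ fun s hs => by
      rw [Matrix.diagonal_mul_diagonal, ← Matrix.diagonal_one]
      congr 1; ext i
      exact inv_mul_cancel₀ (Real.sqrt_pos.2 (hpos s hs i)).ne')
    (mulL2_comp_eq_self _ _ fun s hs => by
      rw [Matrix.diagonal_mul_diagonal, ← Matrix.diagonal_one]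
      congr 1; ext i
      exact mul_inv_cancel₀ (Real.sqrt_pos.2 (hpos s hs i)).ne')

theorem inner_sqrtWeight (hP : ∀ i, ContinuousOn (fun s => P s i) (Icc 0 1))
    (hpos : ∀ s ∈ Icc (0 : ℝ) 1, ∀ i, 0 < P s i)
    (hPc : MatContinuousOn fun s => Matrix.diagonal (P s)) (φ ψ : L2 p q) :
    inner ℝ (sqrtWeight hP hpos φ) (sqrtWeight hP hpos ψ) = inner ℝ (mulL2 hPc φ) ψ := by
  rw [inner_L2_eq, inner_L2_eq]
  refine integral_congr_ae ?_
  filter_upwards [mulL2_ae (sqrt_matContinuousOn hP) φ, mulL2_ae (sqrt_matContinuousOn hP) ψ,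
    mulL2_ae hPc φ, ae_restrict_mem measurableSet_Ioo] with s h1 h2 h3 hs
  have h1' : WithLp.ofLp (sqrtWeight hP hpos φ s) = _ := h1
  have h2' : WithLp.ofLp (sqrtWeight hP hpos ψ s) = _ := h2
  rw [h1', h2', h3]
  simp only [Matrix.mulVec_diagonal, dotProduct]
  refine Finset.sum_congr rfl fun i _ => ?_
  have := Real.mul_self_sqrt (hpos s (Ioo_subset_Icc_self hs) i).le
  linear_combination (φ s i * ψ s i) * this

/-- `(φ, z) ↦ (√P φ, z - 𝓜 φ)`. -/
def lyapEquiv (W : L2 p q ≃L[ℝ] L2 p q) (𝓜 : L2 p q →L[ℝ] EuclideanSpace ℝ (Fin m)) :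
    State p q m ≃L[ℝ] HState p q m :=
  (ContinuousLinearEquiv.equivOfInverse
    (((W : L2 p q →L[ℝ] L2 p q).comp (ContinuousLinearMap.fst ℝ _ _)).prod
      (ContinuousLinearMap.snd ℝ _ _ - 𝓜.comp (ContinuousLinearMap.fst ℝ _ _)))
    (((W.symm : L2 p q →L[ℝ] L2 p q).comp (ContinuousLinearMap.fst ℝ _ _)).prod
      (ContinuousLinearMap.snd ℝ _ _ + (𝓜.comp (W.symm : L2 p q →L[ℝ] L2 p q)).comp
        (ContinuousLinearMap.fst ℝ _ _)))
    (fun x => by simp) (fun x => by simp)).trans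
    (WithLp.prodContinuousLinearEquiv 2 ℝ (L2 p q) (EuclideanSpace ℝ (Fin m))).symm

theorem inner_lyapEquiv (W : L2 p q ≃L[ℝ] L2 p q) (𝓜 : L2 p q →L[ℝ] EuclideanSpace ℝ (Fin m))
    (v y : State p q m) : inner ℝ (lyapEquiv W 𝓜 y) (lyapEquiv W 𝓜 v)
      = inner ℝ (W y.1) (W v.1) + inner ℝ (y.2 - 𝓜 y.1) (v.2 - 𝓜 v.1) := rfl

end Weight

namespace HypSystem

variable {S : HypSystem p q m} {ki : ℝ} {Ki : Matrix (Fin m) (Fin m) ℝ}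
  {v y : State p q m}
  {Φ Ψ : ℝ → Matrix (Idx p q) (Idx p q) ℝ}

/-- Here a and η stand for the weighted norm of φ and for |z - 𝓜φ|, b for the net boundary flux. The
bounds on k give kC ≤ 1/4 and kN² ≤ μ/8, so Young's inequality absorbs b/2 and the cross term, at a
cost of kη²/2 and a fraction of μa²/2. -/
theorem lyapunov_arith {E a η k μ C N z b : ℝ} (hk : 0 < k)
    (hC : 0 ≤ C) (hkC : k ≤ 1 / (4 * (C + 1))) (hkN : k ≤ μ / (8 * (N ^ 2 + 1)))
    (hz0 : 0 ≤ z) (hz : z ≤ η + N * a) (hb : b ≤ C * (k * z) ^ 2)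
    (hE : E ≤ (b - μ * a ^ 2) / 2 - k * η ^ 2 + k * (N * a * η)) :
    E ≤ -min (μ / 4) (k / 2) * (a ^ 2 + η ^ 2) := by
  have h1 : k * C ≤ 1 / 4 := by
    rw [le_div_iff₀ (by positivity)] at hkC
    nlinarith
  have h2 : k * N ^ 2 ≤ μ / 8 := by
    rw [le_div_iff₀ (by positivity)] at hkN
    nlinarith
  have hzz : z ^ 2 ≤ 2 * η ^ 2 + 2 * N ^ 2 * a ^ 2 := by
    have := pow_le_pow_left₀ hz0 hz 2
    nlinarith [sq_nonneg (η - N * a)]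
  have hb' : b ≤ (k * C) * k * (2 * η ^ 2 + 2 * N ^ 2 * a ^ 2) := by
    refine hb.trans ?_
    have : C * (k * z) ^ 2 = (k * C) * k * z ^ 2 := by ring
    rw [this]
    gcongr
  have hb'' : b ≤ k / 2 * η ^ 2 + k * N ^ 2 * a ^ 2 / 2 := by
    have : (k * C) * (k * (2 * η ^ 2 + 2 * N ^ 2 * a ^ 2))
        ≤ 1 / 4 * (k * (2 * η ^ 2 + 2 * N ^ 2 * a ^ 2)) := by gcongr
    linarith
  have hcross : k * (N * a * η) ≤ k / 4 * η ^ 2 + k * N ^ 2 * a ^ 2 := by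
    nlinarith [mul_nonneg hk.le (sq_nonneg (η / 2 - N * a))]
  have h3 : k * N ^ 2 * a ^ 2 ≤ μ / 8 * a ^ 2 := by gcongr
  have hm1 : min (μ / 4) (k / 2) * a ^ 2 ≤ μ / 4 * a ^ 2 := by gcongr; exact min_le_left _ _
  have hm2 : min (μ / 4) (k / 2) * η ^ 2 ≤ k / 2 * η ^ 2 := by gcongr; exact min_le_right _ _
  nlinarith [mul_nonneg hk.le (sq_nonneg η), mul_nonneg (le_trans (by positivity) h2) (sq_nonneg a)]

/-- Strict dissipativity of the closed loop for small gains. -/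
theorem exists_dissipative (hΨ : S.IsPsi Ψ) (hISS : S.ISSAssumption)
    (hrank2 : S.RankCondition2 Ψ) :
    ∃ kstar : ℝ, 0 < kstar ∧ ∀ ki : ℝ, 0 < ki → ki < kstar →
      ∃ (ρ : ℝ) (T : State p q m ≃L[ℝ] HState p q m), 0 < ρ ∧
        ∀ v y, S.IsGen ki (S.T2 Ψ)⁻¹ 0 0 v y → inner ℝ (T y) (T v) ≤ -ρ * ‖T v‖ ^ 2 := by
  obtain ⟨P, μ, Plow, Pup, Q, hPd, hμ, hPlow, hQ, hPDE, hPb, hbd⟩ := hISS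
  have hP : ∀ i, ContinuousOn (fun s => P s i) (Icc 0 1) := fun i => (hPd i).continuousOn
  have hpos : ∀ s ∈ Icc (0 : ℝ) 1, ∀ i, 0 < P s i := fun s hs i => hPlow.trans_le (hPb s hs i).1
  have hPc := MatContinuousOn.diagonal hP
  obtain ⟨C₀, hC₀, hflux⟩ := exists_flux_bound (S := S) (P := P) hQ hbd
  set W := sqrtWeight hP hpos
  set 𝓜 := forwardMap hΨ
  set N := ‖𝓜.comp (W.symm : HypReg.L2 p q →L[ℝ] HypReg.L2 p q)‖ with hN
  let Bz : EuclideanSpace ℝ (Fin m) →L[ℝ] (Idx p q → ℝ) :=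
    (S.B.mulVecLin ∘ₗ (S.T2 Ψ)⁻¹.mulVecLin).toContinuousLinearMap.comp
      (PiLp.continuousLinearEquiv 2 ℝ (fun _ : Fin m => ℝ)).toContinuousLinearMap
  set C := C₀ * ‖Bz‖ ^ 2 with hC
  have hC0 : 0 ≤ C := by positivity
  -- The first threshold absorbs the effect of the control on the boundary flux, the second the
  -- coupling of z with φ through 𝓜; the added 1's keep the denominators positive.
  refine ⟨min (1 / (4 * (C + 1))) (μ / (8 * (N ^ 2 + 1))), by positivity, fun ki hki hkis => ?_⟩
  refine ⟨min (μ / 4) (ki / 2), lyapEquiv W 𝓜, by positivity, fun v y hgen => ?_⟩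
  obtain ⟨g, f, h⟩ := hgen
  set η := v.2 - 𝓜 v.1 with hη
  have hnorm : ‖lyapEquiv W 𝓜 v‖ ^ 2 = ‖W v.1‖ ^ 2 + ‖η‖ ^ 2 := by
    rw [← real_inner_self_eq_norm_sq, inner_lyapEquiv, real_inner_self_eq_norm_sq,
      real_inner_self_eq_norm_sq]
  have hMv : ‖𝓜 v.1‖ ≤ N * ‖W v.1‖ := by
    simpa using (𝓜.comp (W.symm : HypReg.L2 p q →L[ℝ] HypReg.L2 p q)).le_opNorm (W v.1)
  have hen := h.energy hPd hPDE hPc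
  rw [← inner_sqrtWeight hP hpos, ← inner_sqrtWeight hP hpos, real_inner_self_eq_norm_sq] at hen
  have hb : S.B *ᵥ control ki (S.T2 Ψ)⁻¹ v.2 = ki • Bz v.2 := by
    rw [control, Matrix.mulVec_smul]
    rfl
  have hfl := hflux (traceOut f) (ki • Bz v.2)
  have h0 := h.at_zero
  have h1 := h.at_one
  rw [add_zero] at h0 h1
  rw [← hb, ← h0, ← h1] at hfl
  rw [hb] at hfl
  rw [hnorm]
  refine lyapunov_arith hki hC0 (hkis.le.trans (min_le_left _ _))
    (hkis.le.trans (min_le_right _ _)) (norm_nonneg v.2) (N := N) ?_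
    (b := S.flux P 0 (f 0) - S.flux P 1 (f 1)) ?_ ?_
  · have : v.2 = η + 𝓜 v.1 := by rw [hη]; abel
    rw [this]
    exact (norm_add_le _ _).trans (by gcongr)
  · refine hfl.trans ?_
    have h1 : ‖ki • Bz v.2‖ ≤ ki * (‖Bz‖ * ‖v.2‖) := by
      rw [norm_smul, Real.norm_of_nonneg hki.le]
      gcongr
      exact Bz.le_opNorm _
    calc C₀ * ‖ki • Bz v.2‖ ^ 2 ≤ C₀ * (ki * (‖Bz‖ * ‖v.2‖)) ^ 2 := by gcongr
      _ = C * (ki * ‖v.2‖) ^ 2 := by rw [hC]; ring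
  · rw [inner_lyapEquiv, h.forward hΨ hrank2]
    have h1 : inner ℝ (-(ki • v.2)) η = -ki * ‖η‖ ^ 2 - ki * inner ℝ (𝓜 v.1) η := by
      have : v.2 = η + 𝓜 v.1 := by rw [hη]; abel
      nth_rw 1 [this]
      rw [inner_neg_left, real_inner_smul_left, inner_add_left, real_inner_self_eq_norm_sq]
      ring
    have h2 : -inner ℝ (𝓜 v.1) η ≤ N * ‖W v.1‖ * ‖η‖ :=
      ((neg_le_abs _).trans (abs_real_inner_le_norm _ _)).trans (by gcongr)
    rw [← hη, h1]
    have h3 := mul_le_mul_of_nonneg_left h2 hki.le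
    linarith

/-! ### The semigroup of the closed loop -/

/-- `sg` is the exponentially stable semigroup of the closed loop without disturbances, and `R` is
the inverse of its generator. -/
structure IsClosedLoopSemigroup (S : HypSystem p q m) (ki : ℝ) (Ki : Matrix (Fin m) (Fin m) ℝ)
    (C ρ : ℝ) (R : State p q m →L[ℝ] State p q m) (sg : ℝ → State p q m → State p q m) :
    Prop where
  isGen_iff : ∀ v y, S.IsGen ki Ki 0 0 v y ↔ v = R y
  denseRange : DenseRange R
  zero : ∀ x, sg 0 x = x
  sub : ∀ t, 0 ≤ t → ∀ x y, sg t (x - y) = sg t x - sg t y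
  comm : ∀ t, 0 ≤ t → ∀ x, R (sg t x) = sg t (R x)
  continuousOn : ∀ x, ContinuousOn (fun t => sg t x) (Ici 0)
  norm_le : ∀ t, 0 ≤ t → ∀ x, ‖sg t x‖ ≤ C * Real.exp (-ρ * t) * ‖x‖
  hasDerivWithinAt : ∀ y t, 0 ≤ t → HasDerivWithinAt (fun t => sg t (R y)) (sg t y) (Ici 0) t
  eq_zero_of_deriv : ∀ u u' : ℝ → State p q m,
    (∀ t, 0 ≤ t → HasDerivWithinAt u (u' t) (Ici 0) t) → (∀ t, 0 ≤ t → u t = R (u' t)) →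
    u 0 = 0 → ∀ t, 0 ≤ t → u t = 0

/-- The Lyapunov change of variables T carries the problem to a Hilbert space whose squared norm is
the Lyapunov functional. The abstract semigroup is built there and pulled back. -/
theorem exists_closedLoopSemigroup (hΦ : S.IsPhi Φ) (hΨ : S.IsPsi Ψ)
    (hISS : S.ISSAssumption) (hrank1 : S.RankCondition1 Φ) (hrank2 : S.RankCondition2 Ψ) :
    ∃ kstar : ℝ, 0 < kstar ∧ ∀ ki : ℝ, 0 < ki → ki < kstar →
      ∃ (C ρ : ℝ) (R : State p q m →L[ℝ] State p q m) (sg : ℝ → State p q m → State p q m),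
        0 < C ∧ 0 < ρ ∧ S.IsClosedLoopSemigroup ki (S.T2 Ψ)⁻¹ C ρ R sg := by
  obtain ⟨kstar, hkstar, hdiss⟩ := exists_dissipative hΨ hISS hrank2
  refine ⟨kstar, hkstar, fun ki hki hkis => ?_⟩
  obtain ⟨ρ, T, hρ, hT⟩ := hdiss ki hki hkis
  obtain ⟨R, hRgen⟩ := exists_inverse_generator hΦ hΨ hrank1 hki.ne'
    (Ki := (S.T2 Ψ)⁻¹) (by simpa using hrank2.2)
  -- Strict dissipativity excludes a kernel, so the right inverse R describes the whole graph of the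
  -- generator.
  have hv0 : ∀ v, S.IsGen ki (S.T2 Ψ)⁻¹ 0 0 v 0 → v = 0 := fun v hv => by
    have h := hT v 0 hv
    rw [map_zero, inner_zero_left] at h
    have h1 : ‖T v‖ ^ 2 = 0 := le_antisymm (by nlinarith) (sq_nonneg _)
    have h2 : T v = 0 := norm_eq_zero.1 ((pow_eq_zero_iff two_ne_zero).1 h1)
    exact T.injective (h2.trans (map_zero T).symm)
  have hiff : ∀ v y, S.IsGen ki (S.T2 Ψ)⁻¹ 0 0 v y ↔ v = R y := fun v y => by
    constructor
    · intro h
      have := h.sub (hRgen y)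
      simp only [sub_self] at this
      exact sub_eq_zero.1 (hv0 _ this)
    · rintro rfl
      exact hRgen y
  have hRinj : Function.Injective R := fun y y' hyy => by
    have := (hRgen y).sub (hRgen y')
    rw [hyy] at this
    simp only [sub_self] at this
    exact sub_eq_zero.1 this.eq_zero
  set R' : HState p q m →L[ℝ] HState p q m :=
    (T : State p q m →L[ℝ] HState p q m).comp (R.comp (T.symm : HState p q m →L[ℝ] State p q m))
    with hR'
  have hR'T : ∀ x, R' (T x) = T (R x) := fun x => by simp [hR']
  have hdis : InvDissipative R' ρ := fun y' => by
    have := hT _ _ (hRgen (T.symm y'))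
    simpa [hR'] using this
  have hinj' : Function.Injective R' := T.injective.comp (hRinj.comp T.symm.injective)
  have hdense : DenseRange R := by
    have h1 := denseRange_of_invDissipative hρ hdis hinj'
    have h2 : DenseRange (T.symm ∘ (R' ∘ T)) :=
      T.symm.surjective.denseRange.comp
        (h1.comp T.surjective.denseRange R'.continuous) T.symm.continuous
    convert h2 using 1
    funext x
    simp [hR'T]
  set CT := ‖(T.symm : HState p q m →L[ℝ] State p q m)‖ * ‖(T : State p q m →L[ℝ] HState p q m)‖
  -- The added 1 keeps the constant positive even when the state space is trivial and both operator
  -- norms vanish.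
  refine ⟨CT + 1, ρ, R, fun t x => T.symm (invSemigroup R' t (T x)), by positivity, hρ, hiff,
    hdense, ?_, ?_, ?_, ?_, ?_, ?_, ?_⟩
  · intro x
    simp [invSemigroup_zero]
  · intro t ht x y
    simp only [map_sub, invSemigroup_sub hρ hdis hinj' ht]
  · intro t ht x
    rw [← hR'T, ← invSemigroup_comm hρ hdis hinj' ht]
    simp [hR']
  · intro x
    exact T.symm.continuous.comp_continuousOn (continuousOn_invSemigroup hρ hdis hinj' (T x))
  · intro t ht x
    have h1 := (T.symm : HState p q m →L[ℝ] State p q m).le_opNorm (invSemigroup R' t (T x))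
    have h2 := norm_invSemigroup_le_exp hρ hdis hinj' ht (T x)
    have h3 := (T : State p q m →L[ℝ] HState p q m).le_opNorm x
    calc ‖T.symm (invSemigroup R' t (T x))‖
        ≤ ‖(T.symm : HState p q m →L[ℝ] State p q m)‖ * (Real.exp (-ρ * t) *
          (‖(T : State p q m →L[ℝ] HState p q m)‖ * ‖x‖)) :=
          h1.trans (by gcongr; exact h2.trans (by gcongr; exact h3))
      _ = CT * (Real.exp (-ρ * t) * ‖x‖) := by ring
      _ ≤ (CT + 1) * (Real.exp (-ρ * t) * ‖x‖) := by gcongr; linarith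
      _ = _ := by ring
  · intro y t ht
    have h := hasDerivWithinAt_invSemigroup hρ hdis hinj' (T y) ht
    simp only [hR'T] at h
    exact (T.symm : HState p q m →L[ℝ] State p q m).hasFDerivAt.comp_hasDerivWithinAt t h
  · intro u u' hu huR hu0 t ht
    have h := norm_le_exp_mul_of_deriv hdis (u := fun t => T (u t)) (u' := fun t => T (u' t))
      (fun t ht => (T : State p q m →L[ℝ] HState p q m).hasFDerivAt.comp_hasDerivWithinAt t
        (hu t ht)) (fun t ht => by rw [hR'T, huR t ht]) ht
    simp only [hu0, map_zero, norm_zero, mul_zero] at h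
    exact T.injective ((norm_le_zero_iff.1 h).trans (map_zero T).symm)

end HypSystem

/-! ### Curves in `C([0,1], ℝⁿ)` and `L²((0,1), ℝⁿ)` -/

section Curves

variable {D D' : ℝ → ℝ → Idx p q → ℝ}

/-- The curve `t ↦ D t` in `L²((0,1), ℝⁿ)`. -/
def curveL2 (hD : Continuous fun x : ℝ × Icc (0 : ℝ) 1 => D x.1 x.2) (t : ℝ) : L2 p q :=
  embL2 (ContinuousMap.curry ⟨_, hD⟩ t)

theorem continuous_curveL2 (hD : Continuous fun x : ℝ × Icc (0 : ℝ) 1 => D x.1 x.2) :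
    Continuous (curveL2 hD) :=
  embL2.continuous.comp (ContinuousMap.continuous _)

theorem curveL2_ae (hD : Continuous fun x : ℝ × Icc (0 : ℝ) 1 => D x.1 x.2) (t : ℝ) :
    ∀ᵐ s ∂(volume.restrict (Ioo (0 : ℝ) 1)), WithLp.ofLp (curveL2 hD t s) = D t s := by
  filter_upwards [embL2_ae (ContinuousMap.curry ⟨_, hD⟩ t), ae_restrict_mem measurableSet_Ioo]
    with s h hs
  rw [curveL2, h, extC_apply _ (Ioo_subset_Icc_self hs)]
  rfl

/-- The curve equals the integral of its pointwise derivative, first at each s and hence in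
C([0,1]); the fundamental theorem of calculus there gives the norm derivative. -/
theorem hasDerivAt_curveL2 (hD : Continuous fun x : ℝ × Icc (0 : ℝ) 1 => D x.1 x.2)
    (hD' : Continuous fun x : ℝ × Icc (0 : ℝ) 1 => D' x.1 x.2)
    (h : ∀ t, ∀ s ∈ Icc (0 : ℝ) 1, HasDerivAt (fun τ => D τ s) (D' t s) t) (t : ℝ) :
    HasDerivAt (curveL2 hD) (curveL2 hD' t) t := by
  set c : C(ℝ, C01 p q) := ContinuousMap.curry ⟨_, hD⟩
  set c' : C(ℝ, C01 p q) := ContinuousMap.curry ⟨_, hD'⟩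
  have hint : ∀ τ, c τ = c 0 + ∫ r in (0 : ℝ)..τ, c' r := fun τ => by
    ext1 s
    have h1 : (∫ r in (0 : ℝ)..τ, c' r) s = ∫ r in (0 : ℝ)..τ, c' r s :=
      ((ContinuousMap.evalCLM ℝ s).intervalIntegral_comp_comm
        (c'.continuous.intervalIntegrable 0 τ)).symm
    have h2 : ∫ r in (0 : ℝ)..τ, c' r s = c τ s - c 0 s :=
      intervalIntegral.integral_eq_sub_of_hasDerivAt (fun r _ => h r s s.2)
        (((ContinuousMap.evalCLM ℝ s).continuous.comp c'.continuous).intervalIntegrable 0 τ)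
    rw [ContinuousMap.add_apply, h1, h2]
    abel
  have hd : HasDerivAt c (c' t) t := by
    have h1 := (c'.continuous.integral_hasStrictDerivAt 0 t).hasDerivAt.const_add (c 0)
    exact h1.congr_of_eventuallyEq (Eventually.of_forall hint)
  exact embL2.hasFDerivAt.comp_hasDerivAt t hd

theorem MatContinuousOn.continuous_mulVec {ι κ : Type*} [Fintype κ] {M : ℝ → Matrix ι κ ℝ}
    (hM : MatContinuousOn M) {h : ℝ × Icc (0 : ℝ) 1 → κ → ℝ} (hh : Continuous h) :
    Continuous fun x : ℝ × Icc (0 : ℝ) 1 => M x.2 *ᵥ h x := by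
  refine continuous_pi fun i => ?_
  simp only [Matrix.mulVec, dotProduct]
  exact continuous_finsetSum _ fun j _ =>
    (((hM i j).domRestrict).comp continuous_snd).mul ((continuous_apply j).comp hh)

end Curves

/-! ### Partial derivatives of test functions -/

section Partial

variable {ψ : ℝ → ℝ → Idx p q → ℝ}

theorem hasDerivAt_left (hψ : ContDiff ℝ 1 fun x : ℝ × ℝ => ψ x.1 x.2) (t s : ℝ) :
    HasDerivAt (fun τ => ψ τ s) (fderiv ℝ (fun x : ℝ × ℝ => ψ x.1 x.2) (t, s) (1, 0)) t :=
  ((hψ.differentiable one_ne_zero) (t, s)).hasFDerivAt.comp_hasDerivAt (f := fun τ => (τ, s)) t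
    ((hasDerivAt_id t).prodMk (hasDerivAt_const t s))

theorem hasDerivAt_right (hψ : ContDiff ℝ 1 fun x : ℝ × ℝ => ψ x.1 x.2) (t s : ℝ) :
    HasDerivAt (ψ t) (fderiv ℝ (fun x : ℝ × ℝ => ψ x.1 x.2) (t, s) (0, 1)) s :=
  ((hψ.differentiable one_ne_zero) (t, s)).hasFDerivAt.comp_hasDerivAt (f := fun τ => (t, τ)) s
    ((hasDerivAt_const s t).prodMk (hasDerivAt_id s))

theorem continuous_deriv_left (hψ : ContDiff ℝ 1 fun x : ℝ × ℝ => ψ x.1 x.2) :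
    Continuous fun x : ℝ × ℝ => deriv (fun τ => ψ τ x.2) x.1 := by
  simp only [fun x : ℝ × ℝ => (hasDerivAt_left hψ x.1 x.2).deriv]
  exact (hψ.continuous_fderiv one_ne_zero).clm_apply continuous_const

theorem continuous_deriv_right (hψ : ContDiff ℝ 1 fun x : ℝ × ℝ => ψ x.1 x.2) :
    Continuous fun x : ℝ × ℝ => deriv (ψ x.1) x.2 := by
  simp only [fun x : ℝ × ℝ => (hasDerivAt_right hψ x.1 x.2).deriv]
  exact (hψ.continuous_fderiv one_ne_zero).clm_apply continuous_const

end Partial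

namespace HypSystem

variable {S : HypSystem p q m} {ki : ℝ} {Ki : Matrix (Fin m) (Fin m) ℝ} {wb : Idx p q → ℝ}
  {w wy yref : EuclideanSpace ℝ (Fin m)} {v y v₀ : State p q m} {g : HypReg.L2 p q}
  {f : ℝ → Idx p q → ℝ} {Φ Ψ : ℝ → Matrix (Idx p q) (Idx p q) ℝ}

/-! ### Strong solutions and the generator -/

/-- Invertibility of Λ₀ determines the space derivative from v and y by bounded operators.
Continuity in H¹ therefore follows from continuity of v and v' in L². -/
theorem IsGenAux.eq_statDeriv (h : S.IsGenAux ki Ki wb w v y g f) : g = statDeriv S v.1 y.1 := by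
  refine Lp.ext ?_
  filter_upwards [h.pde, statDeriv_ae (S := S) v.1 y.1, ae_restrict_mem measurableSet_Ioo]
    with s h1 h2 hs
  refine WithLp.ofLp_injective 2 ?_
  rw [h2, ← Matrix.mulVec_neg]
  have h3 : -(S.Lam1 s *ᵥ WithLp.ofLp (v.1 s) + WithLp.ofLp (y.1 s))
      = S.Lam0 s *ᵥ WithLp.ofLp (g s) := by
    rw [neg_eq_iff_add_eq_zero, ← h1]; abel
  rw [h3, Matrix.mulVec_mulVec, S.Laminv_mul_Lam0 (Ioo_subset_Icc_self hs), Matrix.one_mulVec]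

theorem traceIn_congr {f f' : ℝ → Idx p q → ℝ} (h : EqOn f f' (Icc 0 1)) :
    traceIn f = traceIn f' := by
  rw [traceIn_eq, traceIn_eq, h ⟨le_rfl, zero_le_one⟩, h ⟨zero_le_one, le_rfl⟩]

theorem traceOut_congr {f f' : ℝ → Idx p q → ℝ} (h : EqOn f f' (Icc 0 1)) :
    traceOut f = traceOut f' := by
  rw [traceOut_eq, traceOut_eq, h ⟨le_rfl, zero_le_one⟩, h ⟨zero_le_one, le_rfl⟩]

theorem IsGen.isGenAux (h : S.IsGen ki Ki wb w v y) :
    S.IsGenAux ki Ki wb w v y (statDeriv S v.1 y.1) (contRep v.1) := by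
  obtain ⟨g, f, h⟩ := h
  have hg := h.eq_statDeriv
  subst hg
  have hc := h.rep.contRep_eqOn
  exact ⟨h.rep.hasWeakDeriv.isH1Rep, h.pde, by
    rw [traceIn_congr hc, traceOut_congr hc, h.boundary], by
    rw [traceIn_congr hc, traceOut_congr hc, h.integrator]⟩

theorem IsStrongSolution.isGen {v : ℝ → State p q m}
    (h : S.IsStrongSolution ki Ki wb wy yref v₀ v) {t : ℝ} (ht : 0 ≤ t) :
    S.IsGen ki Ki wb (wy - yref) (v t) (derivWithin v (Ici 0) t) := by
  obtain ⟨g, -, hg⟩ := h.pde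
  refine ⟨g t, contRep (v t).1, (hg t ht).1.isH1Rep, (hg t ht).2, h.boundary t ht, ?_⟩
  rw [h.integrator t ht, output]
  abel

theorem isStrongSolution_of_isGen {v v' : ℝ → State p q m} (h0 : v 0 = v₀)
    (hd : ∀ t, 0 ≤ t → HasDerivWithinAt v (v' t) (Ici 0) t) (hc : ContinuousOn v' (Ici 0))
    (hg : ∀ t, 0 ≤ t → S.IsGen ki Ki wb (wy - yref) (v t) (v' t)) :
    S.IsStrongSolution ki Ki wb wy yref v₀ v := by
  have hdw : ∀ t ∈ Ici (0 : ℝ), derivWithin v (Ici 0) t = v' t := fun t ht =>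
    (hd t ht).derivWithin (uniqueDiffOn_Ici 0 t ht)
  have hvc : ContinuousOn v (Ici 0) := fun t ht => (hd t ht).continuousWithinAt
  refine ⟨h0, ?_, ⟨fun t => statDeriv S (v t).1 (v' t).1, ?_, fun t ht => ⟨?_, ?_⟩⟩, ?_, ?_⟩
  · rw [contDiffOn_one_iff_derivWithin (uniqueDiffOn_Ici 0)]
    exact ⟨fun t ht => (hd t ht).differentiableWithinAt, hc.congr hdw⟩
  · have h1 : ContinuousOn (fun t => (v t).1) (Ici 0) := continuous_fst.comp_continuousOn hvc
    have h2 : ContinuousOn (fun t => (v' t).1) (Ici 0) := continuous_fst.comp_continuousOn hc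
    exact ((mulL2 S.Laminv_matContinuousOn).continuous.comp_continuousOn
      (((mulL2 S.Lam1_matContinuousOn).continuous.comp_continuousOn h1).add h2)).neg
  · exact (hg t ht).isGenAux.rep.hasWeakDeriv
  · rw [hdw t ht]
    exact (hg t ht).isGenAux.pde
  · exact fun t ht => (hg t ht).isGenAux.boundary
  · intro t ht
    rw [hdw t ht, (hg t ht).isGenAux.integrator, output]
    abel

/-! ### Green's formula -/

/-- Integrates the derivative of ηᵀΛ₀f. The boundary condition is not involved, which lets
`isGen_of_adjoint` use the formula before that condition is known. -/
theorem green (h : IsH1Rep v.1 g f)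
    (hpde : ∀ᵐ s ∂(volume.restrict (Ioo (0 : ℝ) 1)), WithLp.ofLp (y.1 s)
      + S.Lam0 s *ᵥ WithLp.ofLp (g s) + S.Lam1 s *ᵥ WithLp.ofLp (v.1 s) = 0)
    {η η' : ℝ → Idx p q → ℝ} (hη : ∀ s, HasDerivAt η (η' s) s) (hη' : Continuous η')
    {πL aL : HypReg.L2 p q}
    (hπL : ∀ᵐ s ∂(volume.restrict (Ioo (0 : ℝ) 1)), WithLp.ofLp (πL s) = η s)
    (haL : ∀ᵐ s ∂(volume.restrict (Ioo (0 : ℝ) 1)), WithLp.ofLp (aL s)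
      = S.Lam0 s *ᵥ η' s + S.Lam0' s *ᵥ η s - (S.Lam1 s)ᵀ *ᵥ η s) :
    inner ℝ πL y.1 = inner ℝ aL v.1
      - (η 1 ⬝ᵥ (S.Lam0 1 *ᵥ f 1) - η 0 ⬝ᵥ (S.Lam0 0 *ᵥ f 0)) := by
  have hηi : ∀ i, IsPrim (fun s => η s i) (fun s => η' s i) := fun i =>
    IsPrim.of_hasDerivWithinAt (fun s _ => (hasDerivAt_pi.1 (hη s) i).hasDerivWithinAt)
      ((continuous_apply i).comp hη').continuousOn
  have hprim := IsPrim.sum Finset.univ (F := fun i s => S.lam s i * (η s i * f s i))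
    (G := fun i s => derivWithin (fun σ => S.lam σ i) (Icc 0 1) s * (η s i * f s i)
      + S.lam s i * (η' s i * f s i + η s i * g s i))
    fun i _ => (IsPrim.of_contDiffOn (S.lam_contDiffOn i)).mul ((hηi i).mul (h.isPrim i))
  have hbd : ∀ s, η s ⬝ᵥ (S.Lam0 s *ᵥ f s) = ∑ i, S.lam s i * (η s i * f s i) := fun s => by
    simp only [Lam0, Matrix.mulVec_diagonal, dotProduct]
    exact Finset.sum_congr rfl fun i _ => by ring
  rw [hbd 1, hbd 0, ← hprim.integral_eq, inner_L2_eq, inner_L2_eq, ← integral_sub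
    (integrable_dotProduct _ _)
    ((intervalIntegrable_iff_integrableOn_Ioo_of_le zero_le_one).1 hprim.1)]
  refine integral_congr_ae ?_
  filter_upwards [h.ae_eq, hpde, hπL, haL] with s h1 h2 h3 h4
  have hy : WithLp.ofLp (y.1 s) = -(S.Lam0 s *ᵥ WithLp.ofLp (g s) + S.Lam1 s *ᵥ f s) := by
    rw [← h1, eq_neg_iff_add_eq_zero, ← add_assoc, h2]
  rw [h3, h4, h1, hy, dotProduct_neg, dotProduct_add, sub_dotProduct, add_dotProduct]
  have h5 : ((S.Lam1 s)ᵀ *ᵥ η s) ⬝ᵥ f s = η s ⬝ᵥ (S.Lam1 s *ᵥ f s) := by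
    rw [Matrix.dotProduct_mulVec, Matrix.mulVec_transpose]
  have h6 : (S.Lam0 s *ᵥ η' s) ⬝ᵥ f s = ∑ i, S.lam s i * (η' s i * f s i) := by
    simp only [Lam0, Matrix.mulVec_diagonal, dotProduct]
    exact Finset.sum_congr rfl fun i _ => by ring
  have h7 : (S.Lam0' s *ᵥ η s) ⬝ᵥ f s
      = ∑ i, derivWithin (fun σ => S.lam σ i) (Icc 0 1) s * (η s i * f s i) := by
    simp only [Lam0', Matrix.mulVec_diagonal, dotProduct]
    exact Finset.sum_congr rfl fun i _ => by ring
  have h8 : η s ⬝ᵥ (S.Lam0 s *ᵥ WithLp.ofLp (g s)) = ∑ i, S.lam s i * (η s i * g s i) := by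
    simp only [Lam0, Matrix.mulVec_diagonal, dotProduct]
    exact Finset.sum_congr rfl fun i _ => by ring
  rw [h5, h6, h7, h8]
  simp only [mul_add, Finset.sum_add_distrib]
  ring

/-- Green's formula for the closed loop and the adjoint boundary condition. -/
theorem IsGenAux.green (h : S.IsGenAux ki Ki wb w v y g f)
    {η η' : ℝ → Idx p q → ℝ} (hη : ∀ s, HasDerivAt η (η' s) s) (hη' : Continuous η')
    {πL aL : HypReg.L2 p q}
    (hπL : ∀ᵐ s ∂(volume.restrict (Ioo (0 : ℝ) 1)), WithLp.ofLp (πL s) = η s)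
    (haL : ∀ᵐ s ∂(volume.restrict (Ioo (0 : ℝ) 1)), WithLp.ofLp (aL s)
      = S.Lam0 s *ᵥ η' s + S.Lam0' s *ᵥ η s - (S.Lam1 s)ᵀ *ᵥ η s)
    {ζ : Fin m → ℝ} (hadj : S.Kplusᵀ *ᵥ (S.Lam0 1 *ᵥ η 1) - S.Kminusᵀ *ᵥ (S.Lam0 0 *ᵥ η 0)
      = (S.L1 * S.K + S.L2)ᵀ *ᵥ ζ) :
    inner ℝ πL y.1 + ζ ⬝ᵥ WithLp.ofLp y.2 = inner ℝ aL v.1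
      + (η 0 ⬝ᵥ (S.Lam0 0 *ᵥ plusPart (S.B *ᵥ control ki Ki v.2 + wb))
        - η 1 ⬝ᵥ (S.Lam0 1 *ᵥ minusPart (S.B *ᵥ control ki Ki v.2 + wb))
        + ζ ⬝ᵥ (S.L1 *ᵥ (S.B *ᵥ control ki Ki v.2 + wb) + WithLp.ofLp w)) := by
  have h1 := HypSystem.green h.rep h.pde hη hη' hπL haL
  set b := S.B *ᵥ control ki Ki v.2 + wb with hb
  set x := traceOut f with hx
  have hx2 := congrArg (fun r => r ⬝ᵥ x) hadj
  simp only [sub_dotProduct] at hx2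
  have hT : ∀ {ι κ : Type} [Fintype ι] [Fintype κ] (K : Matrix ι κ ℝ) (r : ι → ℝ) (x : κ → ℝ),
      (Kᵀ *ᵥ r) ⬝ᵥ x = r ⬝ᵥ (K *ᵥ x) := fun K r x => by
    rw [Matrix.dotProduct_mulVec, Matrix.mulVec_transpose]
  have hsym : ∀ s (a c : Idx p q → ℝ), (S.Lam0 s *ᵥ a) ⬝ᵥ c = a ⬝ᵥ (S.Lam0 s *ᵥ c) :=
    fun s a c => by
      simp only [Lam0, Matrix.mulVec_diagonal, dotProduct]
      exact Finset.sum_congr rfl fun i _ => by ring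
  rw [hT, hT, hT, hsym, hsym] at hx2
  have hz : WithLp.ofLp y.2 = (S.L1 * S.K + S.L2) *ᵥ x + (S.L1 *ᵥ b + WithLp.ofLp w) := by
    rw [h.integrator, h.boundary, add_assoc, ← hb, ← hx]
    simp only [WithLp.ofLp_add, Matrix.mulVec_add, Matrix.add_mulVec, Matrix.mulVec_mulVec]
    abel
  rw [h1, hz, h.at_zero, h.at_one, ← hb, ← hx]
  simp only [Matrix.mulVec_add, dotProduct_add]
  linarith

end HypSystem

namespace HypSystem

variable {S : HypSystem p q m} {ki : ℝ} {Ki : Matrix (Fin m) (Fin m) ℝ} {wb : Idx p q → ℝ}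
  {w wy yref : EuclideanSpace ℝ (Fin m)} {v₀ : State p q m}
  {T : ℝ} {ψ : ℝ → ℝ → Idx p q → ℝ} {ζ : ℝ → Fin m → ℝ}

/-! ### The weak formulation -/

/-- The spatial part of the adjoint operator. -/
def adjExpr (S : HypSystem p q m) (ψ : ℝ → ℝ → Idx p q → ℝ) (t s : ℝ) : Idx p q → ℝ :=
  S.Lam0 s *ᵥ deriv (ψ t) s + S.Lam0' s *ᵥ ψ t s - (S.Lam1 s)ᵀ *ᵥ ψ t s

theorem continuous_adjExpr (hψ : ContDiff ℝ 1 fun x : ℝ × ℝ => ψ x.1 x.2) :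
    Continuous fun x : ℝ × Icc (0 : ℝ) 1 => S.adjExpr ψ x.1 x.2 := by
  have hj : Continuous fun x : ℝ × Icc (0 : ℝ) 1 => ((x.1, (x.2 : ℝ)) : ℝ × ℝ) := by fun_prop
  have h1 := hψ.continuous.comp hj
  have h2 := (continuous_deriv_right hψ).comp hj
  exact ((S.Lam0_matContinuousOn.continuous_mulVec h2).add
    (S.Lam0'_matContinuousOn.continuous_mulVec h1)).sub
    (S.Lam1_matContinuousOn.transpose.continuous_mulVec h1)

theorem continuous_restrict (hψ : ContDiff ℝ 1 fun x : ℝ × ℝ => ψ x.1 x.2) :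
    Continuous fun x : ℝ × Icc (0 : ℝ) 1 => ψ x.1 x.2 :=
  hψ.continuous.comp (by fun_prop : Continuous fun x : ℝ × Icc (0 : ℝ) 1 => (x.1, (x.2 : ℝ)))

/-- The partial derivative with respect to time. -/
def timeDeriv (ψ : ℝ → ℝ → Idx p q → ℝ) (t s : ℝ) : Idx p q → ℝ := deriv (fun τ => ψ τ s) t

theorem continuous_deriv_restrict (hψ : ContDiff ℝ 1 fun x : ℝ × ℝ => ψ x.1 x.2) :
    Continuous fun x : ℝ × Icc (0 : ℝ) 1 => timeDeriv ψ x.1 x.2 :=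
  (continuous_deriv_left hψ).comp
    (by fun_prop : Continuous fun x : ℝ × Icc (0 : ℝ) 1 => (x.1, (x.2 : ℝ)))

/-- The boundary terms of the weak formulation. -/
def bdryTerm (S : HypSystem p q m) (w : EuclideanSpace ℝ (Fin m)) (a₀ a₁ : Idx p q → ℝ)
    (ζ : Fin m → ℝ) (b : Idx p q → ℝ) : ℝ :=
  a₀ ⬝ᵥ (S.Lam0 0 *ᵥ plusPart b) - a₁ ⬝ᵥ (S.Lam0 1 *ᵥ minusPart b)
    + ζ ⬝ᵥ (S.L1 *ᵥ b + WithLp.ofLp w)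

/-- The left-hand side of the weak formulation, with the spatial integrals written as inner
products. -/
def weakForm (S : HypSystem p q m) (ki : ℝ) (Ki : Matrix (Fin m) (Fin m) ℝ) (wb : Idx p q → ℝ)
    (w : EuclideanSpace ℝ (Fin m)) (T : ℝ) (ψ : ℝ → ℝ → Idx p q → ℝ) (ζ : ℝ → Fin m → ℝ)
    (hψ : ContDiff ℝ 1 fun x : ℝ × ℝ => ψ x.1 x.2) (v : ℝ → State p q m) (v₀ : State p q m) : ℝ :=
  (∫ t in (0 : ℝ)..T,
      (inner ℝ (curveL2 (continuous_deriv_restrict hψ) t) (v t).1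
        + inner ℝ (curveL2 (continuous_adjExpr (S := S) hψ) t) (v t).1
        + deriv ζ t ⬝ᵥ WithLp.ofLp (v t).2
        + S.bdryTerm w (ψ t 0) (ψ t 1) (ζ t) (S.B *ᵥ control ki Ki (v t).2 + wb)))
    + inner ℝ (curveL2 (continuous_restrict hψ) 0) v₀.1 + ζ 0 ⬝ᵥ WithLp.ofLp v₀.2

theorem continuous_bdryTerm : Continuous
    fun x : (Idx p q → ℝ) × (Idx p q → ℝ) × (Fin m → ℝ) × (Idx p q → ℝ) =>
      S.bdryTerm w x.1 x.2.1 x.2.2.1 x.2.2.2 := by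
  have hpc : Continuous (plusPart : (Idx p q → ℝ) → _) := plusL.continuous_of_finiteDimensional
  have hmc : Continuous (minusPart : (Idx p q → ℝ) → _) := minusL.continuous_of_finiteDimensional
  unfold bdryTerm
  fun_prop

theorem continuous_control : Continuous (control ki Ki) := by
  unfold control
  fun_prop

theorem continuousOn_uIcc {v : ℝ → State p q m} (hv : ContinuousOn v (Ici 0)) (hT : 0 ≤ T) : ContinuousOn v (uIcc 0 T) :=
  hv.mono (by rw [uIcc_of_le hT]; exact Icc_subset_Ici_self)

theorem intervalIntegrable_inner_curve {v : ℝ → State p q m} (hv : ContinuousOn v (Ici 0))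
    (hT : 0 ≤ T) {D : ℝ → ℝ → Idx p q → ℝ}
    (hD : Continuous fun x : ℝ × Icc (0 : ℝ) 1 => D x.1 x.2) :
    IntervalIntegrable (fun t => inner ℝ (curveL2 hD t) (v t).1) volume 0 T :=
  ContinuousOn.intervalIntegrable ((continuous_curveL2 hD).continuousOn.inner
    (continuous_fst.comp_continuousOn (continuousOn_uIcc hv hT)))

theorem intervalIntegrable_deriv_dotProduct {v : ℝ → State p q m} (hv : ContinuousOn v (Ici 0))
    (hζ : ContDiff ℝ 1 ζ) (hT : 0 ≤ T) :
    IntervalIntegrable (fun t => deriv ζ t ⬝ᵥ WithLp.ofLp (v t).2) volume 0 T := by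
  refine ContinuousOn.intervalIntegrable ?_
  have h1 := continuous_snd.comp_continuousOn (continuousOn_uIcc hv hT)
  have h2 : ContinuousOn (deriv ζ) (uIcc 0 T) := (hζ.continuous_deriv le_rfl).continuousOn
  have h3 : ContinuousOn (fun t => WithLp.ofLp (v t).2) (uIcc 0 T) :=
    (PiLp.continuous_ofLp 2 _).comp_continuousOn h1
  simp only [dotProduct]
  exact continuousOn_finsetSum _ fun i _ =>
    ((continuous_apply i).comp_continuousOn h2).mul ((continuous_apply i).comp_continuousOn h3)

theorem continuousOn_bdryTerm {a₀ a₁ b : ℝ → Idx p q → ℝ} {s : Set ℝ} (h₀ : ContinuousOn a₀ s)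
    (h₁ : ContinuousOn a₁ s) (hζ : ContinuousOn ζ s) (hb : ContinuousOn b s) :
    ContinuousOn (fun t => S.bdryTerm w (a₀ t) (a₁ t) (ζ t) (b t)) s :=
  (continuous_bdryTerm (S := S) (w := w)).comp_continuousOn
    (f := fun t => (a₀ t, a₁ t, ζ t, b t)) (h₀.prodMk (h₁.prodMk (hζ.prodMk hb)))

theorem continuous_boundaryInput :
    Continuous fun v : State p q m => S.B *ᵥ control ki Ki v.2 + wb :=
  (Continuous.matrix_mulVec continuous_const (continuous_control.comp continuous_snd)).add
    continuous_const

theorem intervalIntegrable_bdryTerm {v : ℝ → State p q m} (hv : ContinuousOn v (Ici 0))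
    (hψ : ContDiff ℝ 1 fun x : ℝ × ℝ => ψ x.1 x.2) (hζ : ContDiff ℝ 1 ζ) (hT : 0 ≤ T) :
    IntervalIntegrable (fun t =>
      S.bdryTerm w (ψ t 0) (ψ t 1) (ζ t) (S.B *ᵥ control ki Ki (v t).2 + wb)) volume 0 T := by
  have h3 : ∀ s, Continuous fun t => ψ t s := fun s =>
    hψ.continuous.comp (by fun_prop : Continuous fun t : ℝ => (t, s))
  exact (continuousOn_bdryTerm (h3 0).continuousOn (h3 1).continuousOn hζ.continuous.continuousOn
    (continuous_boundaryInput.comp_continuousOn (continuousOn_uIcc hv hT))).intervalIntegrable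

theorem weakForm_eq {v : ℝ → State p q m} (hv : ContinuousOn v (Ici 0))
    (hψ : ContDiff ℝ 1 fun x : ℝ × ℝ => ψ x.1 x.2) (hζ : ContDiff ℝ 1 ζ) (hT : 0 ≤ T) :
    S.weakForm ki Ki wb (wy - yref) T ψ ζ hψ v v₀ =
    (∫ t in (0 : ℝ)..T, ∫ s in Ioo (0 : ℝ) 1,
        (deriv (fun τ => ψ τ s) t + S.Lam0 s *ᵥ deriv (ψ t) s + S.Lam0' s *ᵥ ψ t s
          - (S.Lam1 s)ᵀ *ᵥ ψ t s) ⬝ᵥ WithLp.ofLp ((v t).1 s))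
      + (∫ s in Ioo (0 : ℝ) 1, ψ 0 s ⬝ᵥ WithLp.ofLp (v₀.1 s))
      + (∫ t in (0 : ℝ)..T, deriv ζ t ⬝ᵥ WithLp.ofLp (v t).2)
      + ζ 0 ⬝ᵥ WithLp.ofLp v₀.2
      + (∫ t in (0 : ℝ)..T,
          (ψ t 0 ⬝ᵥ (S.Lam0 0 *ᵥ plusPart (S.B *ᵥ control ki Ki (v t).2 + wb))
            - ψ t 1 ⬝ᵥ (S.Lam0 1 *ᵥ minusPart (S.B *ᵥ control ki Ki (v t).2 + wb))
            + ζ t ⬝ᵥ (S.L1 *ᵥ (S.B *ᵥ control ki Ki (v t).2 + wb)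
                + WithLp.ofLp wy - WithLp.ofLp yref))) := by
  have h0 : inner ℝ (curveL2 (continuous_restrict hψ) 0) v₀.1
      = ∫ s in Ioo (0 : ℝ) 1, ψ 0 s ⬝ᵥ WithLp.ofLp (v₀.1 s) := by
    rw [inner_L2_eq]
    refine integral_congr_ae ?_
    filter_upwards [curveL2_ae (continuous_restrict hψ) 0] with s hs
    rw [hs]
  have h1 : ∀ t, inner ℝ (curveL2 (continuous_deriv_restrict hψ) t) (v t).1
        + inner ℝ (curveL2 (continuous_adjExpr (S := S) hψ) t) (v t).1
      = ∫ s in Ioo (0 : ℝ) 1,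
        (deriv (fun τ => ψ τ s) t + S.Lam0 s *ᵥ deriv (ψ t) s + S.Lam0' s *ᵥ ψ t s
          - (S.Lam1 s)ᵀ *ᵥ ψ t s) ⬝ᵥ WithLp.ofLp ((v t).1 s) := fun t => by
    rw [inner_L2_eq, inner_L2_eq, ← integral_add (integrable_dotProduct _ _)
      (integrable_dotProduct _ _)]
    refine integral_congr_ae ?_
    filter_upwards [curveL2_ae (continuous_deriv_restrict hψ) t,
      curveL2_ae (continuous_adjExpr (S := S) hψ) t] with s hs hs'
    rw [hs, hs', ← add_dotProduct, adjExpr, timeDeriv]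
    congr 1
    abel
  have i1 := intervalIntegrable_inner_curve hv hT (continuous_deriv_restrict hψ)
  have i2 := intervalIntegrable_inner_curve hv hT (continuous_adjExpr (S := S) hψ)
  have i3 := intervalIntegrable_deriv_dotProduct hv hζ hT
  have i4 := intervalIntegrable_bdryTerm (S := S) (ki := ki) (Ki := Ki) (wb := wb)
    (w := wy - yref) hv hψ hζ hT
  rw [weakForm, intervalIntegral.integral_add ((i1.add i2).add i3) i4,
    intervalIntegral.integral_add (i1.add i2) i3, h0]
  simp only [h1, bdryTerm, WithLp.ofLp_sub, add_sub_assoc]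
  ring

theorem isWeakSolution_iff {v : ℝ → State p q m} :
    S.IsWeakSolution ki Ki wb wy yref v₀ v ↔ v 0 = v₀ ∧ ContinuousOn v (Ici 0) ∧
      ∀ T : ℝ, 0 < T → ∀ ψ ζ, ∀ h : S.IsTestPair T ψ ζ,
        S.weakForm ki Ki wb (wy - yref) T ψ ζ h.contDiff_psi v v₀ = 0 := by
  constructor
  · rintro ⟨h1, h2, h3⟩
    exact ⟨h1, h2, fun T hT ψ ζ h => by
      rw [weakForm_eq h2 h.contDiff_psi h.contDiff_zeta hT.le]; exact h3 T hT ψ ζ h⟩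
  · rintro ⟨h1, h2, h3⟩
    exact ⟨h1, h2, fun T hT ψ ζ h => by
      rw [← weakForm_eq h2 h.contDiff_psi h.contDiff_zeta hT.le]; exact h3 T hT ψ ζ h⟩

theorem bdryTerm_sub (w w' : EuclideanSpace ℝ (Fin m)) (a₀ a₁ : Idx p q → ℝ)
    (ζ : Fin m → ℝ) (b b' : Idx p q → ℝ) : S.bdryTerm (w - w') a₀ a₁ ζ (b - b')
      = S.bdryTerm w a₀ a₁ ζ b - S.bdryTerm w' a₀ a₁ ζ b' := by
  simp only [bdryTerm, plusPart_sub, minusPart_sub, Matrix.mulVec_sub, dotProduct_sub,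
    dotProduct_add, WithLp.ofLp_sub]
  ring

theorem weakForm_sub {v v' : ℝ → State p q m} (hv : ContinuousOn v (Ici 0))
    (hv' : ContinuousOn v' (Ici 0)) {v₀ v₀' : State p q m} {wb wb' : Idx p q → ℝ}
    {w w' : EuclideanSpace ℝ (Fin m)}
    (hψ : ContDiff ℝ 1 fun x : ℝ × ℝ => ψ x.1 x.2) (hζ : ContDiff ℝ 1 ζ) (hT : 0 ≤ T) :
    S.weakForm ki Ki (wb - wb') (w - w') T ψ ζ hψ (fun t => v t - v' t) (v₀ - v₀')
      = S.weakForm ki Ki wb w T ψ ζ hψ v v₀ - S.weakForm ki Ki wb' w' T ψ ζ hψ v' v₀' := by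
  have hi : ∀ {v : ℝ → State p q m} (_ : ContinuousOn v (Ici 0)) (wb : Idx p q → ℝ)
      (w : EuclideanSpace ℝ (Fin m)), IntervalIntegrable (fun t =>
        inner ℝ (curveL2 (continuous_deriv_restrict hψ) t) (v t).1
        + inner ℝ (curveL2 (continuous_adjExpr (S := S) hψ) t) (v t).1
        + deriv ζ t ⬝ᵥ WithLp.ofLp (v t).2
        + S.bdryTerm w (ψ t 0) (ψ t 1) (ζ t) (S.B *ᵥ control ki Ki (v t).2 + wb)) volume 0 T :=
    fun hv wb w => (((intervalIntegrable_inner_curve hv hT _).add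
      (intervalIntegrable_inner_curve hv hT _)).add
      (intervalIntegrable_deriv_dotProduct hv hζ hT)).add
      (intervalIntegrable_bdryTerm hv hψ hζ hT)
  have e : ∀ a b c a' b' c' : ℝ, a + b + c - (a' + b' + c') = a - a' + (b - b') + (c - c') :=
    fun a b c a' b' c' => by ring
  rw [weakForm, weakForm, weakForm, e, ← intervalIntegral.integral_sub (hi hv wb w) (hi hv' wb' w'),
    ← inner_sub_right, ← dotProduct_sub, ← WithLp.ofLp_sub 2 v₀.2 v₀'.2]
  congr 3
  funext t
  have h1 : S.B *ᵥ control ki Ki (v t - v' t).2 + (wb - wb')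
      = (S.B *ᵥ control ki Ki (v t).2 + wb) - (S.B *ᵥ control ki Ki (v' t).2 + wb') := by
    rw [Prod.snd_sub, control_sub, Matrix.mulVec_sub]
    abel
  rw [h1, bdryTerm_sub, Prod.fst_sub, Prod.snd_sub, inner_sub_right, inner_sub_right,
    WithLp.ofLp_sub, dotProduct_sub]
  ring

theorem IsWeakSolution.sub {v v' : ℝ → State p q m} {v₀ v₀' : State p q m}
    {wb wb' : Idx p q → ℝ} {wy wy' yref yref' : EuclideanSpace ℝ (Fin m)}
    (h : S.IsWeakSolution ki Ki wb wy yref v₀ v) (h' : S.IsWeakSolution ki Ki wb' wy' yref' v₀' v') :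
    S.IsWeakSolution ki Ki (wb - wb') (wy - wy') (yref - yref') (v₀ - v₀')
      fun t => v t - v' t := by
  rw [isWeakSolution_iff] at h h' ⊢
  refine ⟨by rw [h.1, h'.1], h.2.1.sub h'.2.1, fun T hT ψ ζ htest => ?_⟩
  rw [sub_sub_sub_comm, weakForm_sub h.2.1 h'.2.1 _ htest.contDiff_zeta hT.le,
    h.2.2 T hT ψ ζ htest, h'.2.2 T hT ψ ζ htest, sub_zero]

/-! ### Strong solutions are weak solutions -/

/-- By Green's formula the weak integrand is the time derivative of ⟨ψ, φ⟩ + ζ·z. This pairing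
vanishes at T, and its value at 0 is the initial term. -/
theorem isWeakSolution_of_isGen {v v' : ℝ → State p q m} (h0 : v 0 = v₀)
    (hd : ∀ t, 0 ≤ t → HasDerivWithinAt v (v' t) (Ici 0) t)
    (hg : ∀ t, 0 ≤ t → S.IsGen ki Ki wb (wy - yref) (v t) (v' t)) :
    S.IsWeakSolution ki Ki wb wy yref v₀ v := by
  have hvc : ContinuousOn v (Ici 0) := fun t ht => (hd t ht).continuousWithinAt
  rw [isWeakSolution_iff]
  refine ⟨h0, hvc, fun T hT ψ ζ htest => ?_⟩
  have hψ := htest.contDiff_psi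
  have hζ := htest.contDiff_zeta
  set E : ℝ → ℝ := fun t => inner ℝ (curveL2 (continuous_restrict hψ) t) (v t).1
    + ζ t ⬝ᵥ WithLp.ofLp (v t).2 with hE
  have hcurve : ∀ t, HasDerivAt (curveL2 (continuous_restrict hψ))
      (curveL2 (continuous_deriv_restrict hψ) t) t :=
    hasDerivAt_curveL2 (continuous_restrict hψ) (continuous_deriv_restrict hψ) fun t s _ => (hasDerivAt_left hψ t s).differentiableAt.hasDerivAt
  have hEd : ∀ t ∈ Icc (0 : ℝ) T, HasDerivWithinAt E
      (inner ℝ (curveL2 (continuous_deriv_restrict hψ) t) (v t).1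
        + inner ℝ (curveL2 (continuous_adjExpr (S := S) hψ) t) (v t).1
        + deriv ζ t ⬝ᵥ WithLp.ofLp (v t).2
        + S.bdryTerm (wy - yref) (ψ t 0) (ψ t 1) (ζ t) (S.B *ᵥ control ki Ki (v t).2 + wb))
      (Ici 0) t := fun t ht => by
    have hv1 : HasDerivWithinAt (fun t => (v t).1) (v' t).1 (Ici 0) t := (hd t ht.1).fst
    have hv2 : HasDerivWithinAt (fun t => (v t).2) (v' t).2 (Ici 0) t := (hd t ht.1).snd
    have h1 := ((hcurve t).hasDerivWithinAt (s := Ici 0)).inner ℝ hv1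
    have h2 : HasDerivWithinAt (fun t => ζ t ⬝ᵥ WithLp.ofLp (v t).2)
        (∑ i, (deriv ζ t i * (v t).2 i + ζ t i * (v' t).2 i)) (Ici 0) t := by
      simp only [dotProduct]
      refine HasDerivWithinAt.fun_sum fun i _ => ?_
      have h3 : HasDerivAt (fun t => ζ t i) (deriv ζ t i) t :=
        hasDerivAt_pi.1 ((hζ.differentiable one_ne_zero) t).hasDerivAt i
      have h4 : HasDerivWithinAt (fun t => (v t).2 i) ((v' t).2 i) (Ici 0) t :=
        (EuclideanSpace.proj i : EuclideanSpace ℝ (Fin m) →L[ℝ] ℝ).hasFDerivAt.comp_hasDerivWithinAt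
          t hv2
      exact h3.hasDerivWithinAt.mul h4
    refine (h1.add h2).congr_deriv ?_
    have hgreen := (hg t ht.1).isGenAux.green (η := ψ t) (η' := deriv (ψ t))
      (πL := curveL2 (continuous_restrict hψ) t)
      (aL := curveL2 (continuous_adjExpr (S := S) hψ) t) (ζ := ζ t)
      (fun s => (hasDerivAt_right hψ t s).differentiableAt.hasDerivAt)
      ((continuous_deriv_right hψ).comp (by fun_prop : Continuous fun s : ℝ => (t, s)))
      (curveL2_ae _ t) (curveL2_ae _ t) (htest.adjoint_boundary t ht)
    rw [Finset.sum_add_distrib]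
    have h5 : ∑ i, ζ t i * (v' t).2 i = ζ t ⬝ᵥ WithLp.ofLp (v' t).2 := rfl
    have h6 : ∑ i, deriv ζ t i * (v t).2 i = deriv ζ t ⬝ᵥ WithLp.ofLp (v t).2 := rfl
    rw [h5, h6, bdryTerm]
    linarith
  have hint := intervalIntegral.integral_eq_sub_of_hasDeriv_right (a := 0) (b := T) (f := E)
    (fun t ht => by
      rw [uIcc_of_le hT.le] at ht ⊢
      exact ((hEd t ht).continuousWithinAt).mono Icc_subset_Ici_self)
    (fun t ht => by
      rw [min_eq_left hT.le, max_eq_right hT.le] at ht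
      exact (hEd t ⟨ht.1.le, ht.2.le⟩).mono (Ioi_subset_Ici ht.1.le))
    ((((intervalIntegrable_inner_curve hvc hT.le _).add
      (intervalIntegrable_inner_curve hvc hT.le _)).add
      (intervalIntegrable_deriv_dotProduct hvc hζ hT.le)).add
      (intervalIntegrable_bdryTerm hvc hψ hζ hT.le))
  have hET : E T = 0 := by
    have h1 : curveL2 (continuous_restrict hψ) T = 0 := by
      refine Lp.ext ?_
      filter_upwards [curveL2_ae (continuous_restrict hψ) T, ae_restrict_mem measurableSet_Ioo,
        Lp.coeFn_zero (EuclideanSpace ℝ (Idx p q)) 2 (volume.restrict (Ioo (0 : ℝ) 1))]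
        with s h1 hs h2
      rw [h2]
      refine WithLp.ofLp_injective 2 ?_
      rw [h1, htest.psi_end s (Ioo_subset_Icc_self hs)]
      rfl
    simp [hE, h1, htest.zeta_end]
  rw [weakForm, hint, hET]
  simp only [hE, h0]
  ring

end HypSystem

namespace HypSystem

variable {S : HypSystem p q m} {ki : ℝ} {Ki : Matrix (Fin m) (Fin m) ℝ} {wb : Idx p q → ℝ}
  {w wy yref : EuclideanSpace ℝ (Fin m)} {v y v₀ : State p q m}
  {T : ℝ} {ψ : ℝ → ℝ → Idx p q → ℝ} {ζ : ℝ → Fin m → ℝ}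
  {C ρ : ℝ} {R : State p q m →L[ℝ] State p q m} {sg : ℝ → State p q m → State p q m}

/-! ### Existence of weak solutions -/

theorem IsClosedLoopSemigroup.continuous_prod (h : S.IsClosedLoopSemigroup ki Ki C ρ R sg)
    (hC : 0 < C) (hρ : 0 < ρ) :
    Continuous fun x : ℝ × State p q m => sg (max x.1 0) x.2 := by
  refine continuous_prod_of_continuous_lipschitzWith' _ C.toNNReal (fun t => ?_) fun x => ?_
  · refine LipschitzWith.of_dist_le_mul fun x x' => ?_
    rw [dist_eq_norm, dist_eq_norm, Real.coe_toNNReal _ hC.le,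
      ← h.sub _ (le_max_right t 0)]
    refine (h.norm_le _ (le_max_right t 0) _).trans ?_
    refine mul_le_mul_of_nonneg_right ?_ (norm_nonneg _)
    refine mul_le_of_le_one_right hC.le (Real.exp_le_one_iff.2 ?_)
    nlinarith [le_max_right t 0]
  · exact (h.continuousOn x).comp_continuous (by fun_prop) fun t => le_max_right t 0

/-- For fixed test functions, continuity in the initial value lets the weak identity pass from the
dense range of R to every state. -/
theorem IsClosedLoopSemigroup.continuous_weakForm (h : S.IsClosedLoopSemigroup ki Ki C ρ R sg)
    (hC : 0 < C) (hρ : 0 < ρ) (hψ : ContDiff ℝ 1 fun x : ℝ × ℝ => ψ x.1 x.2)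
    (hζ : ContDiff ℝ 1 ζ) (hT : 0 ≤ T) :
    Continuous fun x => S.weakForm ki Ki wb w T ψ ζ hψ (fun t => sg t x) x := by
  have hsg : Continuous fun x : State p q m × ℝ => sg (max x.2 0) x.1 :=
    (h.continuous_prod hC hρ).comp continuous_swap
  have h3 : ∀ s, Continuous fun x : State p q m × ℝ => ψ x.2 s := fun s =>
    hψ.continuous.comp (by fun_prop : Continuous fun x : State p q m × ℝ => (x.2, s))
  have hdot : ∀ {X : Type} [TopologicalSpace X] {a b : X → Fin m → ℝ}, Continuous a →
      Continuous b → Continuous fun x => a x ⬝ᵥ b x := fun ha hb => ha.dotProduct hb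
  have hof : Continuous fun z : EuclideanSpace ℝ (Fin m) => WithLp.ofLp z :=
    PiLp.continuous_ofLp 2 _
  let F : State p q m → ℝ → ℝ := fun x t =>
    inner ℝ (curveL2 (continuous_deriv_restrict hψ) t) (sg (max t 0) x).1
      + inner ℝ (curveL2 (continuous_adjExpr (S := S) hψ) t) (sg (max t 0) x).1
      + deriv ζ t ⬝ᵥ WithLp.ofLp (sg (max t 0) x).2
      + S.bdryTerm w (ψ t 0) (ψ t 1) (ζ t) (S.B *ᵥ control ki Ki (sg (max t 0) x).2 + wb)
  have hcont : Continuous (Function.uncurry F) := by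
    refine ((Continuous.add ?_ ?_).add ?_).add ?_
    · exact ((continuous_curveL2 _).comp continuous_snd).inner (continuous_fst.comp hsg)
    · exact ((continuous_curveL2 _).comp continuous_snd).inner (continuous_fst.comp hsg)
    · exact hdot ((hζ.continuous_deriv le_rfl).comp continuous_snd)
        (hof.comp (continuous_snd.comp hsg))
    · exact (continuous_bdryTerm (S := S) (w := w)).comp ((h3 0).prodMk ((h3 1).prodMk
        ((hζ.continuous.comp continuous_snd).prodMk (continuous_boundaryInput.comp hsg))))
  have hint := intervalIntegral.continuous_parametric_intervalIntegral_of_continuous' (μ := volume)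
    (f := F) hcont 0 T
  have h4 : Continuous fun x : State p q m => inner ℝ (curveL2 (continuous_restrict hψ) 0) x.1 :=
    continuous_const.inner continuous_fst
  have h5 : Continuous fun x : State p q m => ζ 0 ⬝ᵥ WithLp.ofLp x.2 :=
    hdot continuous_const (hof.comp continuous_snd)
  refine ((hint.add h4).add h5).congr fun x => ?_
  rw [weakForm, Pi.add_apply, Pi.add_apply]
  congr 2
  refine intervalIntegral.integral_congr (f := F x) fun t ht => ?_
  rw [uIcc_of_le hT] at ht
  simp only [F, max_eq_left ht.1]

/-- The orbits of the semigroup are weak solutions of the homogeneous closed loop. -/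
theorem IsClosedLoopSemigroup.isWeakSolution (h : S.IsClosedLoopSemigroup ki Ki C ρ R sg)
    (hC : 0 < C) (hρ : 0 < ρ) (x : State p q m) :
    S.IsWeakSolution ki Ki 0 0 0 x fun t => sg t x := by
  rw [isWeakSolution_iff]
  refine ⟨h.zero x, h.continuousOn x, fun T hT ψ ζ htest => ?_⟩
  have hc := h.continuous_weakForm (wb := 0) (w := 0 - 0) hC hρ htest.contDiff_psi
    htest.contDiff_zeta hT.le
  refine congrFun (h.denseRange.equalizer hc continuous_const (funext fun z => ?_)) x
  exact (isWeakSolution_iff.1 (isWeakSolution_of_isGen (h.zero (R z)) (h.hasDerivWithinAt z)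
    fun t ht => by
      rw [sub_zero, h.isGen_iff, h.comm t ht])).2.2 T hT ψ ζ htest

/-! ### Uniqueness of weak solutions -/

theorem plusPart_dotProduct_minusPart (a b : Idx p q → ℝ) : plusPart a ⬝ᵥ minusPart b = 0 := by
  simp [dotProduct, Fintype.sum_sum_type]

theorem minusPart_dotProduct_plusPart (a b : Idx p q → ℝ) : minusPart a ⬝ᵥ plusPart b = 0 := by
  simp [dotProduct, Fintype.sum_sum_type]

theorem plusPart_dotProduct_plusPart (a b : Idx p q → ℝ) :
    plusPart a ⬝ᵥ plusPart b = plusPart a ⬝ᵥ b := by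
  simp [dotProduct, Fintype.sum_sum_type]

theorem minusPart_dotProduct_minusPart (a b : Idx p q → ℝ) :
    minusPart a ⬝ᵥ minusPart b = minusPart a ⬝ᵥ b := by
  simp [dotProduct, Fintype.sum_sum_type]

/-- The boundary values that the adjoint boundary condition leaves free. -/
theorem adjoint_boundary_of (d : Idx p q → ℝ) (e : Fin m → ℝ) (r : Idx p q → ℝ)
    (hr : r = (S.L1 * S.K + S.L2)ᵀ *ᵥ e + S.Kᵀ *ᵥ d) :
    S.Kplusᵀ *ᵥ (plusPart r - minusPart d) - S.Kminusᵀ *ᵥ (plusPart d - minusPart r)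
      = (S.L1 * S.K + S.L2)ᵀ *ᵥ e := by
  have hT : ∀ (K : Matrix (Idx p q) (Idx p q) ℝ) (r x : Idx p q → ℝ),
      (Kᵀ *ᵥ r) ⬝ᵥ x = r ⬝ᵥ (K *ᵥ x) := fun K r x => by
    rw [Matrix.dotProduct_mulVec, Matrix.mulVec_transpose]
  refine dotProduct_eq _ _ fun x => ?_
  rw [eq_sub_of_add_eq hr.symm]
  simp only [sub_dotProduct, hT, Kplus_mulVec, Kminus_mulVec, dotProduct_add,
    plusPart_dotProduct_minusPart, minusPart_dotProduct_plusPart, plusPart_dotProduct_plusPart,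
    minusPart_dotProduct_minusPart]
  nth_rewrite 3 [← plusPart_add_minusPart r]
  nth_rewrite 3 [← plusPart_add_minusPart d]
  simp only [add_dotProduct]
  ring

/-- The coefficient is C¹ and nonzero only on [0,1]; the support of θ keeps the quotient zero near
every other point. -/
theorem contDiff_testFunction_div {θ lam : ℝ → ℝ} (hθ : ContDiff ℝ ∞ θ)
    (hsupp : tsupport θ ⊆ Ioo (0 : ℝ) 1) (hlam : ContDiffOn ℝ 1 lam (Icc 0 1))
    (h0 : ∀ s ∈ Icc (0 : ℝ) 1, lam s ≠ 0) : ContDiff ℝ 1 fun s => θ s / lam s := by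
  rw [contDiff_iff_contDiffAt]
  intro s
  by_cases hs : s ∈ tsupport θ
  · have hs' := hsupp hs
    exact ((hθ.of_le (by exact_mod_cast le_top)).contDiffAt).div
      (hlam.contDiffAt (Icc_mem_nhds hs'.1 hs'.2)) (h0 s (Ioo_subset_Icc_self hs'))
  · refine (contDiffAt_const (c := (0 : ℝ))).congr_of_eventuallyEq ?_
    filter_upwards [(isClosed_tsupport θ).isOpen_compl.mem_nhds hs] with r hr
    rw [image_eq_zero_of_notMem_tsupport hr, zero_div]

theorem hasDerivAt_single {i : Idx p q} {χ : ℝ → ℝ} {s c : ℝ} (h : HasDerivAt χ c s) :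
    HasDerivAt (fun s => (Pi.single i (χ s) : Idx p q → ℝ)) (Pi.single i c) s := by
  refine hasDerivAt_pi.2 fun j => ?_
  by_cases hj : j = i
  · subst hj; simpa using h
  · simpa [hj] using hasDerivAt_const s (0 : ℝ)

theorem contDiff_single {i : Idx p q} {χ : ℝ → ℝ} (h : ContDiff ℝ 1 χ) :
    ContDiff ℝ 1 fun s => (Pi.single i (χ s) : Idx p q → ℝ) := by
  refine contDiff_pi.2 fun j => ?_
  by_cases hj : j = i
  · subst hj; simpa using h
  · simpa [hj] using contDiff_const

theorem exists_adjoint_L2 {η : ℝ → Idx p q → ℝ} (hη : ContDiff ℝ 1 η) :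
    ∃ πL aL : HypReg.L2 p q,
      (∀ᵐ s ∂(volume.restrict (Ioo (0 : ℝ) 1)), WithLp.ofLp (πL s) = η s) ∧
      ∀ᵐ s ∂(volume.restrict (Ioo (0 : ℝ) 1)), WithLp.ofLp (aL s)
        = S.Lam0 s *ᵥ deriv η s + S.Lam0' s *ᵥ η s - (S.Lam1 s)ᵀ *ᵥ η s := by
  have hψ : ContDiff ℝ 1 fun x : ℝ × ℝ => (fun _ : ℝ => η) x.1 x.2 := hη.comp contDiff_snd
  have h1 := continuous_restrict (ψ := fun _ : ℝ => η) hψ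
  have h2 := continuous_adjExpr (S := S) (ψ := fun _ : ℝ => η) hψ
  exact ⟨_, _, curveL2_ae (D := fun _ : ℝ => η) h1 0,
    curveL2_ae (D := S.adjExpr fun _ : ℝ => η) h2 0⟩

/-- Test with η = (θ/λᵢ)eᵢ, for which Λ₀η = θeᵢ: the tested identity becomes the definition of the
weak derivative of the i-th component. -/
theorem hasWeakDeriv_of_adjoint {u y : HypReg.L2 p q}
    (h : ∀ (η : ℝ → Idx p q → ℝ) (πL aL : HypReg.L2 p q), ContDiff ℝ 1 η → η 0 = 0 → η 1 = 0 →
      (∀ᵐ s ∂(volume.restrict (Ioo (0 : ℝ) 1)), WithLp.ofLp (πL s) = η s) →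
      (∀ᵐ s ∂(volume.restrict (Ioo (0 : ℝ) 1)), WithLp.ofLp (aL s)
        = S.Lam0 s *ᵥ deriv η s + S.Lam0' s *ᵥ η s - (S.Lam1 s)ᵀ *ᵥ η s) →
      (inner ℝ πL y : ℝ) = inner ℝ aL u) :
    HasWeakDeriv u (statDeriv S u y) := by
  intro θ hθ _ hsupp i
  obtain ⟨χ, hχdef⟩ : ∃ χ : ℝ → ℝ, χ = fun s => θ s / S.lam s i := ⟨_, rfl⟩
  have hχ : ContDiff ℝ 1 χ := hχdef ▸ contDiff_testFunction_div hθ hsupp (S.lam_contDiffOn i)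
    fun s hs => S.lam_ne_zero hs i
  have hχd : ∀ s, HasDerivAt χ (deriv χ s) s := fun s =>
    (hχ.differentiable one_ne_zero s).hasDerivAt
  have hχ0 : ∀ s, s ∉ Ioo (0 : ℝ) 1 → χ s = 0 := fun s hs => by
    rw [hχdef]
    simp [image_eq_zero_of_notMem_tsupport fun h => hs (hsupp h)]
  have hχθ : ∀ s ∈ Icc (0 : ℝ) 1, S.lam s i * χ s = θ s := fun s hs => by
    rw [hχdef]
    exact mul_div_cancel₀ _ (S.lam_ne_zero hs i)
  have hθd : ∀ s ∈ Ioo (0 : ℝ) 1, deriv θ s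
      = derivWithin (fun σ => S.lam σ i) (Icc 0 1) s * χ s + S.lam s i * deriv χ s :=
    fun s hs => by
      have hl : HasDerivAt (fun σ => S.lam σ i) (derivWithin (fun σ => S.lam σ i) (Icc 0 1) s) s :=
        (((S.lam_contDiffOn i).differentiableOn one_ne_zero s
          (Ioo_subset_Icc_self hs)).hasDerivWithinAt).hasDerivAt (Icc_mem_nhds hs.1 hs.2)
      refine ((hl.mul (hχd s)).congr_of_eventuallyEq ?_).deriv
      filter_upwards [Icc_mem_nhds hs.1 hs.2] with r hr
      exact (hχθ r hr).symm
  obtain ⟨η, hη⟩ : ∃ η : ℝ → Idx p q → ℝ, η = fun s => Pi.single i (χ s) := ⟨_, rfl⟩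
  have hηc : ContDiff ℝ 1 η := hη ▸ contDiff_single hχ
  have hηs : ∀ s, η s = Pi.single i (χ s) := fun s => by rw [hη]
  have hηd : ∀ s, deriv η s = Pi.single i (deriv χ s) := fun s => by
    rw [hη]; exact (hasDerivAt_single (hχd s)).deriv
  obtain ⟨πL, aL, hπL, haL⟩ := exists_adjoint_L2 (S := S) hηc
  have h1 := h η πL aL hηc (by rw [hηs, hχ0 0 (by simp), Pi.single_zero])
    (by rw [hηs, hχ0 1 (by simp), Pi.single_zero]) hπL haL
  have hA : ∫ s in Ioo (0 : ℝ) 1, deriv θ s * u s i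
      = inner ℝ aL u + inner ℝ πL (mulL2 S.Lam1_matContinuousOn u) := by
    rw [inner_L2_eq, inner_L2_eq, ← integral_add (integrable_dotProduct _ _)
      (integrable_dotProduct _ _)]
    refine integral_congr_ae ?_
    filter_upwards [hπL, haL, mulL2_ae S.Lam1_matContinuousOn u,
      ae_restrict_mem measurableSet_Ioo] with s h2 h3 h4 hs
    rw [h2, h3, h4, Matrix.dotProduct_mulVec, ← add_dotProduct, ← Matrix.mulVec_transpose,
      sub_add_cancel, hηs, hηd, Lam0, Lam0', Matrix.diagonal_mulVec_single,
      Matrix.diagonal_mulVec_single, ← Pi.single_add, single_dotProduct, hθd s hs]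
    ring
  have hB : ∫ s in Ioo (0 : ℝ) 1, θ s * statDeriv S u y s i
      = -(inner ℝ πL (mulL2 S.Lam1_matContinuousOn u) + inner ℝ πL y) := by
    rw [inner_L2_eq, inner_L2_eq, ← integral_add (integrable_dotProduct _ _)
      (integrable_dotProduct _ _), ← integral_neg]
    refine integral_congr_ae ?_
    filter_upwards [hπL, statDeriv_ae (S := S) u y, mulL2_ae S.Lam1_matContinuousOn u,
      ae_restrict_mem measurableSet_Ioo] with s h2 h3 h4 hs
    have hl := S.lam_ne_zero (Ioo_subset_Icc_self hs) i
    have h5 : statDeriv S u y s i = -((S.lam s i)⁻¹ *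
        (S.Lam1 s *ᵥ WithLp.ofLp (u s) + WithLp.ofLp (y s)) i) := by
      rw [h3, Laminv, Pi.neg_apply, Matrix.mulVec_diagonal]
    rw [h2, h4, ← dotProduct_add, h5, hηs, single_dotProduct,
      ← hχθ s (Ioo_subset_Icc_self hs)]
    field_simp
  rw [hA, hB, h1]
  ring

/-- A pair that satisfies the tested identity belongs to the graph of the generator. -/
theorem isGen_of_adjoint
    (h : ∀ (η : ℝ → Idx p q → ℝ) (ζ : Fin m → ℝ) (πL aL : HypReg.L2 p q), ContDiff ℝ 1 η →
      S.Kplusᵀ *ᵥ (S.Lam0 1 *ᵥ η 1) - S.Kminusᵀ *ᵥ (S.Lam0 0 *ᵥ η 0)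
        = (S.L1 * S.K + S.L2)ᵀ *ᵥ ζ →
      (∀ᵐ s ∂(volume.restrict (Ioo (0 : ℝ) 1)), WithLp.ofLp (πL s) = η s) →
      (∀ᵐ s ∂(volume.restrict (Ioo (0 : ℝ) 1)), WithLp.ofLp (aL s)
        = S.Lam0 s *ᵥ deriv η s + S.Lam0' s *ᵥ η s - (S.Lam1 s)ᵀ *ᵥ η s) →
      inner ℝ πL y.1 + ζ ⬝ᵥ WithLp.ofLp y.2
        = inner ℝ aL v.1 + S.bdryTerm 0 (η 0) (η 1) ζ (S.B *ᵥ control ki Ki v.2)) :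
    S.IsGen ki Ki 0 0 v y := by
  have hrep : IsH1Rep v.1 (statDeriv S v.1 y.1) (contRep v.1) := by
    refine (hasWeakDeriv_of_adjoint fun η πL aL hη h0 h1 hπL haL => ?_).isH1Rep
    have h2 := h η 0 πL aL hη (by simp [h0, h1]) hπL haL
    simpa [h0, h1, bdryTerm] using h2
  have hpde := statDeriv_pde (S := S) v.1 y.1
  obtain ⟨f, hf⟩ : ∃ f, f = contRep v.1 := ⟨_, rfl⟩
  rw [← hf] at hrep
  obtain ⟨b, hb⟩ : ∃ b, b = S.B *ᵥ control ki Ki v.2 := ⟨_, rfl⟩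
  rw [← hb] at h
  obtain ⟨x, hx⟩ : ∃ x, x = traceOut f := ⟨_, rfl⟩
  -- The residuals: d of the boundary condition and, once d = 0, e of the integrator equation. They
  -- are used to build a test pair that yields |e|² + |d|² = 0.
  obtain ⟨d, hd⟩ : ∃ d, d = traceIn f - S.K *ᵥ x - b := ⟨_, rfl⟩
  obtain ⟨e, he⟩ : ∃ e, e = WithLp.ofLp y.2 - S.L1 *ᵥ b - (S.L1 * S.K + S.L2) *ᵥ x := ⟨_, rfl⟩
  obtain ⟨r, hr⟩ : ∃ r, r = (S.L1 * S.K + S.L2)ᵀ *ᵥ e + S.Kᵀ *ᵥ d := ⟨_, rfl⟩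
  have hadj := adjoint_boundary_of d e r hr
  have m0 : (0 : ℝ) ∈ Icc (0 : ℝ) 1 := ⟨le_rfl, zero_le_one⟩
  have m1 : (1 : ℝ) ∈ Icc (0 : ℝ) 1 := ⟨zero_le_one, le_rfl⟩
  obtain ⟨α₀, hα₀⟩ : ∃ α, α = plusPart d - minusPart r := ⟨_, rfl⟩
  obtain ⟨α₁, hα₁⟩ : ∃ α, α = plusPart r - minusPart d := ⟨_, rfl⟩
  rw [← hα₀, ← hα₁] at hadj
  obtain ⟨a₀, ha₀⟩ : ∃ a, S.Lam0 0 *ᵥ a = α₀ := ⟨S.Laminv 0 *ᵥ α₀, by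
    rw [Matrix.mulVec_mulVec, S.Lam0_mul_Laminv m0, Matrix.one_mulVec]⟩
  obtain ⟨a₁, ha₁⟩ : ∃ a, S.Lam0 1 *ᵥ a = α₁ := ⟨S.Laminv 1 *ᵥ α₁, by
    rw [Matrix.mulVec_mulVec, S.Lam0_mul_Laminv m1, Matrix.one_mulVec]⟩
  have hT : ∀ {ι κ : Type} [Fintype ι] [Fintype κ] (K : Matrix ι κ ℝ) (r : ι → ℝ) (x : κ → ℝ),
      (Kᵀ *ᵥ r) ⬝ᵥ x = r ⬝ᵥ (K *ᵥ x) := fun K r x => by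
    rw [Matrix.dotProduct_mulVec, Matrix.mulVec_transpose]
  have hsym : ∀ s (a c : Idx p q → ℝ), a ⬝ᵥ (S.Lam0 s *ᵥ c) = (S.Lam0 s *ᵥ a) ⬝ᵥ c :=
    fun s a c => by
      simp only [Lam0, Matrix.mulVec_diagonal, dotProduct]
      exact Finset.sum_congr rfl fun i _ => by ring
  -- Only the end values matter, since Green's formula removes the interior terms; an affine η
  -- attains both.
  obtain ⟨η, hη⟩ : ∃ η : ℝ → Idx p q → ℝ, η = fun s => a₀ + s • (a₁ - a₀) := ⟨_, rfl⟩
  have hη0 : η 0 = a₀ := by simp [hη]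
  have hη1 : η 1 = a₁ := by simp [hη]
  have hηc : ContDiff ℝ 1 η := by
    rw [hη]
    exact contDiff_const.add (contDiff_id.smul contDiff_const)
  obtain ⟨πL, aL, hπL, haL⟩ := exists_adjoint_L2 (S := S) hηc
  have h1 := h η e πL aL hηc (by rw [hη0, hη1, ha₀, ha₁, hadj]) hπL haL
  have h2 := HypSystem.green hrep hpde (η := η) (η' := deriv η)
    (fun s => (hηc.differentiable one_ne_zero s).hasDerivAt) (hηc.continuous_deriv le_rfl) hπL haL
  have hx2 := congrArg (fun r => r ⬝ᵥ x) hadj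
  simp only [sub_dotProduct, hT, Kplus_mulVec, Kminus_mulVec] at hx2
  rw [bdryTerm, hη0, hη1, hsym, hsym, ha₀, ha₁] at h1
  rw [hη0, hη1, hsym, hsym, ha₀, ha₁] at h2
  have hf0 : f 0 = plusPart d + plusPart (S.K *ᵥ x) + plusPart b + minusPart x := by
    rw [hd, traceIn_eq]
    ext (i | j) <;> (simp [hx, traceOut]; try ring)
  have hf1 : f 1 = minusPart d + minusPart (S.K *ᵥ x) + minusPart b + plusPart x := by
    rw [hd, traceIn_eq]
    ext (i | j) <;> (simp [hx, traceOut]; try ring)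
  have hy2 : WithLp.ofLp y.2 = e + S.L1 *ᵥ b + (S.L1 * S.K + S.L2) *ᵥ x := by
    rw [he]; abel
  rw [hy2] at h1
  rw [hf0, hf1] at h2
  simp only [dotProduct_add, WithLp.ofLp_zero, dotProduct_zero] at h1 h2 hx2
  have h3 : e ⬝ᵥ e + α₀ ⬝ᵥ plusPart d - α₁ ⬝ᵥ minusPart d = 0 := by linarith
  have h4 : e ⬝ᵥ e + plusPart d ⬝ᵥ plusPart d + minusPart d ⬝ᵥ minusPart d = 0 := by
    rw [hα₀, hα₁, sub_dotProduct, sub_dotProduct, minusPart_dotProduct_plusPart,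
      plusPart_dotProduct_minusPart] at h3
    linarith
  have hnn : ∀ {ι : Type} [Fintype ι] (a : ι → ℝ), 0 ≤ a ⬝ᵥ a := fun a =>
    Finset.sum_nonneg fun i _ => mul_self_nonneg (a i)
  have he0 : e = 0 := dotProduct_self_eq_zero.1 (by
    linarith [hnn e, hnn (plusPart d), hnn (minusPart d)])
  have hd0 : d = 0 := by
    rw [← plusPart_add_minusPart d, (dotProduct_self_eq_zero (v := plusPart d)).1 (by
      linarith [hnn e, hnn (plusPart d), hnn (minusPart d)]),
      (dotProduct_self_eq_zero (v := minusPart d)).1 (by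
      linarith [hnn e, hnn (plusPart d), hnn (minusPart d)]), add_zero]
  have hbd : traceIn f = S.K *ᵥ x + b := by
    rw [hd0] at hd
    rw [← sub_eq_zero, ← sub_sub, ← hd]
  refine ⟨_, f, hrep, hpde, ?_, ?_⟩
  · rw [hbd, hx, hb, add_zero]
  · refine WithLp.ofLp_injective 2 ?_
    rw [hy2, he0, hbd, ← hx, add_zero, WithLp.ofLp_toLp]
    simp only [Matrix.mulVec_add, Matrix.add_mulVec, Matrix.mulVec_mulVec]
    abel

/-- The weak formulation tested with `((T - t) η(s), (T - t) ζ)`. -/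
theorem IsWeakSolution.integral_identity {v : ℝ → State p q m}
    (hv : S.IsWeakSolution ki Ki 0 0 0 0 v) (hT : 0 < T)
    {η : ℝ → Idx p q → ℝ} {ζ : Fin m → ℝ} {πL aL : HypReg.L2 p q} (hη : ContDiff ℝ 1 η)
    (hadj : S.Kplusᵀ *ᵥ (S.Lam0 1 *ᵥ η 1) - S.Kminusᵀ *ᵥ (S.Lam0 0 *ᵥ η 0)
      = (S.L1 * S.K + S.L2)ᵀ *ᵥ ζ)
    (hπL : ∀ᵐ s ∂(volume.restrict (Ioo (0 : ℝ) 1)), WithLp.ofLp (πL s) = η s)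
    (haL : ∀ᵐ s ∂(volume.restrict (Ioo (0 : ℝ) 1)), WithLp.ofLp (aL s)
      = S.Lam0 s *ᵥ deriv η s + S.Lam0' s *ᵥ η s - (S.Lam1 s)ᵀ *ᵥ η s) :
    ∫ t in (0 : ℝ)..T, (-(inner ℝ πL (v t).1 + ζ ⬝ᵥ WithLp.ofLp (v t).2)
      + (inner ℝ aL ((T - t) • v t).1 + S.bdryTerm 0 (η 0) (η 1) ζ
        (S.B *ᵥ control ki Ki ((T - t) • v t).2))) = 0 := by
  obtain ⟨ψ, hψdef⟩ : ∃ ψ : ℝ → ℝ → Idx p q → ℝ, ψ = fun t s => (T - t) • η s := ⟨_, rfl⟩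
  obtain ⟨Z, hZdef⟩ : ∃ Z : ℝ → Fin m → ℝ, Z = fun t => (T - t) • ζ := ⟨_, rfl⟩
  have hψs : ∀ t s, ψ t s = (T - t) • η s := fun t s => by rw [hψdef]
  have hZs : ∀ t, Z t = (T - t) • ζ := fun t => by rw [hZdef]
  have hlin : ∀ t, HasDerivAt (fun t : ℝ => T - t) (-1) t := fun t => by
    simpa using (hasDerivAt_id t).const_sub T
  have htest : S.IsTestPair T ψ Z := by
    refine ⟨?_, ?_, fun s _ => by simp [hψs], by simp [hZs], fun t _ => ?_⟩
    · simp only [hψs]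
      exact (contDiff_const.sub contDiff_fst).smul (hη.comp contDiff_snd)
    · rw [hZdef]
      exact (contDiff_const.sub contDiff_id).smul contDiff_const
    · simp only [hψs, hZs, Matrix.mulVec_smul, ← smul_sub, hadj]
  have h1 := (isWeakSolution_iff.1 hv).2.2 T hT ψ Z htest
  rw [weakForm] at h1
  simp only [Prod.fst_zero, Prod.snd_zero, inner_zero_right, WithLp.ofLp_zero, dotProduct_zero,
    add_zero, sub_zero] at h1
  refine Eq.trans (intervalIntegral.integral_congr fun t _ => ?_) h1
  beta_reduce
  have e1 : curveL2 (continuous_deriv_restrict htest.contDiff_psi) t = -πL := by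
    refine Lp.ext ?_
    filter_upwards [curveL2_ae (continuous_deriv_restrict htest.contDiff_psi) t, hπL,
      Lp.coeFn_neg πL] with s h2 h3 h4
    refine WithLp.ofLp_injective 2 ?_
    rw [h2, h4, Pi.neg_apply, WithLp.ofLp_neg, h3, timeDeriv, hψdef]
    have := ((hlin t).smul_const (η s)).deriv
    rw [this, neg_one_smul]
  have e2 : curveL2 (continuous_adjExpr (S := S) htest.contDiff_psi) t = (T - t) • aL := by
    refine Lp.ext ?_
    filter_upwards [curveL2_ae (continuous_adjExpr (S := S) htest.contDiff_psi) t, haL,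
      Lp.coeFn_smul (T - t) aL] with s h2 h3 h4
    refine WithLp.ofLp_injective 2 ?_
    rw [h2, h4, Pi.smul_apply, WithLp.ofLp_smul, h3, adjExpr, hψdef]
    have : deriv (fun s => (T - t) • η s) s = (T - t) • deriv η s :=
      ((hη.differentiable one_ne_zero s).hasDerivAt.const_smul (T - t)).deriv
    simp only [this, Matrix.mulVec_smul, smul_sub, smul_add]
  have e3 : deriv Z t = -ζ := by
    rw [hZdef, ((hlin t).smul_const ζ).deriv, neg_one_smul]
  have e4 : control ki Ki ((T - t) • v t).2 = (T - t) • control ki Ki (v t).2 := by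
    simp only [control, Prod.smul_snd, WithLp.ofLp_smul, Matrix.mulVec_smul]
    rw [smul_comm]
  rw [e1, e2, e3, e4, hψs, hψs, hZs]
  simp only [bdryTerm, inner_neg_left, neg_dotProduct, Prod.smul_fst, inner_smul_right,
    inner_smul_left, Matrix.mulVec_smul, plusPart_smul, minusPart_smul, smul_dotProduct,
    dotProduct_smul, smul_eq_mul, RCLike.conj_to_real, WithLp.ofLp_zero, add_zero]
  ring

/-- With W = ∫v and U = ∫W, test functions of time profile T - t say that (U(T), W(T)) satisfies the
adjoint identity, so U = RW. As U' = W and U(0) = 0, energy decay gives U = 0; differentiating twice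
gives v = 0. -/
theorem IsClosedLoopSemigroup.eq_zero_of_isWeakSolution
    (h : S.IsClosedLoopSemigroup ki Ki C ρ R sg) {v : ℝ → State p q m}
    (hv : S.IsWeakSolution ki Ki 0 0 0 0 v) {t : ℝ} (ht : 0 ≤ t) : v t = 0 := by
  obtain ⟨u, hudef⟩ : ∃ u : ℝ → State p q m, u = fun t => v (max t 0) := ⟨_, rfl⟩
  have huc : Continuous u := hudef ▸
    hv.continuousOn.comp_continuous (by fun_prop) fun t => le_max_right t 0
  have huv : ∀ t, 0 ≤ t → u t = v t := fun t ht => by rw [hudef]; simp only [max_eq_left ht]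
  obtain ⟨W, hWdef⟩ : ∃ W : ℝ → State p q m, W = fun T => ∫ t in (0 : ℝ)..T, u t := ⟨_, rfl⟩
  have hWd : ∀ T, HasDerivAt W (u T) T := fun T => hWdef ▸
    (huc.integral_hasStrictDerivAt 0 T).hasDerivAt
  have hWc : Continuous W := continuous_iff_continuousAt.2 fun T => (hWd T).continuousAt
  have hW0 : W 0 = 0 := by simp [hWdef]
  obtain ⟨U, hUdef⟩ : ∃ U : ℝ → State p q m, U = fun T => ∫ t in (0 : ℝ)..T, W t := ⟨_, rfl⟩
  have hUd : ∀ T, HasDerivAt U (W T) T := fun T => hUdef ▸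
    (hWc.integral_hasStrictDerivAt 0 T).hasDerivAt
  have hU0 : U 0 = 0 := by simp [hUdef]
  -- Integration by parts; (T - t)W(t) vanishes at both ends because W(0) = 0.
  have hparts : ∀ T, ∫ t in (0 : ℝ)..T, (T - t) • u t = U T := fun T => by
    have hd : ∀ t, HasDerivAt (fun t => (T - t) • W t) ((T - t) • u t + (-1 : ℝ) • W t) t :=
      fun t => ((hasDerivAt_id t).const_sub T).smul (hWd t)
    have hc : Continuous fun t => (T - t) • u t := (continuous_const.sub continuous_id).smul huc
    have h1 := intervalIntegral.integral_eq_sub_of_hasDerivAt (a := 0) (b := T)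
      (fun t _ => hd t) ((hc.add (hWc.const_smul (-1 : ℝ))).intervalIntegrable 0 T)
    have hc' : Continuous fun t => (-1 : ℝ) • W t := hWc.const_smul (-1 : ℝ)
    rw [intervalIntegral.integral_add (hc.intervalIntegrable 0 T)
      (hc'.intervalIntegrable 0 T), intervalIntegral.integral_smul] at h1
    simp only [sub_self, zero_smul, hW0, smul_zero, neg_smul, one_smul] at h1
    rw [hUdef]
    exact add_neg_eq_zero.1 h1
  have hgen : ∀ T, 0 ≤ T → U T = R (W T) := fun T hT => by
    rcases hT.eq_or_lt with rfl | hT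
    · rw [hU0, hW0, map_zero]
    rw [← h.isGen_iff]
    refine isGen_of_adjoint fun η ζ πL aL hη hadj hπL haL => ?_
    have h1 := hv.integral_identity hT hη hadj hπL haL
    obtain ⟨β, hβ⟩ : ∃ β : EuclideanSpace ℝ (Fin m) →L[ℝ] ℝ, ∀ z,
        β z = S.bdryTerm 0 (η 0) (η 1) ζ (S.B *ᵥ control ki Ki z) :=
      ⟨LinearMap.toContinuousLinearMap
        { toFun := fun z => S.bdryTerm 0 (η 0) (η 1) ζ (S.B *ᵥ control ki Ki z)
          map_add' := fun z z' => by
            simp only [bdryTerm, control, WithLp.ofLp_add, Matrix.mulVec_add, smul_add,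
              plusPart_add, minusPart_add, dotProduct_add, WithLp.ofLp_zero, add_zero]
            ring
          map_smul' := fun c z => by
            simp only [bdryTerm, control, WithLp.ofLp_smul, Matrix.mulVec_smul, smul_comm _ c,
              plusPart_smul, minusPart_smul, dotProduct_smul, WithLp.ofLp_zero, add_zero,
              smul_eq_mul, RingHom.id_apply]
            ring }, fun z => rfl⟩
    obtain ⟨ℓ, hℓ⟩ : ∃ ℓ : State p q m →L[ℝ] ℝ, ∀ x,
        ℓ x = inner ℝ πL x.1 + ζ ⬝ᵥ WithLp.ofLp x.2 :=
      ⟨(innerSL ℝ πL).comp (ContinuousLinearMap.fst ℝ _ _)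
        + (innerSL ℝ (WithLp.toLp 2 ζ)).comp (ContinuousLinearMap.snd ℝ _ _), fun x => by
        simp [EuclideanSpace.inner_eq_star_dotProduct, dotProduct_comm]⟩
    obtain ⟨κ, hκ⟩ : ∃ κ : State p q m →L[ℝ] ℝ, ∀ x, κ x
        = inner ℝ aL x.1 + S.bdryTerm 0 (η 0) (η 1) ζ (S.B *ᵥ control ki Ki x.2) :=
      ⟨(innerSL ℝ aL).comp (ContinuousLinearMap.fst ℝ _ _)
        + β.comp (ContinuousLinearMap.snd ℝ _ _), fun x => by simp [hβ]⟩
    have hc : Continuous fun t => (T - t) • u t := (continuous_const.sub continuous_id).smul huc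
    simp only [← hℓ, ← hκ] at h1 ⊢
    have h2 : ∫ t in (0 : ℝ)..T, (-ℓ (u t) + κ ((T - t) • u t)) = 0 := by
      refine Eq.trans (intervalIntegral.integral_congr fun t ht => ?_) h1
      rw [uIcc_of_le hT.le] at ht
      simp only [huv t ht.1]
    have hc1 : Continuous fun t => -ℓ (u t) := (ℓ.continuous.comp huc).neg
    have hc2 : Continuous fun t => κ ((T - t) • u t) := κ.continuous.comp hc
    rw [intervalIntegral.integral_add (hc1.intervalIntegrable 0 T) (hc2.intervalIntegrable 0 T), intervalIntegral.integral_neg,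
      ℓ.intervalIntegral_comp_comm (huc.intervalIntegrable 0 T),
      κ.intervalIntegral_comp_comm (hc.intervalIntegrable 0 T), hparts] at h2
    have h3 : ∫ t in (0 : ℝ)..T, u t = W T := by rw [hWdef]
    rw [h3] at h2
    linarith
  have hUz : ∀ T, 0 ≤ T → U T = 0 :=
    h.eq_zero_of_deriv U W (fun T _ => (hUd T).hasDerivWithinAt) hgen hU0
  have hWz : ∀ T, 0 ≤ T → W T = 0 := fun T hT =>
    (uniqueDiffOn_Ici (0 : ℝ) T hT).eq_deriv _ (hUd T).hasDerivWithinAt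
      ((hasDerivWithinAt_const T _ 0).congr (fun r hr => hUz r hr) (hUz T hT))
  rw [← huv t ht]
  exact (uniqueDiffOn_Ici (0 : ℝ) t ht).eq_deriv _ (hWd t).hasDerivWithinAt
    ((hasDerivWithinAt_const t _ 0).congr (fun r hr => hWz r hr) (hWz t ht))

end HypSystem

/-! ### Well-posedness, exponential stability and output regulation -/

theorem norm_le_stateNorm (v : State p q m) : ‖v‖ ≤ stateNorm v :=
  max_le (le_add_of_nonneg_right (norm_nonneg _)) (le_add_of_nonneg_left (norm_nonneg _))

theorem stateNorm_le (v : State p q m) : stateNorm v ≤ 2 * ‖v‖ := by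
  rw [stateNorm, two_mul]
  exact add_le_add (norm_fst_le v) (norm_snd_le v)

namespace HypSystem

variable {S : HypSystem p q m} {ki : ℝ} {Ki : Matrix (Fin m) (Fin m) ℝ} {wb : Idx p q → ℝ}
  {wy yref : EuclideanSpace ℝ (Fin m)} {v₀ vInf y₀ : State p q m}
  {C ρ : ℝ} {R : State p q m →L[ℝ] State p q m} {sg : ℝ → State p q m → State p q m}

/-- Every compatible initial value belongs to the domain of the generator. -/
theorem exists_isGen_of_memH1 (h : MemH1 v₀.1) (hbc : S.BoundaryCondition ki Ki wb v₀)
    (w : EuclideanSpace ℝ (Fin m)) : ∃ y, S.IsGen ki Ki wb w v₀ y := by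
  obtain ⟨g, hg⟩ := h
  refine ⟨(-(mulL2 S.Lam0_matContinuousOn g + mulL2 S.Lam1_matContinuousOn v₀.1),
    WithLp.toLp 2 (S.L1 *ᵥ traceIn (contRep v₀.1) + S.L2 *ᵥ traceOut (contRep v₀.1)) + w),
    g, contRep v₀.1, hg.isH1Rep, ?_, hbc, rfl⟩
  filter_upwards [Lp.coeFn_neg (mulL2 S.Lam0_matContinuousOn g
      + mulL2 S.Lam1_matContinuousOn v₀.1),
    Lp.coeFn_add (mulL2 S.Lam0_matContinuousOn g) (mulL2 S.Lam1_matContinuousOn v₀.1),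
    mulL2_ae S.Lam0_matContinuousOn g, mulL2_ae S.Lam1_matContinuousOn v₀.1] with s h1 h2 h3 h4
  rw [h1, Pi.neg_apply, h2, Pi.add_apply, WithLp.ofLp_neg, WithLp.ofLp_add, h3, h4]
  abel

theorem IsStrongSolution.hasDerivWithinAt {v : ℝ → State p q m}
    (h : S.IsStrongSolution ki Ki wb wy yref v₀ v) {t : ℝ} (ht : 0 ≤ t) :
    HasDerivWithinAt v (derivWithin v (Ici 0) t) (Ici 0) t :=
  (h.contDiffOn.differentiableOn one_ne_zero t ht).hasDerivWithinAt

theorem IsStrongSolution.isWeakSolution {v : ℝ → State p q m}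
    (h : S.IsStrongSolution ki Ki wb wy yref v₀ v) : S.IsWeakSolution ki Ki wb wy yref v₀ v :=
  isWeakSolution_of_isGen h.initial (fun _ ht => h.hasDerivWithinAt ht) fun _ ht => h.isGen ht

theorem isEquilibrium_of_isGen (h : S.IsGen ki Ki wb (wy - yref) vInf 0) :
    S.IsEquilibrium ki Ki wb wy yref vInf :=
  isStrongSolution_of_isGen (v' := fun _ => 0) rfl (fun t _ => hasDerivWithinAt_const t _ vInf)
    continuousOn_const fun _ _ => h

namespace IsClosedLoopSemigroup

theorem eqOn_of_isWeakSolution (h : S.IsClosedLoopSemigroup ki Ki C ρ R sg)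
    {v v' : ℝ → State p q m} (hv : S.IsWeakSolution ki Ki wb wy yref v₀ v)
    (hv' : S.IsWeakSolution ki Ki wb wy yref v₀ v') : EqOn v v' (Ici 0) := fun t ht => by
  have h1 := hv.sub hv'
  simp only [sub_self] at h1
  exact sub_eq_zero.1 (h.eq_zero_of_isWeakSolution h1 ht)

/-- The orbit is written as the equilibrium minus a homogeneous orbit, so that the difference rule
for weak solutions suffices. -/
theorem isWeakSolution_orbit (h : S.IsClosedLoopSemigroup ki Ki C ρ R sg) (hC : 0 < C)
    (hρ : 0 < ρ) (hInf : S.IsGen ki Ki wb (wy - yref) vInf 0) (v₀ : State p q m) :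
    S.IsWeakSolution ki Ki wb wy yref v₀ fun t => vInf - sg t (vInf - v₀) := by
  have h1 := (isEquilibrium_of_isGen hInf).isWeakSolution.sub (h.isWeakSolution hC hρ (vInf - v₀))
  simpa only [sub_zero, sub_sub_cancel] using h1

/-- The orbit of a point in the domain of the generator. -/
theorem isGen_orbit (h : S.IsClosedLoopSemigroup ki Ki C ρ R sg)
    (hInf : S.IsGen ki Ki wb (wy - yref) vInf 0)
    (h0 : S.IsGen ki Ki wb (wy - yref) v₀ y₀) :
    vInf - v₀ = R (-y₀) ∧ ∀ t, 0 ≤ t →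
      HasDerivWithinAt (fun t => vInf - sg t (vInf - v₀)) (-sg t (-y₀)) (Ici 0) t ∧
      S.IsGen ki Ki wb (wy - yref) (vInf - sg t (vInf - v₀)) (-sg t (-y₀)) := by
  have h1 : vInf - v₀ = R (-y₀) := by
    rw [← h.isGen_iff]
    simpa using hInf.sub h0
  refine ⟨h1, fun t ht => ?_⟩
  rw [h1]
  refine ⟨(h.hasDerivWithinAt (-y₀) t ht).const_sub vInf, ?_⟩
  have h2 : S.IsGen ki Ki 0 0 (sg t (R (-y₀))) (sg t (-y₀)) := by
    rw [h.isGen_iff, h.comm t ht]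
  simpa using hInf.sub h2

theorem isStrongSolution_orbit (h : S.IsClosedLoopSemigroup ki Ki C ρ R sg)
    (hInf : S.IsGen ki Ki wb (wy - yref) vInf 0)
    (h0 : S.IsGen ki Ki wb (wy - yref) v₀ y₀) :
    S.IsStrongSolution ki Ki wb wy yref v₀ fun t => vInf - sg t (vInf - v₀) :=
  isStrongSolution_of_isGen (by rw [h.zero, sub_sub_cancel])
    (fun t ht => ((h.isGen_orbit hInf h0).2 t ht).1) (h.continuousOn (-y₀)).neg
    fun t ht => ((h.isGen_orbit hInf h0).2 t ht).2

/-- The output error is the z-component of the time derivative, and that derivative is minus a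
semigroup orbit, which decays. No separate trace estimate is needed. -/
theorem tendsto_output (h : S.IsClosedLoopSemigroup ki Ki C ρ R sg) (hρ : 0 < ρ)
    (hInf : S.IsGen ki Ki wb (wy - yref) vInf 0)
    (h0 : S.IsGen ki Ki wb (wy - yref) v₀ y₀) {v : ℝ → State p q m}
    (hv : S.IsStrongSolution ki Ki wb wy yref v₀ v) :
    Tendsto (fun t => ‖S.output wy (v t).1 - yref‖) atTop (𝓝 0) := by
  have heq := h.eqOn_of_isWeakSolution hv.isWeakSolution
    (h.isStrongSolution_orbit hInf h0).isWeakSolution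
  have hd : ∀ t, 0 ≤ t → derivWithin v (Ici 0) t = -sg t (-y₀) := fun t ht =>
    ((((h.isGen_orbit hInf h0).2 t ht).1).congr heq (heq ht)).derivWithin
      (uniqueDiffOn_Ici 0 t ht)
  have hlim : Tendsto (fun t => C * Real.exp (-ρ * t) * ‖y₀‖) atTop (𝓝 0) := by
    have h1 : Tendsto (fun t : ℝ => -ρ * t) atTop atBot :=
      tendsto_id.const_mul_atTop_of_neg (neg_neg_of_pos hρ)
    simpa using ((Real.tendsto_exp_atBot.comp h1).const_mul C).mul_const ‖y₀‖
  refine squeeze_zero' (Eventually.of_forall fun t => norm_nonneg _) ?_ hlim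
  filter_upwards [eventually_ge_atTop (0 : ℝ)] with t ht
  rw [← hv.integrator t ht, hd t ht]
  refine (norm_snd_le _).trans ?_
  rw [norm_neg, ← norm_neg y₀]
  exact h.norm_le t ht (-y₀)

/-- The factor 2 compares the sum norm with the maximum norm in which the semigroup is estimated. -/
theorem stateNorm_sub_le (h : S.IsClosedLoopSemigroup ki Ki C ρ R sg) (hC : 0 < C) (hρ : 0 < ρ)
    (hInf : S.IsGen ki Ki wb (wy - yref) vInf 0) {v : ℝ → State p q m}
    (hv : S.IsWeakSolution ki Ki wb wy yref v₀ v) {t : ℝ} (ht : 0 ≤ t) :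
    stateNorm (v t - vInf) ≤ 2 * C * Real.exp (-ρ * t) * stateNorm (v₀ - vInf) := by
  have h1 : v t = vInf - sg t (vInf - v₀) :=
    h.eqOn_of_isWeakSolution hv (h.isWeakSolution_orbit hC hρ hInf v₀) ht
  refine (stateNorm_le _).trans ?_
  rw [h1, sub_sub_cancel_left, norm_neg, mul_assoc 2 C, mul_assoc 2]
  refine mul_le_mul_of_nonneg_left ((h.norm_le t ht _).trans ?_) zero_le_two
  rw [norm_sub_rev]
  exact mul_le_mul_of_nonneg_left (norm_le_stateNorm _) (by positivity)

end IsClosedLoopSemigroup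

end HypSystem

end HypReg
end

theorem theorem2 {p q m : ℕ} (S : HypReg.HypSystem p q m)
    (Φ Ψ : ℝ → Matrix (HypReg.Idx p q) (HypReg.Idx p q) ℝ)
    (hΦ : S.IsPhi Φ) (hΨ : S.IsPsi Ψ)
    (hISS : S.ISSAssumption) (hrank1 : S.RankCondition1 Φ) (hrank2 : S.RankCondition2 Ψ) :
    ∃ kstar : ℝ, 0 < kstar ∧ ∀ ki : ℝ, 0 < ki → ki < kstar →
      ∃ k ν : ℝ, 0 < k ∧ 0 < ν ∧
        ∀ (wb : HypReg.Idx p q → ℝ) (wy yref : EuclideanSpace ℝ (Fin m)),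
          -- well-posedness: weak solutions
          (∀ v₀ : HypReg.State p q m, ∃ v : ℝ → HypReg.State p q m,
            S.IsWeakSolution ki (S.T2 Ψ)⁻¹ wb wy yref v₀ v ∧
            ∀ v' : ℝ → HypReg.State p q m,
              S.IsWeakSolution ki (S.T2 Ψ)⁻¹ wb wy yref v₀ v' → Set.EqOn v' v (Set.Ici 0)) ∧
          -- well-posedness: strong solutions
          (∀ v₀ : HypReg.State p q m, HypReg.MemH1 v₀.1 →
            S.BoundaryCondition ki (S.T2 Ψ)⁻¹ wb v₀ →
            ∃ v : ℝ → HypReg.State p q m,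
              S.IsStrongSolution ki (S.T2 Ψ)⁻¹ wb wy yref v₀ v ∧
              S.IsWeakSolution ki (S.T2 Ψ)⁻¹ wb wy yref v₀ v ∧
              ∀ v' : ℝ → HypReg.State p q m,
                S.IsStrongSolution ki (S.T2 Ψ)⁻¹ wb wy yref v₀ v' →
                  Set.EqOn v' v (Set.Ici 0)) ∧
          -- a globally exponentially stable equilibrium
          (∃ vInf : HypReg.State p q m, S.IsEquilibrium ki (S.T2 Ψ)⁻¹ wb wy yref vInf ∧
            ∀ (v₀ : HypReg.State p q m) (v : ℝ → HypReg.State p q m),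
              S.IsWeakSolution ki (S.T2 Ψ)⁻¹ wb wy yref v₀ v → ∀ t : ℝ, 0 ≤ t →
                HypReg.stateNorm (v t - vInf)
                  ≤ k * Real.exp (-ν * t) * HypReg.stateNorm (v₀ - vInf)) ∧
          -- regulation of the output
          (∀ v₀ : HypReg.State p q m, HypReg.MemH1 v₀.1 →
            S.BoundaryCondition ki (S.T2 Ψ)⁻¹ wb v₀ →
            ∀ v : ℝ → HypReg.State p q m,
              S.IsStrongSolution ki (S.T2 Ψ)⁻¹ wb wy yref v₀ v →
                Filter.Tendsto (fun t => ‖S.output wy (v t).1 - yref‖) Filter.atTop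
                  (nhds 0)) := by

  obtain ⟨kstar, hkstar, hk⟩ := HypReg.HypSystem.exists_closedLoopSemigroup hΦ hΨ hISS hrank1 hrank2
  refine ⟨kstar, hkstar, fun ki hki hlt => ?_⟩
  obtain ⟨C, ρ, R, sg, hC, hρ, h⟩ := hk ki hki hlt
  -- The constants come from the homogeneous semigroup, so they are fixed before the disturbances
  -- and the reference.
  refine ⟨2 * C, ρ, by positivity, hρ, fun wb wy yref => ?_⟩
  obtain ⟨vInf, hInf⟩ := HypReg.HypSystem.exists_isGen_zero hΦ hΨ hrank1 hki.ne'
    (Ki := (S.T2 Ψ)⁻¹) (by simpa using hrank2.2) wb (wy - yref)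
  refine ⟨fun v₀ => ⟨_, h.isWeakSolution_orbit hC hρ hInf v₀, fun v' hv' =>
      h.eqOn_of_isWeakSolution hv' (h.isWeakSolution_orbit hC hρ hInf v₀)⟩,
    fun v₀ hH1 hbc => ?_, ⟨vInf, HypReg.HypSystem.isEquilibrium_of_isGen hInf,
      fun v₀ v hv t ht => h.stateNorm_sub_le hC hρ hInf hv ht⟩,
    fun v₀ hH1 hbc v hv => ?_⟩
  · obtain ⟨y₀, h0⟩ := HypReg.HypSystem.exists_isGen_of_memH1 hH1 hbc (wy - yref)
    have hs := h.isStrongSolution_orbit hInf h0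
    exact ⟨_, hs, hs.isWeakSolution, fun v' hv' =>
      h.eqOn_of_isWeakSolution hv'.isWeakSolution hs.isWeakSolution⟩
  · obtain ⟨y₀, h0⟩ := HypReg.HypSystem.exists_isGen_of_memH1 hH1 hbc (wy - yref)
    exact h.tendsto_output hρ hInf h0 hv
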